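/- Let $\mathbb T=[-\pi,\pi]$ with endpoints identified; $H^m(\mathbb T)$ is the space of real $2\pi$-periodic functions whose weak derivatives up to order $m$ belong to $L^2(\mathbb T)$. Let $$Hf(\theta)=\frac1{2\pi}\,\mathrm{p.v.}\!\int_{-\pi}^{\pi}\cot\Big(\frac{\theta-\vartheta}{2}\Big)f(\vartheta)\,d\vartheta$$ be the periodic Hilbert transform, $\{f,g\}=f\,\partial_\theta g-g\,\partial_\theta f$, $\rho_2(\theta)=\frac{1}{4\pi\sin^2\theta}$, and let $\rho_2^{1/2}(\theta)=\frac{1}{2\sqrt\pi\,\sin\theta}$ denote the square root of $\rho_2$ that carries the sign of $\sin\theta$. Consider on $\mathbb T$ the system $$\partial_t\eta^{+}=\big\{\tfrac12\eta^{+}+v^{+},\,\sin 2\theta\big\},\qquad \partial_t\eta^{-}=\big\{\tfrac12\eta^{-}-v^{-},\,\sin 2\theta\big\},\qquad \partial_\theta v^{\pm}=H\eta^{\pm},\quad v^{\pm}(t,0)=0,$$ which is the linearization around the first excited state $\omega^\pm=-\sin 2\theta$, in the variables $\omega^{\pm}=-\sin 2\theta+(\eta^{+}\pm\eta^{-})$,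 of the one-dimensional MHD model $\partial_t\omega^{\pm}+u^{\mp}\partial_\theta\omega^{\pm}=\omega^{\pm}H\omega^{\mp}$, $\partial_\theta u^{\pm}=H\omega^{\pm}$, $u^\pm(t,0)=0$. **Theorem.** Let $m>3$ be an integer and let $\eta_0^{+},\eta_0^{-}:\mathbb T\to\mathbb R$ be odd, periodic and absolutely continuous with $\rho_2^{1/2}\partial_\theta\eta_0^{\pm}\in H^m(\mathbb T)$. Then for every $T>0$ there is exactly one classical odd solution $(\eta^{+},\eta^{-})$ of the system on $[0,T]$ with $\eta^{\pm}(0,\cdot)=\eta_0^{\pm}$; that is, exactly one pair of functions that are $2\pi$-periodic and odd in $\theta$, are of class $C^1$ on $[0,T]\times\mathbb R$, satisfy the equations at every point of $[0,T]\times\mathbb R$ (with one-sided time derivatives at $t=0,T$), and have the given initial values. It satisfies $$\rho_2^{1/2}\,\partial_\theta\eta^{\pm}\in C([0,T];H^m(\mathbb T))\cap C^2([0,T];H^{m-2}(\mathbb T)).$$ Moreover, with $e_{2,k}(\theta)=\frac{\sin((k+2)\theta)}{k+2}-\frac{\sin(k\theta)}{k}$, the coefficients $\eta^{\pm}_{2,k}(t)=\int_{-\pi}^{\pi}\rho_2\,\partial_\theta\eta^{\pm}(t,\theta)\,e_{2,k}'(\theta)\,d\theta$,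 $k\ge1$, are of class $C^2$ on $[0,T]$, and there is a constant $C$, independent of $k$ and $t$, such that for all $k\ge1$ $$\sup_{0\le t\le T}\big|\eta_{2,k}^{\pm}(t)\big|\le\frac{C}{k^{m}},\qquad \sup_{0\le t\le T}\Big|\frac{d}{dt}\eta_{2,k}^{\pm}(t)\Big|\le\frac{C}{k^{m-1}},\qquad \sup_{0\le t\le T}\Big|\frac{d^2}{dt^2}\eta_{2,k}^{\pm}(t)\Big|\le\frac{C}{k^{m-2}}.$$ -/

import Mathlib

open Real Set Filter Topology MeasureTheory
open scoped ContDiff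

noncomputable section

namespace MHD

/-! ### Sobolev spaces on the torus `[-π, π]` -/

/-- Lebesgue measure on one period. -/
abbrev circleMeasure : Measure ℝ := volume.restrict (Ioc (-π) π)

/-- The space `L²(𝕋)` of real-valued square integrable functions on the torus. -/
abbrev L2 : Type := Lp ℝ 2 circleMeasure

/-- `g` is the `k`-th weak derivative of `f` on the torus: the identity of integration by parts holds
against every smooth `2π`-periodic test function. -/
def HasWeakDeriv (k : ℕ) (f g : ℝ → ℝ) : Prop :=
  ∀ φ : ℝ → ℝ, ContDiff ℝ ∞ φ → Function.Periodic φ (2 * π) →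
    ∫ θ, f θ * iteratedDeriv k φ θ ∂circleMeasure =
      (-1) ^ k * ∫ θ, g θ * φ θ ∂circleMeasure

theorem integrable_mul_of_continuous (f : L2) {φ : ℝ → ℝ} (hφ : Continuous φ) :
    Integrable (fun θ => f θ * φ θ) circleMeasure := by
  have hf : Integrable f circleMeasure := (Lp.memLp f).integrable (by norm_num)
  obtain ⟨C, hC⟩ := (isCompact_Icc (a := -π) (b := π)).exists_bound_of_continuousOn hφ.continuousOn
  refine hf.mul_bdd (c := C) hφ.aestronglyMeasurable ?_
  filter_upwards [ae_restrict_mem measurableSet_Ioc] with θ hθ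
  exact hC θ (Ioc_subset_Icc_self hθ)

/-- The Sobolev space `H^m(𝕋)`. An element is the tuple `(f, f', …, f^(m))` of a function in `L²(𝕋)`
and its weak derivatives, all in `L²(𝕋)`; the norm is `(∑ ‖f^(k)‖²)^(1/2)`. -/
def Sobolev (m : ℕ) : Submodule ℝ (PiLp 2 (fun _ : Fin (m + 1) => L2)) where
  carrier := {g | ∀ k : Fin (m + 1), HasWeakDeriv k (g 0) (g k)}
  zero_mem' := by
    intro k φ _ _
    have h : ∀ ψ : ℝ → ℝ, ∫ θ, (0 : L2) θ * ψ θ ∂circleMeasure = 0 := by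
      intro ψ
      rw [integral_congr_ae (g := fun _ => (0 : ℝ)), integral_zero]
      filter_upwards [Lp.coeFn_zero ℝ 2 circleMeasure] with θ hθ
      rw [hθ]; simp
    change ∫ θ, (0 : L2) θ * iteratedDeriv k φ θ ∂circleMeasure =
      (-1) ^ (k : ℕ) * ∫ θ, (0 : L2) θ * φ θ ∂circleMeasure
    rw [h, h, mul_zero]
  add_mem' := by
    intro a b ha hb k φ hφ hper
    have h : ∀ (x y : L2) (ψ : ℝ → ℝ), Continuous ψ →
        ∫ θ, (x + y : L2) θ * ψ θ ∂circleMeasure =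
          ∫ θ, x θ * ψ θ ∂circleMeasure + ∫ θ, y θ * ψ θ ∂circleMeasure := by
      intro x y ψ hψ
      rw [← integral_add (integrable_mul_of_continuous x hψ) (integrable_mul_of_continuous y hψ)]
      refine integral_congr_ae ?_
      filter_upwards [Lp.coeFn_add x y] with θ hθ
      rw [hθ, Pi.add_apply, add_mul]
    have hd : Continuous (iteratedDeriv k φ) :=
      hφ.continuous_iteratedDeriv k (by exact_mod_cast le_top)
    simp only [PiLp.add_apply]
    rw [h _ _ _ hd, h _ _ _ hφ.continuous, ha k φ hφ hper, hb k φ hφ hper, mul_add]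
  smul_mem' := by
    intro c a ha k φ hφ hper
    have h : ∀ (x : L2) (ψ : ℝ → ℝ),
        ∫ θ, (c • x : L2) θ * ψ θ ∂circleMeasure = c * ∫ θ, x θ * ψ θ ∂circleMeasure := by
      intro x ψ
      rw [← integral_const_mul]
      refine integral_congr_ae ?_
      filter_upwards [Lp.coeFn_smul c x] with θ hθ
      rw [hθ, Pi.smul_apply, smul_eq_mul, mul_assoc]
    simp only [PiLp.smul_apply]
    rw [h, h, ha k φ hφ hper]
    ring

/-- The inclusion `H^m(𝕋) ⊆ H^k(𝕋)` for `k ≤ m`: forget the derivatives of order above `k`. -/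
def Sobolev.incl {k m : ℕ} (h : k ≤ m) (W : Sobolev m) : Sobolev k :=
  ⟨WithLp.toLp 2 fun j => W.1 (Fin.castLE (Nat.succ_le_succ h) j),
    fun j => W.2 (Fin.castLE (Nat.succ_le_succ h) j)⟩

/-- The element `W` of `H^m(𝕋)` is the function `w` (as a class modulo null sets). -/
def Represents {m : ℕ} (W : Sobolev m) (w : ℝ → ℝ) : Prop :=
  (W.1 0 : ℝ → ℝ) =ᵐ[circleMeasure] w

/-! ### The weight and the basis -/

/-- The weight `ρ₂ = 1 / (4π sin² θ)`. -/
def rho (θ : ℝ) : ℝ := 1 / (4 * π * sin θ ^ 2)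

/-- The weighted derivative `ρ₂^{1/2} ∂_θ f`, where `ρ₂^{1/2} = 1 / (2 √π sin θ)` is the square root
of `ρ₂` that is smooth across `θ = 0`. -/
def weightedDeriv (f : ℝ → ℝ) (θ : ℝ) : ℝ := 1 / (2 * √π * sin θ) * deriv f θ

/-- The functions `e_{2,k} = sin((k+2)θ)/(k+2) - sin(kθ)/k`. -/
def e (k : ℕ) (θ : ℝ) : ℝ := sin ((k + 2) * θ) / (k + 2) - sin (k * θ) / k

/-- The coefficient `⟨f, e_{2,k}⟩ = ∫ ρ₂ f' e_{2,k}' dθ` of `f` in the basis `e_{2,k}`. -/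
def coeff (k : ℕ) (f : ℝ → ℝ) : ℝ := ∫ θ in (-π)..π, rho θ * deriv f θ * deriv (e k) θ

/-! ### The linearized system -/

/-- `h = H f (θ)`, for the Hilbert transform
`H f (θ) = (1 / 2π) p.v. ∫ cot((θ - ϑ) / 2) f(ϑ) dϑ` over a period of the `2π`-periodic function `f`;
the principal value is required to exist. -/
def HasHilbert (f : ℝ → ℝ) (θ h : ℝ) : Prop :=
  Tendsto (fun ε : ℝ => 1 / (2 * π) *
      ∫ ϑ in {ϑ : ℝ | ε ≤ |θ - ϑ| ∧ |θ - ϑ| ≤ π}, Real.cot ((θ - ϑ) / 2) * f ϑ)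
    (𝓝[>] 0) (𝓝 h)

/-- `v` is the velocity of `f`: `∂_θ v = H f` and `v(0) = 0`. -/
def IsVelocity (f v : ℝ → ℝ) : Prop :=
  v 0 = 0 ∧ ∀ θ : ℝ, ∃ h : ℝ, HasHilbert f θ h ∧ HasDerivAt v h θ

/-- The bracket `{f, g} = f ∂_θ g - g ∂_θ f`. -/
def bracket (f g : ℝ → ℝ) (θ : ℝ) : ℝ := f θ * deriv g θ - g θ * deriv f θ

/-- `η` is a classical odd solution on `[0, T]` of `∂_t η = {η/2 + σ v, sin 2θ}`, `∂_θ v = H η`,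
`v(t, 0) = 0`, with initial value `η₀`: it is `2π`-periodic and odd in `θ`, of class `C¹` on
`[0, T] × ℝ`, and the equation holds at every point (with one-sided time derivatives at `0` and `T`). -/
structure IsClassicalOddSolution (σ T : ℝ) (η₀ : ℝ → ℝ) (η : ℝ → ℝ → ℝ) : Prop where
  contDiffOn : ContDiffOn ℝ 1 (fun p : ℝ × ℝ => η p.1 p.2) (Icc 0 T ×ˢ univ)
  periodic : ∀ t ∈ Icc 0 T, Function.Periodic (η t) (2 * π)
  odd : ∀ t ∈ Icc 0 T, Function.Odd (η t)
  initial : ∀ θ, η 0 θ = η₀ θ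
  equation : ∀ t ∈ Icc 0 T, ∃ v : ℝ → ℝ, IsVelocity (η t) v ∧
    ∀ θ : ℝ, HasDerivWithinAt (fun s => η s θ)
      (bracket (fun x => 1 / 2 * η t x + σ * v x) (fun x => sin (2 * x)) θ) (Icc 0 T) t

/-- The pair `(η⁺, η⁻)` is a classical odd solution of the linearized system: `σ = 1` for `η⁺` and
`σ = -1` for `η⁻`. -/
def IsClassicalOddSolutionPair (T : ℝ) (η₀p η₀m : ℝ → ℝ) (ηp ηm : ℝ → ℝ → ℝ) : Prop :=
  IsClassicalOddSolution 1 T η₀p ηp ∧ IsClassicalOddSolution (-1) T η₀m ηm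

/-- Odd `2π`-periodic initial data, absolutely continuous (so that `∂_θ η₀` makes sense almost
everywhere), with `ρ₂^{1/2} ∂_θ η₀ ∈ H^m(𝕋)`. -/
structure IsAdmissibleData (m : ℕ) (η₀ : ℝ → ℝ) : Prop where
  periodic : Function.Periodic η₀ (2 * π)
  odd : Function.Odd η₀
  absCont : AbsolutelyContinuousOnInterval η₀ (-π) π
  weighted : ∃ W : Sobolev m, Represents W (weightedDeriv η₀)

/-- `ρ₂^{1/2} ∂_θ η ∈ C([0,T]; H^m(𝕋)) ∩ C²([0,T]; H^k(𝕋))`, where `k ≤ m`. -/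
def HasWeightedRegularity {k m : ℕ} (h : k ≤ m) (T : ℝ) (η : ℝ → ℝ → ℝ) : Prop :=
  ∃ W : ℝ → Sobolev m,
    (∀ t ∈ Icc 0 T, Represents (W t) (weightedDeriv (η t))) ∧
    ContinuousOn W (Icc 0 T) ∧
    ContDiffOn ℝ 2 (fun t => Sobolev.incl h (W t)) (Icc 0 T)

/-- The coefficients `η_{2,k}(t)`, `k ≥ 1`, are twice continuously differentiable on `[0, T]`, and for
`j = 0, 1, 2` their `j`-th time derivatives are bounded by `C / k^(m-j)` on `[0, T]`, with `C`
independent of `k` and `t`. -/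
def HasCoeffDecay (m : ℕ) (T : ℝ) (η : ℝ → ℝ → ℝ) : Prop :=
  ∃ C : ℝ, ∀ k : ℕ, 1 ≤ k →
    ContDiffOn ℝ 2 (fun t => coeff k (η t)) (Icc 0 T) ∧
    ∀ j : ℕ, j ≤ 2 → ∀ t ∈ Icc 0 T,
      |iteratedDerivWithin j (fun s => coeff k (η s)) (Icc 0 T) t| ≤ C / (k : ℝ) ^ (m - j)

end MHD

end

/-! The two equations are decoupled: η⁺ and η⁻ solve the same scalar equation ∂_t η = {η/2 + σ v,
sin 2θ} with σ = 1 and σ = -1, and the argument works for every |σ| ≤ 1.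

Existence. Since ∂_θ e_{2,k} = -2 sin θ sin((k+1)θ), the weighted derivative sends e_{2,k} to
-sin((k+1)θ)/√π. Hence H^m regularity of ρ₂^{1/2} ∂_θ η amounts to square summability of the
coefficients with weight of order k^m (`IsAdmissibleData.exists_eq_profile`). In this basis the
linearized operator couples k only with k ± 2; its off-diagonal entries grow linearly but are
exactly antisymmetric, and its diagonal is bounded (`bracket_mode`, `almostSkew_mode`). The energy
in ℓ² therefore grows at most exponentially. Conjugation by powers of the weight perturbs the
entries by relative size O(1/k), so the symmetric part stays bounded and the same estimate holds in
every weighted space (`AlmostSkew.mul_ratio_pow`). The flow is the limit of the exponentials of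
truncated operators (`AlmostSkew.exists_flow`). Each time derivative costs one factor k, which gives
both C² regularity in H^{m-2} and the decay of the coefficients.

Uniqueness. A classical odd solution need not have a weighted derivative in L², so the basis e_{2,k}
is not available. Testing the equation against sin((i+1)θ) instead gives another almost skew second
neighbour system, for coefficients known only to be bounded (`almostSkew_sine`). Dividing them by i
+ 2 makes the boundary terms of the truncated energy vanish in the limit
(`AlmostSkew.eq_zero_of_hasDerivAt`). Completeness of the trigonometric system then identifies the
two solutions. -/

noncomputable section

namespace MHD

/-! ### Almost skew-symmetric second neighbour systems in `ℓ²` -/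

/-- The space `ℓ²(ℕ)` of real sequences. -/
abbrev Seq : Type := lp (fun _ : ℕ => ℝ) 2

theorem memℓp_two_iff {x : ℕ → ℝ} : Memℓp x 2 ↔ Summable fun i => x i ^ 2 := by
  rw [memℓp_gen_iff (by norm_num)]
  simp

theorem Seq.summable_sq (x : Seq) : Summable fun i => x i ^ 2 :=
  memℓp_two_iff.1 (lp.memℓp x)

theorem Seq.norm_sq (x : Seq) : ‖x‖ ^ 2 = ∑' i, x i ^ 2 := by
  have := lp.norm_rpow_eq_tsum (p := 2) (by norm_num) x
  simpa using this

theorem Seq.abs_apply_le (x : Seq) (i : ℕ) : |x i| ≤ ‖x‖ :=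
  lp.norm_apply_le_norm (by norm_num) x i

theorem summable_weighted (x : Seq) (p : ℕ) {a : ℕ → ℝ} {C : ℝ} (h : ∀ i, |a i| ≤ C) :
    Summable (fun i => (a i * x (i + p)) ^ 2) ∧
      ∑' i, (a i * x (i + p)) ^ 2 ≤ C ^ 2 * ‖x‖ ^ 2 := by
  have hx : Summable fun i => x (i + p) ^ 2 := (summable_nat_add_iff p).2 x.summable_sq
  have hle : ∀ i, (a i * x (i + p)) ^ 2 ≤ C ^ 2 * x (i + p) ^ 2 := fun i => by
    rw [mul_pow]
    refine mul_le_mul_of_nonneg_right ?_ (sq_nonneg _)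
    exact sq_le_sq.2 ((h i).trans (le_abs_self C))
  have hs : Summable (fun i => (a i * x (i + p)) ^ 2) :=
    Summable.of_nonneg_of_le (fun i => sq_nonneg _) hle (hx.mul_left _)
  refine ⟨hs, (hs.tsum_le_tsum hle (hx.mul_left _)).trans ?_⟩
  rw [tsum_mul_left, x.norm_sq, ← x.summable_sq.sum_add_tsum_nat_add p]
  gcongr
  linarith [Finset.sum_nonneg fun i (_ : i ∈ Finset.range p) => sq_nonneg (x i)]

theorem exists_weightedShift (p : ℕ) (a : ℕ → ℝ) (C : ℝ) (h : ∀ i, |a i| ≤ C) :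
    ∃ S : Seq →L[ℝ] Seq, ∀ x i, S x i = a i * x (i + p) := by
  have hC : 0 ≤ C := (abs_nonneg _).trans (h 0)
  let S : Seq →ₗ[ℝ] Seq :=
    { toFun := fun x => ⟨fun i => a i * x (i + p), memℓp_two_iff.2 (summable_weighted x p h).1⟩
      map_add' := fun x y => by
        ext i
        change a i * (x + y : Seq) (i + p) = a i * x (i + p) + a i * y (i + p)
        rw [lp.coeFn_add, Pi.add_apply, mul_add]
      map_smul' := fun c x => by
        ext i
        change a i * (c • x : Seq) (i + p) = c * (a i * x (i + p))
        rw [lp.coeFn_smul, Pi.smul_apply, smul_eq_mul]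
        ring }
  refine ⟨S.mkContinuous C fun x => ?_, fun x i => rfl⟩
  refine (sq_le_sq₀ (norm_nonneg _) (by positivity)).1 ?_
  rw [Seq.norm_sq, mul_pow]
  exact (summable_weighted x p h).2

open Classical in
/-- The operator `(S x) i = a i * x (i + p)` on `ℓ²`, for a bounded sequence `a` (and `0` if `a` is
unbounded). -/
def weightedShift (p : ℕ) (a : ℕ → ℝ) : Seq →L[ℝ] Seq :=
  if h : ∃ C, ∀ i, |a i| ≤ C then (exists_weightedShift p a h.choose h.choose_spec).choose else 0

theorem weightedShift_apply {p : ℕ} {a : ℕ → ℝ} {C : ℝ} (h : ∀ i, |a i| ≤ C) (x : Seq) (i : ℕ) :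
    weightedShift p a x i = a i * x (i + p) := by
  have h' : ∃ C, ∀ i, |a i| ≤ C := ⟨C, h⟩
  rw [weightedShift, dif_pos h']
  exact (exists_weightedShift p a h'.choose h'.choose_spec).choose_spec x i

theorem norm_weightedShift_le {p : ℕ} {a : ℕ → ℝ} {C : ℝ} (h : ∀ i, |a i| ≤ C) :
    ‖weightedShift p a‖ ≤ C := by
  have hC : 0 ≤ C := (abs_nonneg _).trans (h 0)
  refine ContinuousLinearMap.opNorm_le_bound _ hC fun x => (sq_le_sq₀ (norm_nonneg _) (by positivity)).1 ?_
  rw [Seq.norm_sq, mul_pow]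
  simp only [weightedShift_apply h]
  exact (summable_weighted x p h).2

theorem adjoint_weightedShift_apply {p : ℕ} {a : ℕ → ℝ} {C : ℝ} (h : ∀ i, |a i| ≤ C) (x : Seq)
    (i : ℕ) : ContinuousLinearMap.adjoint (weightedShift p a) x i =
      if p ≤ i then a (i - p) * x (i - p) else 0 := by
  have key : ContinuousLinearMap.adjoint (weightedShift p a) x i =
      inner ℝ (weightedShift p a (lp.single 2 i 1)) x := by
    rw [← ContinuousLinearMap.adjoint_inner_right, lp.inner_single_left]
    simp
  rw [key]
  have hs : ∀ j, weightedShift p a (lp.single 2 i 1) j = if j + p = i then a j else 0 := fun j => by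
    rw [weightedShift_apply h, lp.single_apply]
    by_cases hj : j + p = i
    · subst hj; simp
    · rw [Pi.single_eq_of_ne hj, if_neg hj, mul_zero]
  have hsum := lp.hasSum_inner (𝕜 := ℝ) (weightedShift p a (lp.single 2 i 1)) x
  simp only [hs] at hsum
  split_ifs with hp
  · refine hsum.unique ?_
    convert hasSum_single (i - p) ?_ using 1
    · rw [if_pos (Nat.sub_add_cancel hp)]
      simp [mul_comm]
    · intro j hj
      rw [if_neg (by omega), inner_zero_left]
  · refine hsum.unique ?_
    convert hasSum_zero using 1
    ext j
    rw [if_neg (by omega), inner_zero_left]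

/-- The `i`-th component of the right-hand side of the system
`x_i' = l_{i-2} x_{i-2} + d_i x_i + u_i x_{i+2}`. -/
def neighbourSum (l d u x : ℕ → ℝ) (i : ℕ) : ℝ :=
  (if 2 ≤ i then l (i - 2) * x (i - 2) else 0) + d i * x i + u i * x (i + 2)

/-- The operator with components `neighbourSum l d u`, for bounded coefficients. -/
def neighbourOp (l d u : ℕ → ℝ) : Seq →L[ℝ] Seq :=
  ContinuousLinearMap.adjoint (weightedShift 2 l) + weightedShift 0 d + weightedShift 2 u

theorem neighbourOp_apply {l d u : ℕ → ℝ} {C : ℝ} (hl : ∀ i, |l i| ≤ C) (hd : ∀ i, |d i| ≤ C)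
    (hu : ∀ i, |u i| ≤ C) (x : Seq) (i : ℕ) : neighbourOp l d u x i = neighbourSum l d u x i := by
  simp only [neighbourOp, add_apply, lp.coeFn_add, Pi.add_apply,
    adjoint_weightedShift_apply hl, weightedShift_apply hd, weightedShift_apply hu, neighbourSum,
    add_zero]

/-- In the quadratic form the adjoint can be moved to the other side, so `l` and `u` enter only
through `l + u`. The bound `D`, which degenerates as a truncation is removed, does not appear in the
result. -/
theorem abs_inner_neighbourOp_le {l d u : ℕ → ℝ} {C D : ℝ} (hl : ∀ i, |l i| ≤ D)
    (hd : ∀ i, |d i| ≤ C) (hu : ∀ i, |u i| ≤ D) (hlu : ∀ i, |l i + u i| ≤ C) (x : Seq) :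
    |inner ℝ (neighbourOp l d u x) x| ≤ 2 * C * ‖x‖ ^ 2 := by
  have hadd : weightedShift 2 l x + weightedShift 2 u x = weightedShift 2 (fun i => l i + u i) x := by
    ext i
    rw [lp.coeFn_add, Pi.add_apply, weightedShift_apply hl, weightedShift_apply hu,
      weightedShift_apply hlu, add_mul]
  have h1 : inner ℝ (neighbourOp l d u x) x =
      inner ℝ (weightedShift 2 (fun i => l i + u i) x) x + inner ℝ (weightedShift 0 d x) x := by
    rw [← hadd, neighbourOp, add_apply, add_apply,
      inner_add_left, inner_add_left, inner_add_left, ContinuousLinearMap.adjoint_inner_left,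
      real_inner_comm x (weightedShift 2 l x)]
    ring
  have hb : ∀ {p : ℕ} {a : ℕ → ℝ}, (∀ i, |a i| ≤ C) →
      |inner ℝ (weightedShift p a x) x| ≤ C * ‖x‖ ^ 2 := fun {p a} ha => by
    refine (abs_real_inner_le_norm _ _).trans ?_
    have := ContinuousLinearMap.le_of_opNorm_le _ (norm_weightedShift_le (p := p) ha) x
    nlinarith [norm_nonneg x]
  rw [h1]
  refine (abs_add_le _ _).trans ?_
  linarith [hb (p := 2) hlu, hb (p := 0) hd]

theorem norm_neighbourOp_zero_le {l u : ℕ → ℝ} {δ : ℝ} (hl : ∀ i, |l i| ≤ δ)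
    (hu : ∀ i, |u i| ≤ δ) : ‖neighbourOp l 0 u‖ ≤ 2 * δ := by
  have h0 : ‖weightedShift 0 0‖ ≤ 0 := norm_weightedShift_le (by simp)
  refine (norm_add₃_le).trans ?_
  rw [LinearIsometryEquiv.norm_map]
  linarith [norm_weightedShift_le (p := 2) hl, norm_weightedShift_le (p := 2) hu]

/-- The coefficients grow at most linearly, and the symmetric part of the system is bounded. -/
structure AlmostSkew (l d u : ℕ → ℝ) (C : ℝ) : Prop where
  lower : ∀ i : ℕ, |l i| ≤ C * (i + 2)
  upper : ∀ i : ℕ, |u i| ≤ C * (i + 2)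
  diag : ∀ i : ℕ, |d i| ≤ C
  skew : ∀ i : ℕ, |l i + u i| ≤ C

/-- The ratio of consecutive weights. -/
def ratio (i : ℕ) : ℝ := ((i : ℝ) + 4) / (i + 2)

theorem ratio_pos (i : ℕ) : 0 < ratio i := by unfold ratio; positivity

theorem ratio_sub_one (i : ℕ) : ratio i - 1 = 2 / (i + 2) := by
  unfold ratio; field_simp; ring

theorem one_le_ratio (i : ℕ) : 1 ≤ ratio i := by
  have : 0 ≤ ratio i - 1 := by rw [ratio_sub_one]; positivity
  linarith

theorem ratio_le_two (i : ℕ) : ratio i ≤ 2 := by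
  unfold ratio
  rw [div_le_iff₀ (by positivity)]
  have : (0 : ℝ) ≤ i := Nat.cast_nonneg i
  linarith

theorem AlmostSkew.nonneg {l d u : ℕ → ℝ} {C : ℝ} (h : AlmostSkew l d u C) : 0 ≤ C :=
  (abs_nonneg _).trans (h.diag 0)

/-- `ratio i - 1 = 2 / (i + 2)` cancels the linear growth of the coefficient exactly. -/
theorem abs_mul_ratio_sub_one_le {a C : ℝ} {i : ℕ} (h : |a| ≤ C * (i + 2)) :
    |a * (ratio i - 1)| ≤ 2 * C := by
  rw [abs_mul, ratio_sub_one, abs_of_nonneg (by positivity : 0 ≤ 2 / ((i : ℝ) + 2))]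
  calc |a| * (2 / ((i : ℝ) + 2)) ≤ C * (i + 2) * (2 / ((i : ℝ) + 2)) := by gcongr
    _ = 2 * C := by field_simp

theorem abs_mul_inv_ratio_sub_one_le {a C : ℝ} {i : ℕ} (h : |a| ≤ C * (i + 2)) :
    |a * ((ratio i)⁻¹ - 1)| ≤ 2 * C := by
  have h1 : a * ((ratio i)⁻¹ - 1) = -(a * (ratio i - 1)) * (ratio i)⁻¹ := by
    have := (ratio_pos i).ne'
    field_simp
    ring
  rw [h1, abs_mul, abs_neg, abs_of_pos (inv_pos.2 (ratio_pos i))]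
  have h2 := abs_mul_ratio_sub_one_le h
  have := ratio_pos i
  have := inv_le_one_of_one_le₀ (one_le_ratio i)
  calc _ ≤ 2 * C * 1 := by gcongr; exact (abs_nonneg _).trans h2
    _ = _ := mul_one _

/-- This is conjugation by the diagonal weight `i + 2`. It changes `l i + u i` by two errors of size
at most `2 * C` each, whence `5 * C`. -/
theorem AlmostSkew.mul_ratio {l d u : ℕ → ℝ} {C : ℝ} (h : AlmostSkew l d u C) :
    AlmostSkew (fun i => l i * ratio i) d (fun i => u i * (ratio i)⁻¹) (5 * C) where
  lower i := by
    have := h.nonneg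
    have := ratio_pos i
    rw [abs_mul, abs_of_pos (ratio_pos i)]
    calc |l i| * ratio i ≤ C * (i + 2) * 2 := by
          gcongr
          exacts [h.lower i, ratio_le_two i]
      _ ≤ 5 * C * (i + 2) := by nlinarith [mul_nonneg h.nonneg (by positivity : (0 : ℝ) ≤ (i : ℝ) + 2)]
  upper i := by
    have := h.nonneg
    have := ratio_pos i
    rw [abs_mul, abs_of_pos (inv_pos.2 (ratio_pos i))]
    calc |u i| * (ratio i)⁻¹ ≤ C * (i + 2) * 1 := by
          gcongr
          exacts [h.upper i, inv_le_one_of_one_le₀ (one_le_ratio i)]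
      _ ≤ 5 * C * (i + 2) := by nlinarith [mul_nonneg h.nonneg (by positivity : (0 : ℝ) ≤ (i : ℝ) + 2)]
  diag i := by linarith [h.diag i, h.nonneg]
  skew i := by
    have e : l i * ratio i + u i * (ratio i)⁻¹ =
        l i * (ratio i - 1) + u i * ((ratio i)⁻¹ - 1) + (l i + u i) := by ring
    rw [e]
    refine (abs_add_three _ _ _).trans ?_
    linarith [abs_mul_ratio_sub_one_le (h.lower i), abs_mul_inv_ratio_sub_one_le (h.upper i),
      h.skew i]

/-- Conjugation by the inverse weight is the previous case with the roles of `l` and `u` exchanged.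
-/
theorem AlmostSkew.div_ratio {l d u : ℕ → ℝ} {C : ℝ} (h : AlmostSkew l d u C) :
    AlmostSkew (fun i => l i * (ratio i)⁻¹) d (fun i => u i * ratio i) (5 * C) := by
  have h' : AlmostSkew u d l C := ⟨h.upper, h.lower, h.diag, fun i => by rw [add_comm]; exact h.skew i⟩
  have := h'.mul_ratio
  exact ⟨this.upper, this.lower, this.diag, fun i => by rw [add_comm]; exact this.skew i⟩

theorem AlmostSkew.mul_ratio_pow {l d u : ℕ → ℝ} {C : ℝ} (h : AlmostSkew l d u C) (s : ℕ) :
    AlmostSkew (fun i => l i * ratio i ^ s) d (fun i => u i * (ratio i ^ s)⁻¹) (5 ^ s * C) := by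
  induction s with
  | zero => simpa using h
  | succ s ih =>
    have := ih.mul_ratio
    simp only [mul_assoc, ← pow_succ, ← mul_inv] at this
    rwa [← mul_assoc, mul_comm, ← pow_succ', mul_comm] at this

/-! ### Energy estimates -/

/-- The function `exp (-K * s) * E s - ε * s` is nonincreasing, because `exp (-K * s) ≤ 1` on the
interval. -/
theorem gronwall_of_hasDerivAt {E E' : ℝ → ℝ} {T K ε : ℝ} (hK : 0 ≤ K) (hε : 0 ≤ ε)
    (hc : ContinuousOn E (Icc 0 T)) (hd : ∀ t ∈ Ioo 0 T, HasDerivAt E (E' t) t)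
    (hle : ∀ t ∈ Ioo 0 T, E' t ≤ K * E t + ε) {t : ℝ} (ht : t ∈ Icc 0 T) :
    E t ≤ exp (K * t) * (E 0 + ε * t) := by
  have hder : ∀ s ∈ Ioo 0 T, HasDerivAt (fun s => exp (-K * s) * E s - ε * s)
      (exp (-K * s) * (-K) * E s + exp (-K * s) * E' s - ε) s := fun s hs => by
    have h1 : HasDerivAt (fun s => exp (-K * s)) (exp (-K * s) * (-K)) s := by
      simpa using ((hasDerivAt_id s).const_mul (-K)).exp
    convert! (h1.mul (hd s hs)).sub ((hasDerivAt_id s).const_mul ε) using 1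
    simp
  have hanti : AntitoneOn (fun s => exp (-K * s) * E s - ε * s) (Icc 0 T) := by
    refine antitoneOn_of_deriv_nonpos (convex_Icc 0 T) ?_ ?_ ?_
    · exact ((by fun_prop : Continuous fun s : ℝ => exp (-K * s)).continuousOn.mul hc).sub
        (by fun_prop : Continuous fun s : ℝ => ε * s).continuousOn
    · rw [interior_Icc]
      exact fun s hs => (hder s hs).differentiableAt.differentiableWithinAt
    · rw [interior_Icc]
      intro s hs
      rw [(hder s hs).deriv]
      have h1 : exp (-K * s) ≤ 1 := exp_le_one_iff.2 (by nlinarith [hs.1])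
      nlinarith [hle s hs, exp_pos (-K * s)]
  have h0 : (0 : ℝ) ∈ Icc 0 T := ⟨le_rfl, ht.1.trans ht.2⟩
  have := hanti h0 ht ht.1
  simp only [mul_zero, exp_zero, one_mul, sub_zero] at this
  have h2 : E t = exp (K * t) * (exp (-K * t) * E t) := by
    rw [← mul_assoc, ← exp_add]; simp
  rw [h2]
  gcongr
  linarith

section Energy

variable {F : Type*} [NormedAddCommGroup F] [InnerProductSpace ℝ F]

/-- Only the bound `K` on the quadratic form of `A` enters, never its operator norm. The extra 1 in
`2 * K + 1` comes from `2⟨w, f⟩ ≤ ‖w‖² + ‖f‖²`. -/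
theorem norm_sq_le_of_hasDerivAt_of_nonneg {A : F →L[ℝ] F} {K R δ : ℝ} (hK : 0 ≤ K)
    (hA : ∀ x, |inner ℝ (A x) x| ≤ K * ‖x‖ ^ 2) {w f : ℝ → F}
    (hw : ∀ t, HasDerivAt w (A (w t) + f t) t) (hf : ∀ t ∈ Icc (-R) R, ‖f t‖ ≤ δ) {t : ℝ}
    (ht : t ∈ Icc 0 R) :
    ‖w t‖ ^ 2 ≤ exp ((2 * K + 1) * t) * (‖w 0‖ ^ 2 + δ ^ 2 * t) := by
  have hd : ∀ s, HasDerivAt (fun s => ‖w s‖ ^ 2) (2 * inner ℝ (w s) (A (w s) + f s)) s :=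
    fun s => (hw s).norm_sq
  refine gronwall_of_hasDerivAt (by linarith) (sq_nonneg δ)
    (fun s _ => (hd s).continuousAt.continuousWithinAt) (fun s _ => hd s) (fun s hs => ?_) ht
  have h1 := (le_abs_self _).trans (hA (w s))
  have h2 : inner ℝ (w s) (f s) ≤ ‖w s‖ * ‖f s‖ := real_inner_le_norm _ _
  have h3 := hf s ⟨by linarith [hs.1, hs.2], hs.2.le⟩
  rw [inner_add_right, real_inner_comm]
  nlinarith [norm_nonneg (w s), norm_nonneg (f s), sq_nonneg (‖w s‖ - ‖f s‖)]

theorem norm_sq_le_of_hasDerivAt {A : F →L[ℝ] F} {K R δ : ℝ} (hK : 0 ≤ K)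
    (hA : ∀ x, |inner ℝ (A x) x| ≤ K * ‖x‖ ^ 2) {w f : ℝ → F}
    (hw : ∀ t, HasDerivAt w (A (w t) + f t) t) (hf : ∀ t ∈ Icc (-R) R, ‖f t‖ ≤ δ) {t : ℝ}
    (ht : t ∈ Icc (-R) R) :
    ‖w t‖ ^ 2 ≤ exp ((2 * K + 1) * R) * (‖w 0‖ ^ 2 + δ ^ 2 * R) := by
  have hmono : ∀ s ∈ Icc 0 R, exp ((2 * K + 1) * s) * (‖w 0‖ ^ 2 + δ ^ 2 * s) ≤
      exp ((2 * K + 1) * R) * (‖w 0‖ ^ 2 + δ ^ 2 * R) := fun s hs => by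
    have := hs.1
    gcongr
    exacts [hs.2, hs.2]
  rcases le_total 0 t with h | h
  · exact (norm_sq_le_of_hasDerivAt_of_nonneg hK hA hw hf ⟨h, ht.2⟩).trans (hmono t ⟨h, ht.2⟩)
  · have hs : -t ∈ Icc 0 R := ⟨by linarith, by linarith [ht.1]⟩
    refine le_trans ?_ (hmono _ hs)
    -- Negative times by reversal: the hypothesis on the quadratic form is invariant under `A ↦ -A`.
    have := norm_sq_le_of_hasDerivAt_of_nonneg (A := -A) (w := fun s => w (-s))
      (f := fun s => -f (-s)) (δ := δ) hK (fun x => ?_) (fun s => ?_) (fun s hs => ?_) hs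
    · simpa using this
    · simpa using hA x
    · have := (hw (-s)).scomp s (hasDerivAt_neg s)
      convert! this using 1
      simp [add_comm]
    · rw [norm_neg]
      exact hf _ ⟨by linarith [hs.2], by linarith [hs.1]⟩

end Energy

/-! ### The flow of an almost skew-symmetric system -/

/-- The truncation of a sequence. -/
def cut (N : ℕ) (a : ℕ → ℝ) (i : ℕ) : ℝ := if i < N then a i else 0

theorem abs_cut_le_of_linear {a : ℕ → ℝ} {C : ℝ} (hC : 0 ≤ C) (h : ∀ i : ℕ, |a i| ≤ C * (i + 2))
    (N i : ℕ) : |cut N a i| ≤ C * (N + 2) := by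
  unfold cut
  split_ifs with hi
  · refine (h i).trans ?_
    gcongr
  · rw [abs_zero]; positivity

theorem cut_mul (N : ℕ) (a b : ℕ → ℝ) (i : ℕ) : cut N (fun i => a i * b i) i = cut N a i * b i := by
  unfold cut; split_ifs <;> simp

/-- The truncated operators. -/
def cutOp (l d u : ℕ → ℝ) (N : ℕ) : Seq →L[ℝ] Seq := neighbourOp (cut N l) d (cut N u)

/-- The embedding `x ↦ (x_i / (i + 2)^2)_i` of `ℓ²` into itself. -/
def damp : Seq →L[ℝ] Seq := weightedShift 0 fun i => (((i : ℝ) + 2) ^ 2)⁻¹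

theorem damp_apply (x : Seq) (i : ℕ) : damp x i = (((i : ℝ) + 2) ^ 2)⁻¹ * x i := by
  refine weightedShift_apply (C := 1) (fun i => ?_) x i
  rw [abs_of_nonneg (by positivity)]
  refine inv_le_one_of_one_le₀ (one_le_pow₀ ?_)
  linarith [(Nat.cast_nonneg i : (0 : ℝ) ≤ i)]

/-- Finitely supported sequences are dense and lie in the range of `damp`. -/
theorem exists_norm_sub_damp_le (x : Seq) {ε : ℝ} (hε : 0 < ε) : ∃ y : Seq, ‖x - damp y‖ < ε := by
  have h := lp.hasSum_single (p := 2) (by norm_num) x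
  obtain ⟨s, hs⟩ := (Metric.tendsto_atTop.1 h ε hε)
  refine ⟨∑ i ∈ s, lp.single 2 i (((i : ℝ) + 2) ^ 2 * x i), ?_⟩
  have hy : damp (∑ i ∈ s, lp.single 2 i (((i : ℝ) + 2) ^ 2 * x i)) =
      ∑ i ∈ s, lp.single 2 i (x i) := by
    rw [map_sum]
    refine Finset.sum_congr rfl fun i _ => ?_
    ext j
    rw [damp_apply, lp.single_apply, lp.single_apply]
    by_cases hj : j = i
    · subst hj
      have : (j : ℝ) + 2 ≠ 0 := by positivity
      simp only [Pi.single_eq_same]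
      field_simp
    · rw [Pi.single_eq_of_ne hj, Pi.single_eq_of_ne hj, mul_zero]
  rw [hy, norm_sub_rev, ← dist_eq_norm]
  exact hs s le_rfl

namespace AlmostSkew

variable {l d u : ℕ → ℝ} {C : ℝ}

theorem cutOp_apply (h : AlmostSkew l d u C) (N : ℕ) (x : Seq) (i : ℕ) :
    cutOp l d u N x i = neighbourSum (cut N l) d (cut N u) x i := by
  have hC := h.nonneg
  refine neighbourOp_apply (C := C * (N + 2)) (abs_cut_le_of_linear h.nonneg h.lower N)
    (fun i => (h.diag i).trans ?_) (abs_cut_le_of_linear h.nonneg h.upper N) x i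
  nlinarith [(Nat.cast_nonneg N : (0 : ℝ) ≤ N)]

/-- Cutting `l` and `u` at the same index preserves the cancellation in `l + u`, so the constant is
independent of `N`. -/
theorem abs_inner_cutOp_le (h : AlmostSkew l d u C) (N : ℕ) (x : Seq) :
    |inner ℝ (cutOp l d u N x) x| ≤ 2 * C * ‖x‖ ^ 2 := by
  refine abs_inner_neighbourOp_le (abs_cut_le_of_linear h.nonneg h.lower N) h.diag
    (abs_cut_le_of_linear h.nonneg h.upper N) (fun i => ?_) x
  unfold cut
  split_ifs
  · exact h.skew i
  · simpa using h.nonneg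

/-- The coefficients of the system satisfied by `((i + 2)^2 x_i)_i`. -/
theorem cutOp_damp (h : AlmostSkew l d u C) (N : ℕ) (y : Seq) : cutOp l d u N (damp y) =
    damp (cutOp (fun i => l i * ratio i ^ 2) d (fun i => u i * (ratio i ^ 2)⁻¹) N y) := by
  ext i
  rw [damp_apply, h.cutOp_apply, (h.mul_ratio_pow 2).cutOp_apply]
  simp only [neighbourSum, damp_apply, cut_mul]
  have h2 : (i : ℝ) + 2 ≠ 0 := by positivity
  have h4 : (i : ℝ) + 4 ≠ 0 := by positivity
  rw [mul_add, mul_add]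
  congr 1
  · congr 1
    · split_ifs with hi
      · obtain ⟨j, rfl⟩ := Nat.exists_eq_add_of_le' hi
        have h2' : (j : ℝ) + 2 ≠ 0 := by positivity
        have h4' : (j : ℝ) + 4 ≠ 0 := by positivity
        simp only [Nat.add_sub_cancel, ratio]
        push_cast
        rw [show (j : ℝ) + 2 + 2 = j + 4 by ring]
        field_simp
      · rw [mul_zero]
    · ring
  · simp only [ratio]
    push_cast
    rw [show (i : ℝ) + 2 + 2 = i + 4 by ring]
    field_simp

/-- The two truncations agree below `n`. Beyond `n` the linear growth of the coefficients meets the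
quadratic damping and leaves `C / (n + 2)`. -/
theorem norm_cutOp_sub_damp_le (h : AlmostSkew l d u C) (n N M : ℕ) (hN : n ≤ N) (hM : n ≤ M)
    (y : Seq) :
    ‖(cutOp l d u N - cutOp l d u M) (damp y)‖ ≤ 2 * (C / (n + 2)) * ‖y‖ := by
  have hC := h.nonneg
  -- `c` is the weight at the index that is damped: `i + 2` for the lower entries, `i + 4` for the
  -- upper ones.
  have key : ∀ a : ℕ → ℝ, (∀ i : ℕ, |a i| ≤ C * (i + 2)) → ∀ (i : ℕ) (c : ℝ), (i : ℝ) + 2 ≤ c →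
      |(cut N a i - cut M a i) * (c ^ 2)⁻¹| ≤ C / (n + 2) := fun a ha i c hc => by
    have hi : (0 : ℝ) < (i : ℝ) + 2 := by positivity
    have hc0 : 0 < c := hi.trans_le hc
    rcases lt_or_ge i n with hin | hin
    · rw [cut, cut, if_pos (by omega), if_pos (by omega), sub_self, zero_mul, abs_zero]
      positivity
    · have hle : |cut N a i - cut M a i| ≤ C * (i + 2) := by
        unfold cut
        have := ha i
        split_ifs <;> simp only [sub_self, sub_zero, zero_sub, abs_neg, abs_zero] <;>
          first | exact this | positivity
      rw [abs_mul, abs_of_pos (by positivity : 0 < (c ^ 2)⁻¹)]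
      calc |cut N a i - cut M a i| * (c ^ 2)⁻¹ ≤ C * (i + 2) * (((i : ℝ) + 2) ^ 2)⁻¹ := by gcongr
        _ = C / (i + 2) := by field_simp
        _ ≤ C / (n + 2) := by gcongr
  have hl := fun i => key l h.lower i (i + 2) le_rfl
  have hu := fun i => key u h.upper i ((i + 2 : ℕ) + 2) (by push_cast; linarith)
  have heq : (cutOp l d u N - cutOp l d u M) (damp y) =
      neighbourOp (fun i : ℕ => (cut N l i - cut M l i) * (((i : ℝ) + 2) ^ 2)⁻¹) 0
        (fun i : ℕ => (cut N u i - cut M u i) * ((((i + 2 : ℕ) : ℝ) + 2) ^ 2)⁻¹) y := by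
    ext i
    rw [sub_apply, lp.coeFn_sub, Pi.sub_apply, h.cutOp_apply, h.cutOp_apply,
      neighbourOp_apply hl (fun i => by simp only [Pi.zero_apply, abs_zero]; positivity) hu]
    simp only [neighbourSum, damp_apply, Pi.zero_apply]
    split_ifs <;> ring
  rw [heq]
  exact ContinuousLinearMap.le_of_opNorm_le _ (norm_neighbourOp_zero_le hl hu) y

/-- The flow of the truncated system. -/
theorem hasDerivAt_exp_cutOp (l d u : ℕ → ℝ) (N : ℕ) (x : Seq) (t : ℝ) :
    HasDerivAt (fun t : ℝ => NormedSpace.exp (t • cutOp l d u N) x)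
      (cutOp l d u N (NormedSpace.exp (t • cutOp l d u N) x)) t := by
  have := (hasDerivAt_exp_smul_const' (𝕂 := ℝ) (cutOp l d u N) t).clm_apply (hasDerivAt_const t x)
  simpa using this

theorem norm_sq_exp_cutOp_le (h : AlmostSkew l d u C) (N : ℕ) (x : Seq) {R t : ℝ}
    (ht : t ∈ Icc (-R) R) :
    ‖NormedSpace.exp (t • cutOp l d u N) x‖ ^ 2 ≤ exp ((2 * (2 * C) + 1) * R) * ‖x‖ ^ 2 := by
  have := norm_sq_le_of_hasDerivAt (f := 0) (δ := 0) (by linarith [h.nonneg])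
    (h.abs_inner_cutOp_le N)
    (fun s => by simpa using hasDerivAt_exp_cutOp l d u N x s) (by simp) ht
  simpa using this

theorem norm_exp_cutOp_le (h : AlmostSkew l d u C) (N : ℕ) (x : Seq) {R t : ℝ}
    (ht : t ∈ Icc (-R) R) :
    ‖NormedSpace.exp (t • cutOp l d u N) x‖ ≤ exp ((2 * (2 * C) + 1) * R) * ‖x‖ := by
  refine (sq_le_sq₀ (norm_nonneg _) (by positivity)).1 ((h.norm_sq_exp_cutOp_le N x ht).trans ?_)
  rw [mul_pow]
  gcongr
  refine le_self_pow₀ (one_le_exp ?_) two_ne_zero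
  have : 0 ≤ R := by linarith [ht.1, ht.2]
  have := h.nonneg
  positivity

/-- By `cutOp_damp` both sides solve the same linear equation with the same initial value, so the
energy estimate without forcing applies to their difference. Damped data thus stay damped, with
control uniform in `N`. -/
theorem exp_cutOp_damp (h : AlmostSkew l d u C) (N : ℕ) (y : Seq) (t : ℝ) :
    NormedSpace.exp (t • cutOp l d u N) (damp y) =
      damp (NormedSpace.exp
        (t • cutOp (fun i => l i * ratio i ^ 2) d (fun i => u i * (ratio i ^ 2)⁻¹) N) y) := by
  set V := fun t : ℝ => NormedSpace.exp
    (t • cutOp (fun i => l i * ratio i ^ 2) d (fun i => u i * (ratio i ^ 2)⁻¹) N) y with hV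
  have hw : ∀ s, HasDerivAt
      (fun s => NormedSpace.exp (s • cutOp l d u N) (damp y) - damp (V s))
      (cutOp l d u N (NormedSpace.exp (s • cutOp l d u N) (damp y) - damp (V s)) + (0 : Seq)) s :=
    fun s => by
      have h1 := damp.hasFDerivAt.comp_hasDerivAt s (hasDerivAt_exp_cutOp
        (fun i => l i * ratio i ^ 2) d (fun i => u i * (ratio i ^ 2)⁻¹) N y s)
      rw [← h.cutOp_damp] at h1
      convert! (hasDerivAt_exp_cutOp l d u N (damp y) s).sub h1 using 1
      rw [add_zero, map_sub]
  have := norm_sq_le_of_hasDerivAt (R := |t|) (f := fun _ => (0 : Seq)) (δ := 0)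
    (by linarith [h.nonneg]) (h.abs_inner_cutOp_le N) hw (by simp)
    ⟨neg_abs_le t, le_abs_self t⟩
  simp only [zero_smul, NormedSpace.exp_zero, one_apply_eq_self, hV, sub_self, norm_zero,
    ne_eq, OfNat.ofNat_ne_zero, not_false_eq_true, zero_pow, zero_mul, add_zero, mul_zero] at this
  exact sub_eq_zero.1 (norm_eq_zero.1 (pow_eq_zero_iff two_ne_zero |>.1
    (le_antisymm this (sq_nonneg _))))

/-- The difference of two truncated flows solves the system truncated at `N`, forced by the
difference of the operators acting on the other flow. That flow stays in the range of `damp`, so the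
forcing is O(1/n). -/
theorem norm_exp_cutOp_damp_sub_le (h : AlmostSkew l d u C) (y : Seq) (R : ℝ) :
    ∃ D, ∀ n N M : ℕ, n ≤ N → n ≤ M → ∀ t ∈ Icc (-R) R,
      ‖NormedSpace.exp (t • cutOp l d u N) (damp y) -
        NormedSpace.exp (t • cutOp l d u M) (damp y)‖ ^ 2 ≤ D / (n + 2) ^ 2 := by
  set V := fun (M : ℕ) (t : ℝ) => NormedSpace.exp
    (t • cutOp (fun i => l i * ratio i ^ 2) d (fun i => u i * (ratio i ^ 2)⁻¹) M) y with hV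
  set B := exp ((2 * (2 * (5 ^ 2 * C)) + 1) * R) * ‖y‖ with hB
  refine ⟨exp ((2 * (2 * C) + 1) * R) * ((2 * C * B) ^ 2 * R), fun n N M hN hM t ht => ?_⟩
  have hw : ∀ s, HasDerivAt (fun s => NormedSpace.exp (s • cutOp l d u N) (damp y) -
        NormedSpace.exp (s • cutOp l d u M) (damp y))
      (cutOp l d u N (NormedSpace.exp (s • cutOp l d u N) (damp y) -
        NormedSpace.exp (s • cutOp l d u M) (damp y)) +
        (cutOp l d u N - cutOp l d u M) (damp (V M s))) s := fun s => by
    convert! (hasDerivAt_exp_cutOp l d u N (damp y) s).sub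
      (hasDerivAt_exp_cutOp l d u M (damp y) s) using 1
    rw [← h.exp_cutOp_damp, sub_apply, map_sub]
    abel
  have hf : ∀ s ∈ Icc (-R) R, ‖(cutOp l d u N - cutOp l d u M) (damp (V M s))‖ ≤
      2 * (C / (n + 2)) * B := fun s hs => by
    refine (h.norm_cutOp_sub_damp_le n N M hN hM _).trans ?_
    have := h.nonneg
    gcongr
    exact (h.mul_ratio_pow 2).norm_exp_cutOp_le M y hs
  have := norm_sq_le_of_hasDerivAt (by linarith [h.nonneg]) (h.abs_inner_cutOp_le N) hw hf ht
  simp only [zero_smul, NormedSpace.exp_zero, one_apply_eq_self, sub_self, norm_zero,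
    ne_eq, OfNat.ofNat_ne_zero, not_false_eq_true, zero_pow, zero_add] at this
  refine this.trans (le_of_eq ?_)
  field_simp

theorem uniformCauchySeqOn_exp_cutOp (h : AlmostSkew l d u C) (x : Seq) (R : ℝ) :
    UniformCauchySeqOn (fun (N : ℕ) (t : ℝ) => NormedSpace.exp (t • cutOp l d u N) x) atTop
      (Icc (-R) R) := by
  rw [Metric.uniformCauchySeqOn_iff]
  intro ε hε
  set K := exp ((2 * (2 * C) + 1) * R) with hK
  have hKpos : 0 < K := exp_pos _
  -- `K` bounds every truncated flow on `[-R, R]`, so replacing `x` by damped data costs less than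
  -- `ε / 3` for each of the two flows.
  obtain ⟨y, hy⟩ := exists_norm_sub_damp_le x (ε := ε / (3 * K)) (by positivity)
  obtain ⟨D, hD⟩ := h.norm_exp_cutOp_damp_sub_le y R
  have htend : Tendsto (fun n : ℕ => D / ((n : ℝ) + 2) ^ 2) atTop (𝓝 0) := by
    refine Tendsto.div_atTop tendsto_const_nhds ?_
    exact (tendsto_pow_atTop two_ne_zero).comp
      (tendsto_atTop_add_const_right _ _ tendsto_natCast_atTop_atTop)
  obtain ⟨n, hn⟩ := (htend.eventually (gt_mem_nhds (by positivity : 0 < (ε / 3) ^ 2))).exists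
  refine ⟨n, fun N hN M hM t ht => ?_⟩
  have h1 : ‖NormedSpace.exp (t • cutOp l d u N) (damp y) -
      NormedSpace.exp (t • cutOp l d u M) (damp y)‖ < ε / 3 :=
    lt_of_pow_lt_pow_left₀ 2 (by positivity) ((hD n N M hN hM t ht).trans_lt hn)
  have h2 : ∀ N, ‖NormedSpace.exp (t • cutOp l d u N) (x - damp y)‖ < ε / 3 := fun N => by
    refine (h.norm_exp_cutOp_le N _ ht).trans_lt ?_
    calc K * ‖x - damp y‖ < K * (ε / (3 * K)) := by gcongr
      _ = ε / 3 := by field_simp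
  rw [dist_eq_norm]
  have e : NormedSpace.exp (t • cutOp l d u N) x - NormedSpace.exp (t • cutOp l d u M) x =
      NormedSpace.exp (t • cutOp l d u N) (x - damp y) -
        NormedSpace.exp (t • cutOp l d u M) (x - damp y) +
        (NormedSpace.exp (t • cutOp l d u N) (damp y) -
          NormedSpace.exp (t • cutOp l d u M) (damp y)) := by
    rw [map_sub, map_sub]; abel
  rw [e]
  refine (norm_add_le _ _).trans_lt ?_
  linarith [norm_sub_le (NormedSpace.exp (t • cutOp l d u N) (x - damp y))
    (NormedSpace.exp (t • cutOp l d u M) (x - damp y)), h2 N, h2 M]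

/-- `neighbourSum` as a continuous functional. -/
theorem exists_clm_neighbourSum (l d u : ℕ → ℝ) (i : ℕ) :
    ∃ L : Seq →L[ℝ] ℝ, ∀ x : Seq, L x = neighbourSum l d u x i := by
  refine ⟨(if 2 ≤ i then l (i - 2) • lp.evalCLM ℝ (fun _ : ℕ => ℝ) 2 (i - 2) else 0) +
    d i • lp.evalCLM ℝ (fun _ : ℕ => ℝ) 2 i + u i • lp.evalCLM ℝ (fun _ : ℕ => ℝ) 2 (i + 2),
    fun x => ?_⟩
  unfold neighbourSum
  split_ifs <;> rfl

/-- The initial value problem for an almost skew-symmetric system is solvable in `ℓ²`. -/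
theorem exists_flow (h : AlmostSkew l d u C) (x : Seq) :
    ∃ b : ℝ → Seq, Continuous b ∧ b 0 = x ∧
      ∀ i t, HasDerivAt (fun s => b s i) (neighbourSum l d u (b t) i) t := by
  set U := fun (N : ℕ) (t : ℝ) => NormedSpace.exp (t • cutOp l d u N) x with hU
  have hcs : ∀ t, CauchySeq fun N => U N t := fun t =>
    (h.uniformCauchySeqOn_exp_cutOp x |t|).cauchySeq ⟨neg_abs_le t, le_abs_self t⟩
  choose b hb using fun t => cauchySeq_tendsto_of_complete (hcs t)
  have hunif : ∀ R, TendstoUniformlyOn U b atTop (Icc (-R) R) := fun R =>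
    (h.uniformCauchySeqOn_exp_cutOp x R).tendstoUniformlyOn_of_tendsto fun t _ => hb t
  have hloc : TendstoLocallyUniformly U b atTop := by
    rw [← tendstoLocallyUniformlyOn_univ]
    refine (tendstoLocallyUniformlyOn_iff_forall_isCompact isOpen_univ).2 fun K _ hK => ?_
    obtain ⟨R, hR⟩ := hK.isBounded.subset_closedBall 0
    rw [Real.closedBall_eq_Icc, zero_sub, zero_add] at hR
    exact (hunif |R|).mono
      (hR.trans (Icc_subset_Icc (neg_le_neg (le_abs_self R)) (le_abs_self R)))
  refine ⟨b, hloc.continuous (Frequently.of_forall fun N => ?_), ?_, fun i t => ?_⟩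
  · exact continuous_iff_continuousAt.2 fun t => (hasDerivAt_exp_cutOp l d u N x t).continuousAt
  · refine tendsto_nhds_unique (hb 0) ?_
    simp [hU]
  · obtain ⟨L, hL⟩ := exists_clm_neighbourSum l d u i
    -- Once `N > i`, the `i`-th component no longer sees the truncation. The limit equation is
    -- obtained componentwise, since the full operator need not be bounded on ℓ².
    have hd : ∀ᶠ N : ℕ in atTop, ∀ s ∈ (univ : Set ℝ),
        HasDerivAt (fun s => U N s i) (L (U N s)) s := by
      filter_upwards [eventually_gt_atTop i] with N hN s _
      have h1 := (lp.evalCLM ℝ (fun _ : ℕ => ℝ) 2 i).hasFDerivAt.comp_hasDerivAt s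
        (hasDerivAt_exp_cutOp l d u N x s)
      have h2 : lp.evalCLM ℝ (fun _ : ℕ => ℝ) 2 i
          (cutOp l d u N (NormedSpace.exp (s • cutOp l d u N) x)) = L (U N s) := by
        change cutOp l d u N (U N s) i = _
        rw [h.cutOp_apply, hL, neighbourSum, neighbourSum, cut, cut, if_pos (by omega : i - 2 < N),
          if_pos hN]
      rw [h2] at h1
      exact h1
    rw [← hL]
    refine hasDerivAt_of_tendstoLocallyUniformlyOn (l := atTop) (f := fun N s => U N s i)
      (g := fun s => b s i) (f' := fun N s => L (U N s)) (g' := fun s => L (b s)) isOpen_univ ?_ hd (fun s _ => ?_) (mem_univ t)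
    · exact (L.uniformContinuous.comp_tendstoLocallyUniformly hloc).tendstoLocallyUniformlyOn
    · exact ((lp.evalCLM ℝ (fun _ : ℕ => ℝ) 2 i).continuous.tendsto _).comp (hb s)

/-! ### Uniqueness of bounded solutions -/

/-- Pairs `(i, i + 2)` inside the window combine into `l i + u i`. The two pairs crossing its upper
end contribute only their `u` half; these are the boundary terms. -/
theorem sum_mul_neighbourSum (l d u y : ℕ → ℝ) (N : ℕ) :
    ∑ i ∈ Finset.range (N + 2), y i * neighbourSum l d u y i =
      ∑ i ∈ Finset.range N, (l i + u i) * (y i * y (i + 2)) +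
        ∑ i ∈ Finset.range (N + 2), d i * y i ^ 2 +
        (u N * (y N * y (N + 2)) + u (N + 1) * (y (N + 1) * y (N + 3))) := by
  induction N with
  | zero =>
    simp only [neighbourSum, Finset.sum_range_succ, Finset.sum_range_zero]
    norm_num
    ring
  | succ N ih =>
    rw [Finset.sum_range_succ, ih, Finset.sum_range_succ _ N, Finset.sum_range_succ _ (N + 2),
      neighbourSum, if_pos (by omega), show N + 1 + 1 - 2 = N by omega]
    ring_nf

/-- Decay of order `1 / i` beats the linear growth of `u` in the boundary products, which are
therefore O(1/N). -/
theorem sum_mul_neighbourSum_le (h : AlmostSkew l d u C) (y : ℕ → ℝ) {M : ℝ}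
    (hy : ∀ i : ℕ, |y i| ≤ M / (i + 2)) (N : ℕ) :
    ∑ i ∈ Finset.range (N + 2), y i * neighbourSum l d u y i ≤
      2 * C * ∑ i ∈ Finset.range (N + 2), y i ^ 2 + 2 * C * M ^ 2 / (N + 2) := by
  have hC := h.nonneg
  have hM : 0 ≤ M := by
    have := (abs_nonneg _).trans (hy 0)
    simp only [Nat.cast_zero, zero_add] at this
    linarith
  rw [sum_mul_neighbourSum]
  have h1 : ∑ i ∈ Finset.range N, (l i + u i) * (y i * y (i + 2)) ≤
      C * ∑ i ∈ Finset.range (N + 2), y i ^ 2 := by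
    have h2 : ∑ i ∈ Finset.range N, (l i + u i) * (y i * y (i + 2)) ≤
        ∑ i ∈ Finset.range N, (C / 2 * y i ^ 2 + C / 2 * y (i + 2) ^ 2) := by
      refine Finset.sum_le_sum fun i _ => ?_
      have h3 : (l i + u i) * (y i * y (i + 2)) ≤ C * (|y i| * |y (i + 2)|) := by
        rw [← abs_mul]
        refine (le_abs_self _).trans ?_
        rw [abs_mul]
        gcongr
        exact h.skew i
      nlinarith [sq_nonneg (|y i| - |y (i + 2)|), sq_abs (y i), sq_abs (y (i + 2))]
    rw [Finset.sum_add_distrib, ← Finset.mul_sum, ← Finset.mul_sum] at h2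
    have h4 : ∑ i ∈ Finset.range N, y i ^ 2 ≤ ∑ i ∈ Finset.range (N + 2), y i ^ 2 :=
      Finset.sum_le_sum_of_subset_of_nonneg (by simp) fun _ _ _ => sq_nonneg _
    have h5 : ∑ i ∈ Finset.range N, y (i + 2) ^ 2 ≤ ∑ i ∈ Finset.range (N + 2), y i ^ 2 := by
      rw [add_comm N 2, Finset.sum_range_add]
      simp only [add_comm 2]
      linarith [Finset.sum_nonneg fun i (_ : i ∈ Finset.range 2) => sq_nonneg (y i)]
    nlinarith
  have h6 : ∑ i ∈ Finset.range (N + 2), d i * y i ^ 2 ≤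
      C * ∑ i ∈ Finset.range (N + 2), y i ^ 2 := by
    rw [Finset.mul_sum]
    refine Finset.sum_le_sum fun i _ => ?_
    gcongr
    exact (le_abs_self _).trans (h.diag i)
  have h7 : ∀ n : ℕ, N ≤ n → u n * (y n * y (n + 2)) ≤ C * M ^ 2 / (N + 2) := fun n hn => by
    refine (le_abs_self _).trans ?_
    rw [abs_mul, abs_mul]
    calc |u n| * (|y n| * |y (n + 2)|) ≤
          C * (n + 2) * (M / (n + 2) * (M / ((n + 2 : ℕ) + 2))) := by
          gcongr
          exacts [h.upper n, hy n, hy (n + 2)]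
      _ = C * M ^ 2 / ((n + 2 : ℕ) + 2) := by field_simp
      _ ≤ C * M ^ 2 / (N + 2) := by
          gcongr
          omega
  have e : 2 * C * M ^ 2 / ((N : ℝ) + 2) = C * M ^ 2 / (N + 2) + C * M ^ 2 / (N + 2) := by ring
  rw [e]
  linarith [h7 N le_rfl, h7 (N + 1) (by omega)]

/-- A bounded solution of an almost skew-symmetric system with zero initial value vanishes. -/
theorem eq_zero_of_hasDerivAt (h : AlmostSkew l d u C) {x : ℕ → ℝ → ℝ} {T M : ℝ}
    (hM : ∀ i, ∀ t ∈ Icc 0 T, |x i t| ≤ M) (hc : ∀ i, ContinuousOn (x i) (Icc 0 T))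
    (hd : ∀ i, ∀ t ∈ Ioo 0 T, HasDerivAt (x i) (neighbourSum l d u (fun j => x j t) i) t)
    (h0 : ∀ i, x i 0 = 0) (i : ℕ) {t : ℝ} (ht : t ∈ Icc 0 T) : x i t = 0 := by
  -- A bounded sequence has uncontrolled boundary terms. Dividing it by `i + 2` gives the required
  -- decay and keeps the system almost skew, with constant `5 * C`.
  have h' := h.div_ratio
  set l' := fun i => l i * (ratio i)⁻¹
  set u' := fun i => u i * ratio i
  have hC := h'.nonneg
  have hT : 0 ≤ T := ht.1.trans ht.2
  have hM0 : 0 ≤ M := (abs_nonneg _).trans (hM 0 t ht)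
  set y : ℕ → ℝ → ℝ := fun i t => x i t / (i + 2) with hy
  have hyd : ∀ i, ∀ t ∈ Ioo 0 T,
      HasDerivAt (y i) (neighbourSum l' d u' (fun j => y j t) i) t := fun i t ht => by
    convert! (hd i t ht).div_const ((i : ℝ) + 2) using 1
    have h2 : (i : ℝ) + 2 ≠ 0 := by positivity
    have h4 : (i : ℝ) + 4 ≠ 0 := by positivity
    simp only [neighbourSum, hy, l', u']
    rw [add_div, add_div]
    congr 1
    · congr 1
      · split_ifs with hi
        · obtain ⟨j, rfl⟩ := Nat.exists_eq_add_of_le' hi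
          have h2' : (j : ℝ) + 2 ≠ 0 := by positivity
          have h4' : (j : ℝ) + 4 ≠ 0 := by positivity
          simp only [Nat.add_sub_cancel, ratio]
          push_cast
          rw [show (j : ℝ) + 2 + 2 = j + 4 by ring]
          field_simp
        · rw [zero_div]
      · ring
    · simp only [ratio]
      push_cast
      rw [show (i : ℝ) + 2 + 2 = i + 4 by ring]
      field_simp
  have hyM : ∀ i, ∀ t ∈ Icc 0 T, |y i t| ≤ M / (i + 2) := fun i t ht => by
    simp only [hy]
    rw [abs_div, abs_of_pos (by positivity : (0 : ℝ) < (i : ℝ) + 2)]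
    gcongr
    exact hM i t ht
  -- One factor 2 comes from differentiating the square, the rest from `sum_mul_neighbourSum_le`
  -- with constant `5 * C`.
  set K := 2 * (2 * (5 * C)) with hK
  have hE : ∀ N : ℕ, ∑ i ∈ Finset.range (N + 2), y i t ^ 2 ≤
      exp (K * t) * (0 + 2 * (2 * (5 * C) * M ^ 2 / (N + 2)) * t) := fun N => by
    have := gronwall_of_hasDerivAt (E := fun t => ∑ i ∈ Finset.range (N + 2), y i t ^ 2)
      (E' := fun t => ∑ i ∈ Finset.range (N + 2),
        2 * (y i t * neighbourSum l' d u' (fun j => y j t) i)) (T := T) (K := K)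
      (ε := 2 * (2 * (5 * C) * M ^ 2 / (N + 2))) (by positivity) (by positivity) ?_ ?_ ?_ ht
    · convert this using 3
      simp [hy, h0]
    · exact continuousOn_finsetSum _ fun i _ => ((hc i).div_const _).pow 2
    · intro s hs
      refine HasDerivAt.fun_sum fun i _ => ?_
      convert! (hyd i s hs).pow 2 using 1
      push_cast
      ring
    · intro s hs
      rw [← Finset.mul_sum]
      have := h'.sum_mul_neighbourSum_le (fun j => y j s)
        (fun i => hyM i s (Ioo_subset_Icc_self hs)) N
      linarith
  have hlim : Tendsto (fun N : ℕ => exp (K * t) * (0 + 2 * (2 * (5 * C) * M ^ 2 / ((N : ℝ) + 2)) * t))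
      atTop (𝓝 (exp (K * t) * (0 + 2 * 0 * t))) := by
    refine (((Tendsto.div_atTop tendsto_const_nhds ?_).const_mul 2).mul_const t |>.const_add 0).const_mul _
    exact tendsto_atTop_add_const_right _ _ tendsto_natCast_atTop_atTop
  have hle : y i t ^ 2 ≤ exp (K * t) * (0 + 2 * 0 * t) := by
    refine ge_of_tendsto hlim ?_
    filter_upwards [eventually_ge_atTop i] with N hN
    refine le_trans ?_ (hE N)
    exact Finset.single_le_sum (f := fun i => y i t ^ 2) (fun _ _ => sq_nonneg _)
      (Finset.mem_range.2 (by omega))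
  have hy0 : y i t = 0 := by
    have : y i t ^ 2 = 0 := le_antisymm (by simpa using hle) (sq_nonneg _)
    exact pow_eq_zero_iff two_ne_zero |>.1 this
  simp only [hy, div_eq_zero_iff] at hy0
  exact hy0.resolve_right (by positivity)

end AlmostSkew

/-! ### Trigonometric integrals and Fourier completeness -/

theorem integral_cos_int_mul_add (k : ℤ) (hk : k ≠ 0) (c : ℝ) :
    ∫ θ in (-π)..π, cos (k * θ + c) = 0 := by
  have hk' : (k : ℝ) ≠ 0 := by exact_mod_cast hk
  rw [intervalIntegral.integral_comp_mul_add (fun x => cos x) hk' c, integral_cos,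
    show (k : ℝ) * π + c = k * -π + c + k * (2 * π) by ring, sin_add_int_mul_two_pi, sub_self,
    smul_zero]

/-- The phase `c` survives only at frequency `a + b`, which integrates to zero. Sines with a common
phase are thus orthogonal for every phase, in particular for `c = j * (π / 2)`, the phase of the
`j`-th derivative. -/
theorem integral_sin_mul_sin (a b : ℕ) (c : ℝ) (h : 0 < a + b) :
    ∫ θ in (-π)..π, sin (a * θ + c) * sin (b * θ + c) = if a = b then π else 0 := by
  have e : ∀ θ : ℝ, sin (a * θ + c) * sin (b * θ + c) =
      (1 / 2) * (cos (((a - b : ℤ) : ℝ) * θ) - cos (((a + b : ℤ) : ℝ) * θ + 2 * c)) := fun θ => by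
    have h1 : ((a - b : ℤ) : ℝ) * θ = (a * θ + c) - (b * θ + c) := by push_cast; ring
    have h2 : ((a + b : ℤ) : ℝ) * θ + 2 * c = (a * θ + c) + (b * θ + c) := by push_cast; ring
    rw [h1, h2, cos_sub, cos_add (a * θ + c)]
    ring
  simp only [e]
  rw [intervalIntegral.integral_const_mul, intervalIntegral.integral_sub
    (Continuous.intervalIntegrable (by fun_prop) _ _)
    (Continuous.intervalIntegrable (by fun_prop) _ _),
    integral_cos_int_mul_add _ (by omega), sub_zero]
  split_ifs with hab
  · subst hab
    simp
    ring
  · have := integral_cos_int_mul_add (a - b) (by omega) 0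
    simp only [add_zero] at this
    rw [this, mul_zero]

theorem integral_circleMeasure (f : ℝ → ℝ) : ∫ θ, f θ ∂circleMeasure = ∫ θ in (-π)..π, f θ :=
  (intervalIntegral.integral_of_le (by linarith [pi_pos])).symm

/-- Completeness of the trigonometric system. -/
theorem ae_eq_zero_of_integral_eq_zero {f : ℝ → ℝ} (hf : MemLp f 2 circleMeasure)
    (hcos : ∀ n : ℕ, ∫ θ, f θ * cos (n * θ) ∂circleMeasure = 0)
    (hsin : ∀ n : ℕ, ∫ θ, f θ * sin (n * θ) ∂circleMeasure = 0) : f =ᵐ[circleMeasure] 0 := by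
  have hint : ∀ {φ : ℝ → ℝ}, Continuous φ → Integrable (fun θ => f θ * φ θ) circleMeasure :=
    fun {φ} hφ => by
      refine (integrable_mul_of_continuous (hf.toLp f) hφ).congr ?_
      filter_upwards [hf.coeFn_toLp] with θ hθ
      rw [hθ]
  have hab : -π < π := by linarith [pi_pos]
  have hL2 : MemLp (fun θ => (f θ : ℂ)) 2 (volume.restrict (Ioc (-π) π)) := hf.ofReal
  have hcosZ : ∀ n : ℤ, ∫ θ, f θ * cos (n * θ) ∂circleMeasure = 0 := fun n => by
    obtain ⟨k, rfl | rfl⟩ := n.eq_nat_or_neg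
    · simpa using hcos k
    · simpa [cos_neg] using hcos k
  have hsinZ : ∀ n : ℤ, ∫ θ, f θ * sin (n * θ) ∂circleMeasure = 0 := fun n => by
    obtain ⟨k, rfl | rfl⟩ := n.eq_nat_or_neg
    · simpa using hsin k
    · simpa [sin_neg, integral_neg] using hsin k
  have hcoef : ∀ n, fourierCoeffOn hab (fun θ => (f θ : ℂ)) n = 0 := fun n => by
    rw [fourierCoeffOn_eq_integral, intervalIntegral.integral_of_le hab.le]
    have e : ∀ θ : ℝ, fourier (-n) (θ : AddCircle (π - -π)) • (f θ : ℂ) =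
        ((f θ * cos (n * θ) : ℝ) : ℂ) - ((f θ * sin (n * θ) : ℝ) : ℂ) * Complex.I := fun θ => by
      rw [fourier_coe_apply]
      have h2 : 2 * π * Complex.I * ((-n : ℤ) : ℂ) * θ / ((π - -π : ℝ) : ℂ) =
          ((-(n * θ) : ℝ) : ℂ) * Complex.I := by
        have : (π : ℂ) ≠ 0 := by exact_mod_cast pi_ne_zero
        push_cast
        field_simp
        ring
      rw [h2, Complex.exp_mul_I, ← Complex.ofReal_cos, ← Complex.ofReal_sin, cos_neg, sin_neg]
      push_cast
      rw [smul_eq_mul]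
      ring
    simp only [e]
    rw [integral_sub (hint (by fun_prop)).ofReal ((hint (by fun_prop)).ofReal.mul_const _),
      integral_mul_const, integral_complex_ofReal, integral_complex_ofReal, hcosZ, hsinZ]
    simp
  have hsum := hasSum_sq_fourierCoeffOn hab hL2
  simp only [hcoef, norm_zero, ne_eq, OfNat.ofNat_ne_zero, not_false_eq_true, zero_pow] at hsum
  have h0 := hsum.unique hasSum_zero
  rw [smul_eq_zero_iff_right (inv_ne_zero (by linarith)), intervalIntegral.integral_of_le hab.le,
    integral_eq_zero_iff_of_nonneg (fun _ => sq_nonneg _) ?_] at h0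
  · filter_upwards [h0] with θ hθ
    simpa using hθ
  · exact (memLp_two_iff_integrable_sq_norm hL2.1).1 hL2

theorem eq_of_ae_eq_circleMeasure {f g : ℝ → ℝ} (hf : Continuous f) (hg : Continuous g)
    (hfp : Function.Periodic f (2 * π)) (hgp : Function.Periodic g (2 * π))
    (h : f =ᵐ[circleMeasure] g) : f = g := by
  have h1 : EqOn f g (Ioo (-π) π) := Measure.eqOn_open_of_ae_eq
    (ae_restrict_of_ae_restrict_of_subset Ioo_subset_Ioc_self h) isOpen_Ioo hf.continuousOn
    hg.continuousOn
  have h2 : EqOn f g (Icc (-π) π) := by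
    rw [← closure_Ioo (by linarith [pi_pos] : -π ≠ π)]
    exact h1.closure hf hg
  ext θ
  obtain ⟨y, hy, hfy⟩ := (hfp.sub hgp).exists_mem_Ico (by positivity) θ (-π)
  rw [show -π + 2 * π = π by ring] at hy
  have h3 := h2 (Ico_subset_Icc_self hy)
  simp only [Pi.sub_apply] at hfy
  linarith

/-! ### Orthonormal systems of shifted sines -/

/-- The normalized function `sin ((i + 2) θ + c) / √π`. -/
def shiftedSin (c : ℝ) (i : ℕ) : BoundedContinuousFunction ℝ ℝ :=
  BoundedContinuousFunction.ofNormedAddCommGroup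
    (fun θ => (√π)⁻¹ * sin (((i + 2 : ℕ) : ℝ) * θ + c)) (by fun_prop) (√π)⁻¹ fun θ => by
      rw [norm_mul, norm_of_nonneg (by positivity)]
      exact mul_le_of_le_one_right (by positivity) (abs_sin_le_one _)

theorem shiftedSin_apply (c : ℝ) (i : ℕ) (θ : ℝ) :
    shiftedSin c i θ = (√π)⁻¹ * sin (((i + 2 : ℕ) : ℝ) * θ + c) := rfl

theorem norm_shiftedSin_le (c : ℝ) (i : ℕ) : ‖shiftedSin c i‖ ≤ (√π)⁻¹ :=
  BoundedContinuousFunction.norm_ofNormedAddCommGroup_le _ (by positivity) _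

/-- The function `sin ((i + 2) θ + c) / √π` as an element of `L²(𝕋)`. -/
def shiftedSinL2 (c : ℝ) (i : ℕ) : L2 :=
  BoundedContinuousFunction.toLp 2 circleMeasure ℝ (shiftedSin c i)

theorem coeFn_shiftedSinL2 (c : ℝ) (i : ℕ) : shiftedSinL2 c i =ᵐ[circleMeasure] shiftedSin c i :=
  BoundedContinuousFunction.coeFn_toLp 2 circleMeasure ℝ (shiftedSin c i)

theorem inner_shiftedSinL2 (c : ℝ) (i : ℕ) (f : L2) :
    inner ℝ (shiftedSinL2 c i) f =
      (√π)⁻¹ * ∫ θ, f θ * sin (((i + 2 : ℕ) : ℝ) * θ + c) ∂circleMeasure := by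
  rw [L2.inner_def, ← integral_const_mul]
  refine integral_congr_ae ?_
  filter_upwards [coeFn_shiftedSinL2 c i] with θ hθ
  rw [hθ, shiftedSin_apply]
  simp only [RCLike.inner_apply, conj_trivial]
  ring

theorem orthonormal_shiftedSinL2 (c : ℝ) : Orthonormal ℝ (shiftedSinL2 c) := by
  rw [orthonormal_iff_ite]
  intro i j
  have h1 : ∫ θ, shiftedSinL2 c j θ * sin (((i + 2 : ℕ) : ℝ) * θ + c) ∂circleMeasure =
      ∫ θ, (√π)⁻¹ * (sin (((i + 2 : ℕ) : ℝ) * θ + c) * sin (((j + 2 : ℕ) : ℝ) * θ + c))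
        ∂circleMeasure := by
    refine integral_congr_ae ?_
    filter_upwards [coeFn_shiftedSinL2 c j] with θ hθ
    rw [hθ, shiftedSin_apply]
    ring
  rw [inner_shiftedSinL2, h1, integral_const_mul, integral_circleMeasure,
    integral_sin_mul_sin _ _ _ (by omega), ← mul_assoc, ← mul_inv, mul_self_sqrt pi_pos.le]
  simp only [Nat.add_right_cancel_iff]
  split_ifs
  · exact inv_mul_cancel₀ pi_ne_zero
  · rw [mul_zero]

/-- The isometry `x ↦ ∑ x_i sin ((i + 2) θ + c) / √π` of `ℓ²` into `L²(𝕋)`. -/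
def sineSeries (c : ℝ) : Seq →ₗᵢ[ℝ] L2 := (orthonormal_shiftedSinL2 c).orthogonalFamily.linearIsometry

theorem hasSum_sineSeries (c : ℝ) (x : Seq) :
    HasSum (fun i => x i • shiftedSinL2 c i) (sineSeries c x) :=
  (orthonormal_shiftedSinL2 c).orthogonalFamily.hasSum_linearIsometry x

theorem sineSeries_single (c : ℝ) (i : ℕ) (a : ℝ) :
    sineSeries c (lp.single 2 i a) = a • shiftedSinL2 c i :=
  (orthonormal_shiftedSinL2 c).orthogonalFamily.linearIsometry_apply_single a

/-- For absolutely summable coefficients the series converges to its sum in `L²(𝕋)` pointwise. -/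
theorem coeFn_sineSeries (c : ℝ) (x : Seq) (hx : Summable fun i => |x i|) :
    sineSeries c x =ᵐ[circleMeasure]
      fun θ => ∑' i, x i * ((√π)⁻¹ * sin (((i + 2 : ℕ) : ℝ) * θ + c)) := by
  -- The series converges uniformly; mapping this sum continuously to `L²` and to point values
  -- identifies the two limits.
  have hs : Summable fun i => x i • shiftedSin c i := by
    refine Summable.of_norm_bounded (hx.mul_right (√π)⁻¹) fun i => ?_
    rw [norm_smul, Real.norm_eq_abs]
    gcongr
    exact norm_shiftedSin_le c i
  have h1 := hs.hasSum.mapL (BoundedContinuousFunction.toLp (E := ℝ) 2 circleMeasure ℝ)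
  simp only [map_smul] at h1
  rw [(hasSum_sineSeries c x).unique h1]
  refine (BoundedContinuousFunction.coeFn_toLp 2 circleMeasure ℝ _).trans (ae_of_all _ fun θ => ?_)
  have h2 := hs.hasSum.mapL (BoundedContinuousFunction.evalCLM ℝ θ)
  exact h2.tsum_eq.symm

/-! ### Series in Sobolev spaces -/

/-- Written as a phase shift by π/2, differentiation stays within one family of functions. -/
theorem hasDerivAt_sin_mul_add (n c θ : ℝ) :
    HasDerivAt (fun θ => sin (n * θ + c)) (n * sin (n * θ + (c + π / 2))) θ := by
  have h := (((hasDerivAt_id θ).const_mul n).add_const c).sin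
  have e : n * θ + (c + π / 2) = n * θ + c + π / 2 := by ring
  rw [e, sin_add_pi_div_two]
  convert! h using 1
  simp
  ring

theorem iteratedDeriv_sin_mul_add (n : ℝ) (k : ℕ) (c : ℝ) :
    iteratedDeriv k (fun θ => sin (n * θ + c)) =
      fun θ => n ^ k * sin (n * θ + (c + k * (π / 2))) := by
  induction k with
  | zero => simp
  | succ k ih =>
    rw [iteratedDeriv_succ, ih]
    ext θ
    rw [((hasDerivAt_sin_mul_add n (c + k * (π / 2)) θ).const_mul (n ^ k)).deriv]
    push_cast
    rw [show c + k * (π / 2) + π / 2 = c + ((k : ℝ) + 1) * (π / 2) by ring]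
    ring

theorem periodic_sin_nat_mul_add (n : ℕ) (c : ℝ) :
    Function.Periodic (fun θ => sin (n * θ + c)) (2 * π) := fun θ => by
  change sin (n * (θ + 2 * π) + c) = sin (n * θ + c)
  rw [show (n : ℝ) * (θ + 2 * π) + c = n * θ + c + n * (2 * π) by ring, sin_add_nat_mul_two_pi]

theorem _root_.Function.Periodic.apply_pi_eq {f : ℝ → ℝ} (hf : Function.Periodic f (2 * π)) :
    f π = f (-π) := by
  have := hf (-π)
  rwa [show -π + 2 * π = π by ring] at this

theorem periodic_iteratedDeriv {φ : ℝ → ℝ} (hφ : Function.Periodic φ (2 * π)) (k : ℕ) :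
    Function.Periodic (iteratedDeriv k φ) (2 * π) := by
  intro θ
  rw [← congrFun (iteratedDeriv_comp_add_const k φ (2 * π)) θ]
  congr 1
  ext x
  exact hφ x

/-- Integration by parts over a period. -/
theorem integral_mul_deriv_eq_neg {f f' g g' : ℝ → ℝ} (hf : ∀ θ, HasDerivAt f (f' θ) θ)
    (hg : ∀ θ, HasDerivAt g (g' θ) θ) (hf' : IntervalIntegrable f' volume (-π) π)
    (hg' : IntervalIntegrable g' volume (-π) π)
    (hfp : f π = f (-π)) (hgp : g π = g (-π)) :
    ∫ θ in (-π)..π, f θ * g' θ = -∫ θ in (-π)..π, f' θ * g θ := by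
  rw [intervalIntegral.integral_mul_deriv_eq_deriv_mul (fun θ _ => hf θ) (fun θ _ => hg θ) hf' hg',
    hfp, hgp]
  ring

theorem integral_sin_mul_iteratedDeriv (n : ℕ) {φ : ℝ → ℝ} (hφ : ContDiff ℝ ∞ φ)
    (hper : Function.Periodic φ (2 * π)) (k : ℕ) (c : ℝ) :
    ∫ θ, sin (n * θ + c) * iteratedDeriv k φ θ ∂circleMeasure =
      (-1) ^ k * ∫ θ, (n : ℝ) ^ k * sin (n * θ + (c + k * (π / 2))) * φ θ ∂circleMeasure := by
  induction k generalizing c with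
  | zero => simp
  | succ k ih =>
    have hc : Continuous (iteratedDeriv (k + 1) φ) :=
      hφ.continuous_iteratedDeriv (k + 1) (by exact_mod_cast le_top)
    have hd : ∀ θ, HasDerivAt (iteratedDeriv k φ) (iteratedDeriv (k + 1) φ θ) θ := fun θ => by
      rw [iteratedDeriv_succ]
      exact (hφ.differentiable_iteratedDeriv k (by exact_mod_cast ENat.natCast_lt_top k) θ).hasDerivAt
    have h := integral_mul_deriv_eq_neg (hasDerivAt_sin_mul_add n c) hd
      (Continuous.intervalIntegrable (by fun_prop) _ _) (hc.intervalIntegrable _ _)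
      (periodic_sin_nat_mul_add n c).apply_pi_eq (periodic_iteratedDeriv hper k).apply_pi_eq
    rw [integral_circleMeasure, h, ← integral_circleMeasure]
    simp only [mul_assoc]
    rw [integral_const_mul, ih, pow_succ]
    push_cast
    simp only [mul_assoc]
    rw [integral_const_mul, integral_const_mul]
    rw [show c + π / 2 + k * (π / 2) = c + ((k : ℝ) + 1) * (π / 2) by ring]
    ring

theorem exists_clm_integral_mul {ψ : ℝ → ℝ} (hψ : Continuous ψ) :
    ∃ L : L2 →L[ℝ] ℝ, ∀ f : L2, L f = ∫ θ, f θ * ψ θ ∂circleMeasure := by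
  obtain ⟨C, hC⟩ := (isCompact_Icc (a := -π) (b := π)).exists_bound_of_continuousOn hψ.continuousOn
  have hm : MemLp ψ 2 circleMeasure := by
    refine MemLp.of_bound hψ.aestronglyMeasurable C ?_
    filter_upwards [ae_restrict_mem measurableSet_Ioc] with θ hθ
    exact hC θ (Ioc_subset_Icc_self hθ)
  refine ⟨innerSL ℝ (hm.toLp ψ), fun f => ?_⟩
  rw [innerSL_apply_apply, L2.inner_def]
  refine integral_congr_ae ?_
  filter_upwards [hm.coeFn_toLp] with θ hθ
  rw [hθ]
  simp

theorem integral_shiftedSinL2_mul (c : ℝ) (i : ℕ) (ψ : ℝ → ℝ) :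
    ∫ θ, shiftedSinL2 c i θ * ψ θ ∂circleMeasure =
      (√π)⁻¹ * ∫ θ, sin (((i + 2 : ℕ) : ℝ) * θ + c) * ψ θ ∂circleMeasure := by
  rw [← integral_const_mul]
  refine integral_congr_ae ?_
  filter_upwards [coeFn_shiftedSinL2 c i] with θ hθ
  rw [hθ, shiftedSin_apply]
  ring

/-- The multiplier of the `j`-th derivative in `sobolevSeries`. -/
def multiplier (m j i : ℕ) : ℝ := ((i : ℝ) + 2) ^ j / ((i : ℝ) + 2) ^ m

theorem abs_multiplier_le {m j : ℕ} (h : j ≤ m) (i : ℕ) : |multiplier m j i| ≤ 1 := by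
  unfold multiplier
  rw [abs_of_nonneg (by positivity)]
  refine div_le_one_of_le₀ (pow_le_pow_right₀ ?_ h) (by positivity)
  linarith [(Nat.cast_nonneg i : (0 : ℝ) ≤ i)]

/-- The `j`-th derivative of `∑ (i + 2)^(-m) x_i sin ((i + 2) θ) / √π`. -/
def seriesDeriv (m j : ℕ) : Seq →L[ℝ] L2 :=
  (sineSeries (j * (π / 2))).toContinuousLinearMap.comp (weightedShift 0 (multiplier m j))

theorem seriesDeriv_single {m j : ℕ} (h : j ≤ m) (i : ℕ) :
    seriesDeriv m j (lp.single 2 i 1) = multiplier m j i • shiftedSinL2 (j * (π / 2)) i := by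
  rw [← sineSeries_single]
  change sineSeries _ (weightedShift 0 (multiplier m j) (lp.single 2 i 1)) = _
  congr 1
  ext k
  rw [weightedShift_apply (abs_multiplier_le h), lp.single_apply, lp.single_apply, add_zero]
  by_cases hk : k = i
  · subst hk; simp
  · rw [Pi.single_eq_of_ne hk, Pi.single_eq_of_ne hk, mul_zero]

/-- Against a fixed test function both sides are continuous and linear in `x`, so unit sequences
suffice; there the identity is integration by parts for a single sine. -/
theorem hasWeakDeriv_seriesDeriv {m j : ℕ} (h : j ≤ m) (x : Seq) :
    HasWeakDeriv j (seriesDeriv m 0 x) (seriesDeriv m j x) := by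
  intro φ hφ hper
  obtain ⟨L₁, hL₁⟩ := exists_clm_integral_mul
    (hφ.continuous_iteratedDeriv j (by exact_mod_cast le_top))
  obtain ⟨L₂, hL₂⟩ := exists_clm_integral_mul hφ.continuous
  have key : L₁.comp (seriesDeriv m 0) = (-1 : ℝ) ^ j • L₂.comp (seriesDeriv m j) := by
    refine lp.ext_continuousLinearMap (by norm_num) fun i => ?_
    ext
    change L₁ (seriesDeriv m 0 (lp.single 2 i 1)) =
      (-1) ^ j * L₂ (seriesDeriv m j (lp.single 2 i 1))
    rw [seriesDeriv_single (Nat.zero_le m), seriesDeriv_single h, map_smul, map_smul, hL₁, hL₂,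
      integral_shiftedSinL2_mul, integral_shiftedSinL2_mul, integral_sin_mul_iteratedDeriv _ hφ hper]
    simp only [mul_assoc, smul_eq_mul]
    rw [integral_const_mul]
    simp only [multiplier, pow_zero, Nat.cast_zero, zero_mul, zero_add]
    push_cast
    ring
  have := DFunLike.congr_fun key x
  rw [← hL₁, ← hL₂]
  exact this

/-- The isomorphism `x ↦ ∑ (i + 2)^(-m) x_i sin ((i + 2) θ) / √π` of `ℓ²` onto its image in
`H^m(𝕋)`. -/
def sobolevSeries (m : ℕ) : Seq →L[ℝ] Sobolev m :=
  ((PiLp.continuousLinearEquiv 2 ℝ (fun _ : Fin (m + 1) => L2)).symm.toContinuousLinearMap.comp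
    (ContinuousLinearMap.pi fun j : Fin (m + 1) => seriesDeriv m j)).codRestrict (Sobolev m)
    fun x j => hasWeakDeriv_seriesDeriv (Nat.lt_succ_iff.1 j.2) x

/-- Forgetting two derivatives amounts to two extra powers of damping. Being C² in time with values
in H^{m-2} is thereby reduced to `damp ∘ b` being C² in ℓ². -/
theorem incl_sobolevSeries {m : ℕ} (hm : 2 ≤ m) (x : Seq) :
    Sobolev.incl (Nat.sub_le m 2) (sobolevSeries m x) = sobolevSeries (m - 2) (damp x) := by
  refine Subtype.ext (PiLp.ext fun j => ?_)
  change seriesDeriv m j x = seriesDeriv (m - 2) j (damp x)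
  have hj : (j : ℕ) ≤ m - 2 := Nat.lt_succ_iff.1 j.2
  change sineSeries _ (weightedShift 0 (multiplier m j) x) =
    sineSeries _ (weightedShift 0 (multiplier (m - 2) j) (damp x))
  congr 1
  ext i
  rw [weightedShift_apply (abs_multiplier_le (by omega)), weightedShift_apply (abs_multiplier_le hj),
    damp_apply, multiplier, multiplier]
  have : (i : ℝ) + 2 ≠ 0 := by positivity
  have e : ((i : ℝ) + 2) ^ m = ((i : ℝ) + 2) ^ (m - 2) * ((i : ℝ) + 2) ^ 2 := by
    rw [← pow_add, Nat.sub_add_cancel hm]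
  rw [e, add_zero]
  field_simp

/-! ### Time regularity in `ℓ²` -/

/-- Componentwise derivatives identify `f` with `f 0 + ∫ G`, and norm continuity of `G` makes that
primitive differentiable in ℓ². -/
theorem hasDerivAt_of_forall_apply {f G : ℝ → Seq} (hG : Continuous G)
    (h : ∀ i t, HasDerivAt (fun s => f s i) (G t i) t) (t : ℝ) : HasDerivAt f (G t) t := by
  set g : ℝ → Seq := fun t => f 0 + ∫ s in (0 : ℝ)..t, G s with hg
  have hgd : ∀ t, HasDerivAt g (G t) t := fun t =>
    (intervalIntegral.integral_hasDerivAt_right (hG.intervalIntegrable _ _)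
      (hG.stronglyMeasurableAtFilter _ _) hG.continuousAt).const_add (f 0)
  have hfg : f = g := by
    ext s i
    have hgi : ∀ t, HasDerivAt (fun s => g s i) (G t i) t := fun t =>
      (lp.evalCLM ℝ (fun _ : ℕ => ℝ) 2 i).hasFDerivAt.comp_hasDerivAt t (hgd t)
    have h0 : ∀ t, HasDerivAt (fun s => f s i - g s i) 0 t := fun t => by
      have := (h i t).sub (hgi t)
      rwa [sub_self] at this
    have := is_const_of_deriv_eq_zero (fun t => (h0 t).differentiableAt) (fun t => (h0 t).deriv) s 0
    have hz : g 0 = f 0 := by simp [hg]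
    rw [hz, sub_self] at this
    linarith
  rw [hfg]
  exact hgd t

theorem hasDerivAt_neighbourSum {x x' : ℕ → ℝ → ℝ} {t : ℝ} (h : ∀ i, HasDerivAt (x i) (x' i t) t)
    (l d u : ℕ → ℝ) (i : ℕ) :
    HasDerivAt (fun s => neighbourSum l d u (fun j => x j s) i)
      (neighbourSum l d u (fun j => x' j t) i) t := by
  unfold neighbourSum
  refine (HasDerivAt.add ?_ ((h i).const_mul _)).add ((h (i + 2)).const_mul _)
  split_ifs
  · exact (h (i - 2)).const_mul _
  · exact hasDerivAt_const t 0

namespace AlmostSkew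

variable {l d u : ℕ → ℝ} {C : ℝ}

/-- Damping by one power of the weight makes the system bounded. -/
theorem exists_clm_inv_mul_neighbourSum (h : AlmostSkew l d u C) :
    ∃ S : Seq →L[ℝ] Seq, ∀ (x : Seq) i, S x i = ((i : ℝ) + 2)⁻¹ * neighbourSum l d u x i := by
  have hC := h.nonneg
  refine ⟨neighbourOp (fun i => (((i + 2 : ℕ) : ℝ) + 2)⁻¹ * l i) (fun i => ((i : ℝ) + 2)⁻¹ * d i)
    (fun i => ((i : ℝ) + 2)⁻¹ * u i), fun x i => ?_⟩
  rw [neighbourOp_apply (C := C)]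
  · simp only [neighbourSum]
    split_ifs with hi
    · rw [Nat.sub_add_cancel hi]; ring
    · ring
  · intro i
    rw [abs_mul, abs_of_pos (by positivity), inv_mul_le_iff₀ (by positivity)]
    have := h.lower i
    push_cast
    linarith
  · intro i
    rw [abs_mul, abs_of_pos (by positivity), inv_mul_le_iff₀ (by positivity)]
    have := h.diag i
    nlinarith [(Nat.cast_nonneg i : (0 : ℝ) ≤ i)]
  · intro i
    rw [abs_mul, abs_of_pos (by positivity), inv_mul_le_iff₀ (by positivity)]
    have := h.upper i
    linarith

/-- This serves the second time derivative: one power of the damping absorbs the growth of the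
coefficients, the other the factor `j + 2`. The constant is `2 * C` because `i + 4 ≤ 2 * (i + 2)`.
-/
theorem exists_clm_inv_sq_mul_neighbourSum (h : AlmostSkew l d u C) :
    ∃ S : Seq →L[ℝ] Seq, ∀ (x : Seq) i, S x i =
      (((i : ℝ) + 2) ^ 2)⁻¹ * neighbourSum l d u (fun j : ℕ => ((j : ℝ) + 2) * x j) i := by
  have hC := h.nonneg
  refine ⟨neighbourOp (fun i => (((i + 2 : ℕ) : ℝ) + 2)⁻¹ ^ 2 * (l i * ((i : ℝ) + 2)))
    (fun i => ((i : ℝ) + 2)⁻¹ * d i)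
    (fun i => ((i : ℝ) + 2)⁻¹ ^ 2 * (u i * (((i + 2 : ℕ) : ℝ) + 2))), fun x i => ?_⟩
  have hi0 : (i : ℝ) + 2 ≠ 0 := by positivity
  rw [neighbourOp_apply (C := 2 * C)]
  · simp only [neighbourSum]
    have hd : ((i : ℝ) + 2)⁻¹ * d i * x (i + 0) =
        (((i : ℝ) + 2) ^ 2)⁻¹ * (d i * (((i : ℝ) + 2) * x i)) := by
      rw [add_zero]; field_simp
    simp only [add_zero] at hd
    rw [hd]
    split_ifs with hi
    · rw [Nat.sub_add_cancel hi, inv_pow]; ring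
    · rw [inv_pow]; ring
  · intro i
    rw [abs_mul, abs_of_pos (by positivity), inv_pow, inv_mul_le_iff₀ (by positivity), abs_mul,
      abs_of_pos (by positivity : (0 : ℝ) < (i : ℝ) + 2)]
    have := mul_le_mul_of_nonneg_right (h.lower i) (by positivity : (0 : ℝ) ≤ (i : ℝ) + 2)
    push_cast
    have h3 : C * ((i : ℝ) + 2) * (i + 2) ≤ C * ((i : ℝ) + 2 + 2) * (i + 2 + 2) := by
      gcongr <;> linarith
    have h4 : 0 ≤ C * ((i : ℝ) + 2 + 2) * (i + 2 + 2) := by positivity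
    linarith
  · intro i
    rw [abs_mul, abs_of_pos (by positivity), inv_mul_le_iff₀ (by positivity)]
    have := h.diag i
    nlinarith [(Nat.cast_nonneg i : (0 : ℝ) ≤ i), mul_nonneg hC (Nat.cast_nonneg i : (0 : ℝ) ≤ i)]
  · intro i
    rw [abs_mul, abs_of_pos (by positivity), inv_pow, inv_mul_le_iff₀ (by positivity), abs_mul,
      abs_of_pos (by positivity : (0 : ℝ) < ((i + 2 : ℕ) : ℝ) + 2)]
    have := mul_le_mul_of_nonneg_right (h.upper i)
      (by positivity : (0 : ℝ) ≤ ((i + 2 : ℕ) : ℝ) + 2)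
    push_cast at this ⊢
    have h3 : C * ((i : ℝ) + 2) * (i + 2 + 2) ≤ C * ((i : ℝ) + 2) * (2 * (i + 2)) := by
      gcongr
      linarith [(Nat.cast_nonneg i : (0 : ℝ) ≤ i)]
    linarith

/-- Each time derivative applies the unbounded operator once and uses up one of the two powers of
damping, so both derivatives are bounded operators applied to `b t`. -/
theorem contDiff_damp (h : AlmostSkew l d u C) {b : ℝ → Seq} (hb : Continuous b)
    (hd : ∀ i t, HasDerivAt (fun s => b s i) (neighbourSum l d u (b t) i) t) :
    ContDiff ℝ 2 fun t => damp (b t) := by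
  obtain ⟨S, hS⟩ := h.exists_clm_inv_mul_neighbourSum
  obtain ⟨S₂, hS₂⟩ := h.exists_clm_inv_sq_mul_neighbourSum
  have h0 : ∀ i : ℕ, |((i : ℝ) + 2)⁻¹| ≤ 1 := fun i => by
    rw [abs_of_pos (by positivity)]
    exact inv_le_one_of_one_le₀ (by linarith [(Nat.cast_nonneg i : (0 : ℝ) ≤ i)])
  set D := weightedShift 0 fun i => ((i : ℝ) + 2)⁻¹ with hD
  have hDa : ∀ x i, D x i = ((i : ℝ) + 2)⁻¹ * x i := fun x i => weightedShift_apply h0 x i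
  have h1 : ∀ t, HasDerivAt (fun t => damp (b t)) (D (S (b t))) t :=
    hasDerivAt_of_forall_apply (by fun_prop) fun i t => by
      simp only [damp_apply, hDa, hS]
      convert! (hd i t).const_mul (((i : ℝ) + 2) ^ 2)⁻¹ using 1
      rw [sq, mul_inv, mul_assoc]
  have h2 : ∀ t, HasDerivAt (fun t => D (S (b t))) (S₂ (S (b t))) t :=
    hasDerivAt_of_forall_apply (by fun_prop) fun i t => by
      simp only [hS₂, hDa, hS]
      convert! ((hasDerivAt_neighbourSum (x := fun j s => b s j)
        (x' := fun j s => neighbourSum l d u (b s) j) (fun j => hd j t) l d u i).const_mul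
        ((i : ℝ) + 2)⁻¹).const_mul ((i : ℝ) + 2)⁻¹ using 1
      have e : ∀ j : ℕ, ((j : ℝ) + 2) * (((j : ℝ) + 2)⁻¹ * neighbourSum l d u (b t) j) =
          neighbourSum l d u (b t) j := fun j => by
        have : (j : ℝ) + 2 ≠ 0 := by positivity
        field_simp
      simp only [e]
      rw [sq, mul_inv, mul_assoc]
  have e1 : deriv (fun t => damp (b t)) = fun t => D (S (b t)) := funext fun t => (h1 t).deriv
  have e2 : deriv (fun t => D (S (b t))) = fun t => S₂ (S (b t)) := funext fun t => (h2 t).deriv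
  rw [show (2 : WithTop ℕ∞) = 1 + 1 by norm_num, contDiff_succ_iff_deriv, e1, contDiff_one_iff_deriv,
    e2]
  exact ⟨fun t => (h1 t).differentiableAt, by simp, fun t => (h2 t).differentiableAt, by fun_prop⟩

end AlmostSkew

/-! ### The Hilbert transform of Lipschitz functions -/

/-- The symmetrized integrand of the Hilbert transform. -/
def hilbertKernel (f : ℝ → ℝ) (θ y : ℝ) : ℝ := Real.cot (y / 2) * (f (θ - y) - f (θ + y))

/-- The Hilbert transform of a Lipschitz function. -/
def hilbert (f : ℝ → ℝ) (θ : ℝ) : ℝ := 1 / (2 * π) * ∫ y in (0 : ℝ)..π, hilbertKernel f θ y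

theorem sin_half_pos {y : ℝ} (hy : y ∈ Ioc 0 π) : 0 < sin (y / 2) :=
  sin_pos_of_pos_of_lt_pi (by linarith [hy.1]) (by linarith [hy.2, pi_pos])

theorem abs_cot_half_le {y : ℝ} (hy : y ∈ Ioc 0 π) : |Real.cot (y / 2)| ≤ π / y := by
  have h1 := mul_le_sin (x := y / 2) (by linarith [hy.1]) (by linarith [hy.2])
  have h2 : y / π ≤ sin (y / 2) := by
    refine le_trans (le_of_eq ?_) h1
    ring
  have hy0 := hy.1
  rw [Real.cot_eq_cos_div_sin, abs_div, abs_of_pos (sin_half_pos hy)]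
  calc |cos (y / 2)| / sin (y / 2) ≤ 1 / (y / π) := by
        gcongr
        exact abs_cos_le_one _
    _ = π / y := one_div_div _ _

theorem measurable_cot : Measurable Real.cot := by
  have : Real.cot = fun x => cos x / sin x := funext Real.cot_eq_cos_div_sin
  rw [this]
  exact measurable_cos.div measurable_sin

theorem continuousOn_cot_half : ContinuousOn (fun y => Real.cot (y / 2)) (Ioc 0 π) := by
  have : (fun y => Real.cot (y / 2)) = fun y => cos (y / 2) / sin (y / 2) :=
    funext fun y => Real.cot_eq_cos_div_sin _
  rw [this]
  exact ContinuousOn.div (by fun_prop) (by fun_prop) fun y hy => (sin_half_pos hy).ne'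

section Hilbert

variable {f : ℝ → ℝ} {K : NNReal}

/-- The singularity `π / y` of the cotangent cancels against the Lipschitz bound `2 * K * y`, so the
principal value becomes an absolutely convergent integral. -/
theorem abs_hilbertKernel_le (hf : LipschitzWith K f) (θ : ℝ) {y : ℝ} (hy : y ∈ Ioc 0 π) :
    |hilbertKernel f θ y| ≤ 2 * π * K := by
  have h1 := hf.dist_le_mul (θ - y) (θ + y)
  rw [Real.dist_eq, Real.dist_eq, show θ - y - (θ + y) = -(2 * y) by ring, abs_neg,
    abs_of_pos (by linarith [hy.1] : 0 < 2 * y)] at h1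
  have hy0 := hy.1
  rw [hilbertKernel, abs_mul]
  calc |Real.cot (y / 2)| * |f (θ - y) - f (θ + y)| ≤ π / y * (K * (2 * y)) := by
        gcongr
        exact abs_cot_half_le hy
    _ = 2 * π * K := by field_simp

theorem measurable_hilbertKernel (hf : Continuous f) (θ : ℝ) : Measurable (hilbertKernel f θ) :=
  (measurable_cot.comp (measurable_id.div_const 2)).mul
    (by fun_prop : Continuous fun y => f (θ - y) - f (θ + y)).measurable

theorem intervalIntegrable_hilbertKernel (hf : LipschitzWith K f) (θ : ℝ) :
    IntervalIntegrable (hilbertKernel f θ) volume 0 π := by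
  rw [intervalIntegrable_iff_integrableOn_Ioc_of_le pi_pos.le]
  refine Measure.integrableOn_of_bounded (M := 2 * π * K) (by simp)
    (measurable_hilbertKernel hf.continuous θ).aestronglyMeasurable ?_
  filter_upwards [ae_restrict_mem measurableSet_Ioc] with y hy
  exact abs_hilbertKernel_le hf θ hy

/-- Substituting `θ - y` to the left of `θ` and `θ + y` to the right folds the two arcs together;
oddness of the cotangent produces the difference of values of `f`. -/
theorem setIntegral_cot_eq (hf : Continuous f) (θ : ℝ) {ε : ℝ} (hε : ε ∈ Ioc 0 π) :
    ∫ ϑ in {ϑ : ℝ | ε ≤ |θ - ϑ| ∧ |θ - ϑ| ≤ π}, Real.cot ((θ - ϑ) / 2) * f ϑ =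
      ∫ y in ε..π, hilbertKernel f θ y := by
  have hset : {ϑ : ℝ | ε ≤ |θ - ϑ| ∧ |θ - ϑ| ≤ π} = Icc (θ - π) (θ - ε) ∪ Icc (θ + ε) (θ + π) := by
    have h1 := hε.1
    ext ϑ
    simp only [mem_ofPred_eq, mem_union, mem_Icc]
    rcases abs_cases (θ - ϑ) with ⟨h, h'⟩ | ⟨h, h'⟩ <;> rw [h] <;> constructor
    · exact fun hh => Or.inl ⟨by linarith [hh.2], by linarith [hh.1]⟩
    · rintro (hh | hh)
      · exact ⟨by linarith [hh.2], by linarith [hh.1]⟩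
      · linarith [hh.1]
    · exact fun hh => Or.inr ⟨by linarith [hh.1], by linarith [hh.2]⟩
    · rintro (hh | hh)
      · linarith [hh.2]
      · exact ⟨by linarith [hh.1], by linarith [hh.2]⟩
  have hsub : Icc ε π ⊆ Ioc 0 π := fun y hy => ⟨hε.1.trans_le hy.1, hy.2⟩
  have hc1 : ContinuousOn (fun ϑ => Real.cot ((θ - ϑ) / 2) * f ϑ) (Icc (θ - π) (θ - ε)) := by
    refine ContinuousOn.mul ?_ hf.continuousOn
    exact continuousOn_cot_half.comp (f := fun ϑ => θ - ϑ) (by fun_prop) fun ϑ hϑ =>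
      hsub ⟨by linarith [hϑ.2], by linarith [hϑ.1]⟩
  have hc2 : ContinuousOn (fun ϑ => Real.cot ((θ - ϑ) / 2) * f ϑ) (Icc (θ + ε) (θ + π)) := by
    have e : (fun ϑ => Real.cot ((θ - ϑ) / 2) * f ϑ) =
        fun ϑ => -(Real.cot ((ϑ - θ) / 2)) * f ϑ := funext fun ϑ => by
      rw [Real.cot_eq_cos_div_sin, Real.cot_eq_cos_div_sin,
        show (ϑ - θ) / 2 = -((θ - ϑ) / 2) by ring, cos_neg, sin_neg, div_neg, neg_neg]
    rw [e]
    refine ContinuousOn.mul (ContinuousOn.neg ?_) hf.continuousOn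
    exact continuousOn_cot_half.comp (f := fun ϑ => ϑ - θ) (by fun_prop) fun ϑ hϑ =>
      hsub ⟨by linarith [hϑ.1], by linarith [hϑ.2]⟩
  rw [hset, setIntegral_union ?_ measurableSet_Icc hc1.integrableOn_Icc hc2.integrableOn_Icc,
    integral_Icc_eq_integral_Ioc, integral_Icc_eq_integral_Ioc,
    ← intervalIntegral.integral_of_le (by linarith [hε.2]),
    ← intervalIntegral.integral_of_le (by linarith [hε.2]),
    ← intervalIntegral.integral_comp_sub_left (fun ϑ => Real.cot ((θ - ϑ) / 2) * f ϑ) θ,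
    ← intervalIntegral.integral_comp_add_left (fun ϑ => Real.cot ((θ - ϑ) / 2) * f ϑ) θ,
    ← intervalIntegral.integral_add]
  · refine intervalIntegral.integral_congr fun y _ => ?_
    simp only [hilbertKernel]
    rw [sub_sub_cancel, show (θ - (θ + y)) / 2 = -(y / 2) by ring, Real.cot_eq_cos_div_sin (-(y / 2)),
      cos_neg, sin_neg, div_neg, ← Real.cot_eq_cos_div_sin]
    ring
  · refine ContinuousOn.intervalIntegrable ?_
    rw [uIcc_of_le hε.2]
    exact hc1.comp (f := fun y => θ - y) (by fun_prop) fun y hy =>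
      ⟨by linarith [hy.2], by linarith [hy.1]⟩
  · refine ContinuousOn.intervalIntegrable ?_
    rw [uIcc_of_le hε.2]
    exact hc2.comp (f := fun y => θ + y) (by fun_prop) fun y hy =>
      ⟨by linarith [hy.1], by linarith [hy.2]⟩
  · refine Set.disjoint_left.2 fun ϑ h1 h2 => ?_
    linarith [h1.2, h2.1, hε.1]

theorem hasHilbert_hilbert (hf : LipschitzWith K f) (θ : ℝ) : HasHilbert f θ (hilbert f θ) := by
  have hc : ContinuousOn (fun ε => ∫ y in ε..π, hilbertKernel f θ y) (uIcc 0 π) := by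
    refine intervalIntegral.continuousOn_primitive_interval_left ?_
    rw [uIcc_of_le pi_pos.le, integrableOn_Icc_iff_integrableOn_Ioc]
    exact (intervalIntegrable_iff_integrableOn_Ioc_of_le pi_pos.le).1
      (intervalIntegrable_hilbertKernel hf θ)
  have h0 : Tendsto (fun ε => ∫ y in ε..π, hilbertKernel f θ y) (𝓝[>] 0)
      (𝓝 (∫ y in (0 : ℝ)..π, hilbertKernel f θ y)) := by
    refine (hc 0 left_mem_uIcc).mono_left ?_
    rw [uIcc_of_le pi_pos.le, ← nhdsWithin_Ioc_eq_nhdsGT pi_pos]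
    exact nhdsWithin_mono _ Ioc_subset_Icc_self
  refine (h0.const_mul (1 / (2 * π))).congr' ?_
  filter_upwards [Ioc_mem_nhdsGT pi_pos] with ε hε
  rw [setIntegral_cot_eq hf.continuous θ hε]

theorem HasHilbert.eq_hilbert (hf : LipschitzWith K f) {θ h : ℝ} (hh : HasHilbert f θ h) :
    h = hilbert f θ :=
  tendsto_nhds_unique hh (hasHilbert_hilbert hf θ)

theorem continuous_hilbert (hf : LipschitzWith K f) : Continuous (hilbert f) := by
  refine continuous_const.mul ?_
  refine intervalIntegral.continuous_of_dominated_interval (bound := fun _ => 2 * π * K)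
    (fun θ => (measurable_hilbertKernel hf.continuous θ).aestronglyMeasurable)
    (fun θ => ae_of_all _ fun y hy => ?_) (by simp) (ae_of_all _ fun y _ => ?_)
  · rw [uIoc_of_le pi_pos.le] at hy
    exact abs_hilbertKernel_le hf θ hy
  · have := hf.continuous
    unfold hilbertKernel
    fun_prop

/-! ### The Hilbert transform on Fourier modes -/

theorem integral_cos_nat_mul {n : ℕ} (hn : n ≠ 0) : ∫ y in (0 : ℝ)..π, cos (n * y) = 0 := by
  have : (n : ℝ) ≠ 0 := by exact_mod_cast hn
  rw [intervalIntegral.integral_comp_mul_left _ this, integral_cos]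
  simp

theorem lipschitzWith_sin_nat_mul (n : ℕ) : LipschitzWith n fun θ : ℝ => sin (n * θ) := by
  refine lipschitzWith_of_nnnorm_deriv_le (by fun_prop) fun θ => ?_
  have h : HasDerivAt (fun θ : ℝ => sin (n * θ)) (cos (n * θ) * n) θ := by
    simpa using ((hasDerivAt_id θ).const_mul (n : ℝ)).sin
  rw [h.deriv, ← NNReal.coe_le_coe, coe_nnnorm, norm_mul, Real.norm_eq_abs, Real.norm_natCast]
  exact mul_le_of_le_one_left (Nat.cast_nonneg n) (abs_cos_le_one _)

theorem hilbertKernel_sin (n : ℕ) (θ y : ℝ) : hilbertKernel (fun θ => sin (n * θ)) θ y =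
    -2 * cos (n * θ) * (Real.cot (y / 2) * sin (n * y)) := by
  rw [hilbertKernel, mul_sub (n : ℝ), mul_add (n : ℝ), sin_sub, sin_add]
  ring

theorem intervalIntegrable_cot_mul_sin (n : ℕ) :
    IntervalIntegrable (fun y => Real.cot (y / 2) * sin (n * y)) volume 0 π := by
  have h := (intervalIntegrable_hilbertKernel (lipschitzWith_sin_nat_mul n) 0).const_mul (-1 / 2)
  refine h.congr fun y _ => ?_
  simp only [hilbertKernel_sin]
  simp
  ring

/-- Since cot(y/2) (sin((n+1)y) - sin(ny)) = cos((n+1)y) + cos(ny), the integral is the same for all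
positive frequencies; the value π is the integral of cos 0 in the step from frequency 0 to 1. -/
theorem integral_cot_mul_sin (n : ℕ) :
    ∫ y in (0 : ℝ)..π, Real.cot (y / 2) * sin ((n + 1 : ℕ) * y) = π := by
  have step : ∀ n : ℕ, ∫ y in (0 : ℝ)..π, Real.cot (y / 2) * sin ((n + 1 : ℕ) * y) =
      (∫ y in (0 : ℝ)..π, Real.cot (y / 2) * sin (n * y)) +
        ((∫ y in (0 : ℝ)..π, cos ((n + 1 : ℕ) * y)) + ∫ y in (0 : ℝ)..π, cos (n * y)) := fun n => by
    rw [← intervalIntegral.integral_add (Continuous.intervalIntegrable (by fun_prop) _ _)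
      (Continuous.intervalIntegrable (by fun_prop) _ _), ← intervalIntegral.integral_add
      (intervalIntegrable_cot_mul_sin n) (Continuous.intervalIntegrable (by fun_prop) _ _)]
    refine intervalIntegral.integral_congr_ae (ae_of_all _ fun y hy => ?_)
    rw [uIoc_of_le pi_pos.le] at hy
    have hs := (sin_half_pos hy).ne'
    have e1 : ((n + 1 : ℕ) : ℝ) * y = n * y + 2 * (y / 2) := by push_cast; ring
    rw [Real.cot_eq_cos_div_sin, e1, sin_add, cos_add, sin_two_mul, cos_two_mul']
    generalize (n : ℝ) * y = a
    field_simp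
    linear_combination (sin a * cos (y / 2) + cos a * sin (y / 2)) *
      sin_sq_add_cos_sq (y / 2)
  induction n with
  | zero =>
    rw [step, integral_cos_nat_mul (by omega)]
    simp
  | succ n ih =>
    rw [step, ih, integral_cos_nat_mul (by omega), integral_cos_nat_mul (by omega)]
    ring

theorem hilbert_sin (n : ℕ) (θ : ℝ) :
    hilbert (fun θ => sin ((n + 1 : ℕ) * θ)) θ = -cos ((n + 1 : ℕ) * θ) := by
  simp only [hilbert, hilbertKernel_sin]
  rw [intervalIntegral.integral_const_mul, integral_cot_mul_sin]
  field_simp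

theorem integral_hilbertKernel_mul_cos (hf : Continuous f) (hfp : Function.Periodic f (2 * π)) (n : ℕ)
    (y : ℝ) : ∫ θ in (-π)..π, hilbertKernel f θ y * cos (n * θ) =
      -2 * (∫ θ in (-π)..π, f θ * sin (n * θ)) * (Real.cot (y / 2) * sin (n * y)) := by
  have shift : ∀ a : ℝ, ∫ θ in (-π)..π, f (θ + a) * cos (n * θ) =
      ∫ θ in (-π)..π, f θ * cos (n * (θ - a)) := fun a => by
    have hp : Function.Periodic (fun θ => f θ * cos (n * (θ - a))) (2 * π) := fun θ => by
      change f (θ + 2 * π) * cos (n * (θ + 2 * π - a)) = f θ * cos (n * (θ - a))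
      rw [hfp, show (n : ℝ) * (θ + 2 * π - a) = n * (θ - a) + n * (2 * π) by ring,
        cos_add_nat_mul_two_pi]
    have h1 := intervalIntegral.integral_comp_add_right (a := -π) (b := π)
      (fun θ => f θ * cos (n * (θ - a))) a
    simp only [add_sub_cancel_right] at h1
    rw [h1]
    have h2 := hp.intervalIntegral_add_eq (-π + a) (-π)
    rw [show -π + a + 2 * π = π + a by ring, show -π + 2 * π = π by ring] at h2
    exact h2
  have e : ∀ θ, hilbertKernel f θ y * cos (n * θ) =
      Real.cot (y / 2) * (f (θ + -y) * cos (n * θ) - f (θ + y) * cos (n * θ)) := fun θ => by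
    rw [hilbertKernel, sub_eq_add_neg θ y]
    ring
  simp only [e]
  rw [intervalIntegral.integral_const_mul, intervalIntegral.integral_sub
    (Continuous.intervalIntegrable (by fun_prop) _ _)
    (Continuous.intervalIntegrable (by fun_prop) _ _), shift, shift,
    ← intervalIntegral.integral_sub (Continuous.intervalIntegrable (by fun_prop) _ _)
    (Continuous.intervalIntegrable (by fun_prop) _ _)]
  have e2 : ∀ θ, f θ * cos (n * (θ - -y)) - f θ * cos (n * (θ - y)) =
      -2 * sin (n * y) * (f θ * sin (n * θ)) := fun θ => by
    rw [sub_neg_eq_add, mul_add, mul_sub, cos_add, cos_sub]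
    ring
  simp only [e2]
  rw [intervalIntegral.integral_const_mul]
  ring

/-- Fubini and translation invariance give the Fourier multiplier without expanding `f`. The case `n
= 0`, that the transform has mean zero, makes velocities periodic. -/
theorem integral_hilbert_mul_cos (hf : LipschitzWith K f) (hfp : Function.Periodic f (2 * π))
    (n : ℕ) : ∫ θ in (-π)..π, hilbert f θ * cos (n * θ) = -∫ θ in (-π)..π, f θ * sin (n * θ) := by
  have hpi : -π ≤ π := by linarith [pi_pos]
  have hint : Integrable (Function.uncurry fun θ y => hilbertKernel f θ y * cos (n * θ))
      ((volume.restrict (uIoc (-π) π)).prod (volume.restrict (Ioc 0 π))) := by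
    rw [uIoc_of_le hpi, Measure.prod_restrict]
    refine Measure.integrableOn_of_bounded (M := 2 * π * K) ?_ ?_ ?_
    · rw [Measure.prod_prod, Real.volume_Ioc, Real.volume_Ioc]
      exact ENNReal.mul_ne_top ENNReal.ofReal_ne_top ENNReal.ofReal_ne_top
    · have hc := hf.continuous
      refine Measurable.aestronglyMeasurable ?_
      refine ((measurable_cot.comp (measurable_snd.div_const 2)).mul
        (by fun_prop : Continuous fun p : ℝ × ℝ => f (p.1 - p.2) - f (p.1 + p.2)).measurable).mul
        (by fun_prop : Continuous fun p : ℝ × ℝ => cos (n * p.1)).measurable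
    · filter_upwards [ae_restrict_mem (measurableSet_Ioc.prod measurableSet_Ioc)] with p hp
      simp only [Function.uncurry, norm_mul, Real.norm_eq_abs]
      calc _ ≤ 2 * π * K * 1 := by
            gcongr
            exacts [abs_hilbertKernel_le hf _ hp.2, abs_cos_le_one _]
        _ = _ := mul_one _
  have h1 : ∫ θ in (-π)..π, hilbert f θ * cos (n * θ) =
      1 / (2 * π) * ∫ θ in (-π)..π, ∫ y in Ioc 0 π, hilbertKernel f θ y * cos (n * θ) := by
    rw [← intervalIntegral.integral_const_mul]
    refine intervalIntegral.integral_congr fun θ _ => ?_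
    simp only [hilbert]
    rw [integral_mul_const, intervalIntegral.integral_of_le pi_pos.le]
    ring
  rw [h1, intervalIntegral_integral_swap hint]
  simp only [integral_hilbertKernel_mul_cos hf.continuous hfp]
  rw [integral_const_mul, ← intervalIntegral.integral_of_le pi_pos.le]
  cases n with
  | zero => simp
  | succ n =>
    rw [integral_cot_mul_sin]
    field_simp

theorem hasSum_hilbert {F : ℕ → ℝ → ℝ} {L : ℕ → NNReal} (hF : ∀ i, LipschitzWith (L i) (F i))
    (hL : Summable L) (hf : ∀ θ, HasSum (fun i => F i θ) (f θ)) (θ : ℝ) :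
    HasSum (fun i => hilbert (F i) θ) (hilbert f θ) := by
  refine HasSum.mul_left _ ?_
  have hL' : Summable fun i => 2 * π * (L i : ℝ) := (NNReal.summable_coe.2 hL).mul_left _
  refine intervalIntegral.hasSum_integral_of_dominated_convergence (fun i _ => 2 * π * (L i : ℝ))
    (fun i => (measurable_hilbertKernel (hF i).continuous θ).aestronglyMeasurable)
    (fun i => ae_of_all _ fun y hy => ?_) (ae_of_all _ fun _ _ => hL') (by simp)
    (ae_of_all _ fun y _ => ((hf _).sub (hf _)).mul_left _)
  rw [uIoc_of_le pi_pos.le] at hy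
  exact abs_hilbertKernel_le (hF i) θ hy

end Hilbert

/-! ### Uniqueness of classical odd solutions -/

/-- The sine coefficients of a function. -/
def sineCoeff (f : ℝ → ℝ) (n : ℕ) : ℝ := ∫ θ in (-π)..π, f θ * sin (n * θ)

theorem integral_eq_zero_of_odd {f : ℝ → ℝ} (hf : Function.Odd f) (a : ℝ) :
    ∫ θ in (-a)..a, f θ = 0 := by
  have h := intervalIntegral.integral_comp_neg (a := -a) (b := a) f
  have e : (fun θ => f (-θ)) = fun θ => -f θ := funext hf
  rw [e, intervalIntegral.integral_neg, neg_neg] at h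
  linarith

theorem exists_lipschitzWith_of_periodic {f : ℝ → ℝ} (hf : ContDiff ℝ 1 f)
    (hp : Function.Periodic f (2 * π)) : ∃ K, LipschitzWith K f := by
  have hc : Continuous (deriv f) := hf.continuous_deriv_one
  obtain ⟨C, hC⟩ := (isCompact_Icc (a := -π) (b := π)).exists_bound_of_continuousOn hc.continuousOn
  have hdp : Function.Periodic (deriv f) (2 * π) := by
    rw [← iteratedDeriv_one]
    exact periodic_iteratedDeriv hp 1
  refine ⟨C.toNNReal, lipschitzWith_of_nnnorm_deriv_le (hf.differentiable one_ne_zero) fun θ => ?_⟩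
  obtain ⟨y, hy, hfy⟩ := hdp.exists_mem_Ico (by positivity) θ (-π)
  rw [show -π + 2 * π = π by ring] at hy
  rw [hfy, ← NNReal.coe_le_coe, coe_nnnorm]
  exact (hC y (Ico_subset_Icc_self hy)).trans (le_coe_toNNReal C)

theorem hasDerivAt_sin_two_mul (θ : ℝ) : HasDerivAt (fun x => sin (2 * x)) (2 * cos (2 * θ)) θ := by
  have := ((hasDerivAt_id θ).const_mul (2 : ℝ)).sin
  convert! this using 1
  simp
  ring

theorem integral_velocity_mul_sin {f v : ℝ → ℝ} {K : NNReal} (hf : LipschitzWith K f)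
    (hfp : Function.Periodic f (2 * π)) (hv : ∀ θ, HasDerivAt v (hilbert f θ) θ) :
    v π = v (-π) ∧ ∀ n : ℕ, sineCoeff v (n + 1) = -(1 / (n + 1 : ℝ)) * sineCoeff f (n + 1) := by
  have hH := continuous_hilbert hf
  have hper : v π = v (-π) := by
    have h0 := integral_hilbert_mul_cos hf hfp 0
    simp only [Nat.cast_zero, zero_mul, cos_zero, mul_one, sin_zero, mul_zero,
      intervalIntegral.integral_zero, neg_zero] at h0
    rw [intervalIntegral.integral_eq_sub_of_hasDerivAt (fun θ _ => hv θ)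
      (hH.intervalIntegrable _ _)] at h0
    linarith
  refine ⟨hper, fun n => ?_⟩
  have hcos : ∀ θ : ℝ, HasDerivAt (fun θ => cos ((n + 1 : ℕ) * θ))
      (-((n + 1 : ℕ) * sin ((n + 1 : ℕ) * θ))) θ := fun θ => by
    have := ((hasDerivAt_id θ).const_mul ((n + 1 : ℕ) : ℝ)).cos
    convert! this using 1
    simp
    ring
  have h := integral_mul_deriv_eq_neg hv hcos (hH.intervalIntegrable _ _)
    (Continuous.intervalIntegrable (by fun_prop) _ _) hper (by simp)
  rw [integral_hilbert_mul_cos hf hfp] at h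
  have e : ∀ θ, v θ * -(((n + 1 : ℕ) : ℝ) * sin ((n + 1 : ℕ) * θ)) =
      -((n + 1 : ℕ) : ℝ) * (v θ * sin ((n + 1 : ℕ) * θ)) := fun θ => by ring
  simp only [e] at h
  rw [intervalIntegral.integral_const_mul, neg_neg] at h
  have hn : (n : ℝ) + 1 ≠ 0 := by positivity
  unfold sineCoeff
  push_cast at h ⊢
  rw [← h]
  field_simp

/-! ### The equation in sine coefficients -/

/-- Integration by parts moves the derivative off `g`; product formulas for 4 cos 2θ sin nθ + n sin
2θ cos nθ then leave only the frequencies n ± 2. -/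
theorem integral_bracket_mul_sin {g g' : ℝ → ℝ} (hg : ∀ θ, HasDerivAt g (g' θ) θ)
    (hg' : Continuous g') (hp : g π = g (-π)) (n : ℕ) :
    ∫ θ in (-π)..π, bracket g (fun x => sin (2 * x)) θ * sin (n * θ) =
      (2 + n / 2) * (∫ θ in (-π)..π, g θ * sin (((n : ℝ) + 2) * θ)) +
        (2 - n / 2) * ∫ θ in (-π)..π, g θ * sin (((n : ℝ) - 2) * θ) := by
  have hgc : Continuous g := continuous_iff_continuousAt.2 fun θ => (hg θ).continuousAt
  have hw : ∀ θ : ℝ, HasDerivAt (fun θ => sin (2 * θ) * sin (n * θ))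
      (2 * cos (2 * θ) * sin (n * θ) + sin (2 * θ) * (n * cos (n * θ))) θ := fun θ => by
    have h2 : HasDerivAt (fun θ : ℝ => sin (n * θ)) (n * cos (n * θ)) θ := by
      have := ((hasDerivAt_id θ).const_mul (n : ℝ)).sin
      convert! this using 1
      simp
      ring
    exact (hasDerivAt_sin_two_mul θ).mul h2
  have hparts := integral_mul_deriv_eq_neg hg hw (hg'.intervalIntegrable _ _)
    (Continuous.intervalIntegrable (by fun_prop) _ _) hp (by simp)
  have e1 : ∀ θ, bracket g (fun x => sin (2 * x)) θ * sin (n * θ) =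
      g θ * (2 * cos (2 * θ) * sin (n * θ)) - g' θ * (sin (2 * θ) * sin (n * θ)) := fun θ => by
    rw [bracket, (hasDerivAt_sin_two_mul θ).deriv, (hg θ).deriv]
    ring
  simp only [e1]
  rw [intervalIntegral.integral_sub (Continuous.intervalIntegrable (by fun_prop) _ _)
    (Continuous.intervalIntegrable (by fun_prop) _ _), sub_eq_add_neg, ← hparts,
    ← intervalIntegral.integral_add (Continuous.intervalIntegrable (by fun_prop) _ _)
    (Continuous.intervalIntegrable (by fun_prop) _ _), ← intervalIntegral.integral_const_mul,
    ← intervalIntegral.integral_const_mul,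
    ← intervalIntegral.integral_add (Continuous.intervalIntegrable (by fun_prop) _ _)
    (Continuous.intervalIntegrable (by fun_prop) _ _)]
  refine intervalIntegral.integral_congr fun θ _ => ?_
  simp only [add_mul, sub_mul, sin_add, sin_sub]
  ring

/-- The subdiagonal coefficients of the system in the basis `sin ((i + 1) θ)`. -/
def sineLower (σ : ℝ) (i : ℕ) : ℝ := (2 - ((i : ℝ) + 3) / 2) * (1 / 2 - σ / (i + 1))

/-- The superdiagonal coefficients of the system in the basis `sin ((i + 1) θ)`. -/
def sineUpper (σ : ℝ) (i : ℕ) : ℝ := (2 + ((i : ℝ) + 1) / 2) * (1 / 2 - σ / (i + 3))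

/-- The diagonal coefficients of the system in the basis `sin ((i + 1) θ)`. -/
def sineDiag (σ : ℝ) (i : ℕ) : ℝ := if i = 0 then -(3 / 2) * (1 / 2 - σ) else 0

theorem abs_div_add_le_one {σ : ℝ} (hσ : |σ| ≤ 1) (i : ℕ) {a : ℝ} (ha : 1 ≤ a) :
    |σ / (i + a)| ≤ 1 := by
  have hi : (0 : ℝ) ≤ i := Nat.cast_nonneg i
  rw [abs_div, abs_of_pos (by linarith : (0 : ℝ) < i + a), div_le_one (by linarith)]
  linarith

theorem almostSkew_sine {σ : ℝ} (hσ : |σ| ≤ 1) :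
    AlmostSkew (sineLower σ) (sineDiag σ) (sineUpper σ) 10 where
  lower i := by
    have hi : (0 : ℝ) ≤ i := Nat.cast_nonneg i
    have h1 := abs_le.1 (abs_div_add_le_one hσ i le_rfl)
    rw [sineLower, abs_mul]
    calc _ ≤ ((i : ℝ) + 2) * 10 := by
          gcongr
          · rw [abs_le]; constructor <;> linarith
          · rw [abs_le]; constructor <;> linarith
      _ = _ := by ring
  upper i := by
    have hi : (0 : ℝ) ≤ i := Nat.cast_nonneg i
    have h1 := abs_le.1 (abs_div_add_le_one hσ i (by norm_num : (1 : ℝ) ≤ 3))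
    rw [sineUpper, abs_mul]
    calc _ ≤ (2 * ((i : ℝ) + 2)) * 5 := by
          gcongr
          · rw [abs_le]; constructor <;> linarith
          · rw [abs_le]; constructor <;> linarith
      _ = _ := by ring
  diag i := by
    have h := abs_le.1 hσ
    unfold sineDiag
    split_ifs
    · rw [abs_le]; constructor <;> linarith
    · simp
  skew i := by
    have hi : (0 : ℝ) ≤ i := Nat.cast_nonneg i
    have h1 := abs_div_add_le_one hσ i le_rfl
    have h3 := abs_div_add_le_one hσ i (by norm_num : (1 : ℝ) ≤ 3)
    have hσ' := abs_le.1 hσ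
    -- The parts growing linearly in `i` have opposite signs and cancel.
    have e : sineLower σ i + sineUpper σ i = 3 / 2 - σ / (i + 1) - σ / (i + 3) := by
      unfold sineLower sineUpper
      field_simp
      ring
    rw [e]
    have h1' := abs_le.1 h1
    have h3' := abs_le.1 h3
    rw [abs_le]
    constructor <;> linarith

theorem integral_velocity_bracket_mul_sin {σ : ℝ} {f v : ℝ → ℝ} (hf : ContDiff ℝ 1 f)
    (hfp : Function.Periodic f (2 * π)) (hv : IsVelocity f v) (i : ℕ) :
    ∫ θ in (-π)..π, bracket (fun x => 1 / 2 * f x + σ * v x) (fun x => sin (2 * x)) θ *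
        sin ((i + 1 : ℕ) * θ) =
      neighbourSum (sineLower σ) (sineDiag σ) (sineUpper σ) (fun j => sineCoeff f (j + 1)) i := by
  obtain ⟨K, hK⟩ := exists_lipschitzWith_of_periodic hf hfp
  have hvd : ∀ θ, HasDerivAt v (hilbert f θ) θ := fun θ => by
    obtain ⟨h, hh, hd⟩ := hv.2 θ
    rwa [hh.eq_hilbert hK] at hd
  obtain ⟨hvp, hvs⟩ := integral_velocity_mul_sin hK hfp hvd
  have hvc : Continuous v := continuous_iff_continuousAt.2 fun θ => (hvd θ).continuousAt
  have hfc : Continuous f := hf.continuous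
  have hfd : ∀ θ, HasDerivAt f (deriv f θ) θ := fun θ =>
    (hf.differentiable one_ne_zero θ).hasDerivAt
  have hgs : ∀ j : ℕ, ∫ θ in (-π)..π, (1 / 2 * f θ + σ * v θ) * sin (((j : ℝ) + 1) * θ) =
      (1 / 2 - σ / (j + 1)) * sineCoeff f (j + 1) := fun j => by
    have e : ∀ θ, (1 / 2 * f θ + σ * v θ) * sin (((j : ℝ) + 1) * θ) =
        1 / 2 * (f θ * sin ((j + 1 : ℕ) * θ)) + σ * (v θ * sin ((j + 1 : ℕ) * θ)) := fun θ => by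
      push_cast; ring
    simp only [e]
    rw [intervalIntegral.integral_add (Continuous.intervalIntegrable (by fun_prop) _ _)
      (Continuous.intervalIntegrable (by fun_prop) _ _), intervalIntegral.integral_const_mul,
      intervalIntegral.integral_const_mul]
    have := hvs j
    unfold sineCoeff at this ⊢
    rw [this]
    ring
  have hg : ∀ θ, HasDerivAt (fun x => 1 / 2 * f x + σ * v x)
      (1 / 2 * deriv f θ + σ * hilbert f θ) θ := fun θ =>
    ((hfd θ).const_mul (1 / 2)).add ((hvd θ).const_mul σ)
  rw [integral_bracket_mul_sin hg
    (((hf.continuous_deriv_one).const_mul _).add ((continuous_hilbert hK).const_mul _))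
    (by rw [hvp, hfp.apply_pi_eq])]
  have hup : ∫ θ in (-π)..π, (1 / 2 * f θ + σ * v θ) * sin ((((i + 1 : ℕ) : ℝ) + 2) * θ) =
      (1 / 2 - σ / (i + 3)) * sineCoeff f (i + 2 + 1) := by
    have := hgs (i + 2)
    push_cast at this ⊢
    rw [show (i : ℝ) + 2 + 1 = i + 1 + 2 by ring] at this
    rw [this]
    ring
  rw [hup, neighbourSum]
  rcases Nat.lt_or_ge i 2 with hi | hi
  · rw [if_neg (by omega)]
    interval_cases i
    · have h0 := hgs 0
      -- Frequency -1 folds back onto frequency 1, which is the source of the single nonzero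
      -- diagonal coefficient.
      have e : ∀ θ, (1 / 2 * f θ + σ * v θ) * sin ((((0 + 1 : ℕ) : ℝ) - 2) * θ) =
          -((1 / 2 * f θ + σ * v θ) * sin ((((0 : ℕ) : ℝ) + 1) * θ)) := fun θ => by
        rw [← mul_neg, ← sin_neg]
        norm_num
      simp only [e]
      rw [intervalIntegral.integral_neg, h0]
      simp only [sineDiag, sineUpper, if_true]
      push_cast
      ring
    · have e : ∀ θ, (1 / 2 * f θ + σ * v θ) * sin ((((1 + 1 : ℕ) : ℝ) - 2) * θ) = 0 := fun θ => by
        norm_num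
      simp only [e]
      simp only [sineDiag, sineUpper, intervalIntegral.integral_zero]
      push_cast
      ring_nf
  · obtain ⟨j, rfl⟩ := Nat.exists_eq_add_of_le' hi
    have h0 := hgs j
    rw [if_pos hi]
    have e : (((j + 2 + 1 : ℕ) : ℝ) - 2) = j + 1 := by push_cast; ring
    rw [e, h0]
    simp only [Nat.add_sub_cancel, sineLower, sineDiag, sineUpper, if_neg (by omega : ¬ j + 2 = 0)]
    push_cast
    ring

namespace IsClassicalOddSolution

variable {σ T : ℝ} {η₀ : ℝ → ℝ} {η : ℝ → ℝ → ℝ}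

theorem contDiff_apply (h : IsClassicalOddSolution σ T η₀ η) {t : ℝ} (ht : t ∈ Icc 0 T) :
    ContDiff ℝ 1 (η t) :=
  h.contDiffOn.comp_contDiff (by fun_prop : ContDiff ℝ 1 fun θ : ℝ => (t, θ)) fun _ => ⟨ht, mem_univ _⟩

theorem continuous_comp_projIcc (h : IsClassicalOddSolution σ T η₀ η) (hT : 0 ≤ T) :
    Continuous fun p : ℝ × ℝ => η (projIcc 0 T hT p.1) p.2 :=
  h.contDiffOn.continuousOn.comp_continuous
    (((continuous_subtype_val.comp (continuous_projIcc (h := hT))).comp continuous_fst).prodMk continuous_snd)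
    fun p => ⟨(projIcc 0 T hT p.1).2, mem_univ _⟩

theorem continuousOn_sineCoeff (h : IsClassicalOddSolution σ T η₀ η) (hT : 0 ≤ T) (n : ℕ) :
    ContinuousOn (fun t => sineCoeff (η t) n) (Icc 0 T) := by
  have hc := h.continuous_comp_projIcc hT
  have h1 : Continuous fun t : ℝ => sineCoeff (η (projIcc 0 T hT t)) n :=
    intervalIntegral.continuous_parametric_intervalIntegral_of_continuous'
      (f := fun t θ => η (projIcc 0 T hT t) θ * sin (n * θ))
      (hc.mul (by fun_prop : Continuous fun p : ℝ × ℝ => sin (n * p.2))) _ _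
  exact h1.continuousOn.congr fun t ht => by simp only [projIcc_of_mem hT ht]

theorem exists_abs_sineCoeff_le (h : IsClassicalOddSolution σ T η₀ η) :
    ∃ M, ∀ n : ℕ, ∀ t ∈ Icc 0 T, |sineCoeff (η t) n| ≤ M := by
  obtain ⟨B, hB⟩ := ((isCompact_Icc (a := (0 : ℝ)) (b := T)).prod
    (isCompact_Icc (a := -π) (b := π))).exists_bound_of_continuousOn
    (h.contDiffOn.continuousOn.mono (prod_mono subset_rfl (subset_univ _)))
  refine ⟨B * |π - -π|, fun n t ht => ?_⟩
  rw [← Real.norm_eq_abs, sineCoeff]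
  refine intervalIntegral.norm_integral_le_of_norm_le_const fun θ hθ => ?_
  rw [uIoc_of_le (by linarith [pi_pos])] at hθ
  have h1 := hB (t, θ) ⟨ht, Ioc_subset_Icc_self hθ⟩
  rw [norm_mul]
  calc _ ≤ B * 1 := by
        gcongr
        · exact (norm_nonneg _).trans h1
        · exact abs_sin_le_one _
    _ = B := mul_one B

/-- Joint C¹ regularity bounds the time derivative on compact sets, which justifies differentiation
under the integral; uniqueness of derivatives identifies that derivative with the bracket. -/
theorem hasDerivAt_sineCoeff (h : IsClassicalOddSolution σ T η₀ η) (i : ℕ) {t : ℝ}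
    (ht : t ∈ Ioo 0 T) : HasDerivAt (fun t => sineCoeff (η t) (i + 1))
      (neighbourSum (sineLower σ) (sineDiag σ) (sineUpper σ)
        (fun j => sineCoeff (η t) (j + 1)) i) t := by
  have hT : 0 < T := ht.1.trans ht.2
  have hu : UniqueDiffOn ℝ (Icc 0 T ×ˢ (univ : Set ℝ)) :=
    (uniqueDiffOn_Icc hT).prod uniqueDiffOn_univ
  set D : ℝ → ℝ → ℝ := fun t θ =>
    fderivWithin ℝ (fun p : ℝ × ℝ => η p.1 p.2) (Icc 0 T ×ˢ univ) (t, θ) (1, 0) with hD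
  have hDc : ContinuousOn (fun p : ℝ × ℝ => D p.1 p.2) (Icc 0 T ×ˢ univ) :=
    (h.contDiffOn.continuousOn_fderivWithin hu le_rfl).clm_apply continuousOn_const
  obtain ⟨B, hB⟩ := ((isCompact_Icc (a := (0 : ℝ)) (b := T)).prod
    (isCompact_Icc (a := -π) (b := π))).exists_bound_of_continuousOn
    (hDc.mono (prod_mono subset_rfl (subset_univ _)))
  have hder : ∀ s ∈ Icc 0 T, ∀ θ, HasDerivWithinAt (fun s => η s θ) (D s θ) (Icc 0 T) s :=
    fun s hs θ => by
      have h1 := (h.contDiffOn.differentiableOn one_ne_zero (s, θ)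
        ⟨hs, mem_univ _⟩).hasFDerivWithinAt
      have h2 : HasDerivWithinAt (fun s : ℝ => (s, θ)) (1, 0) (Icc 0 T) s :=
        (hasDerivWithinAt_id s _).prodMk (hasDerivWithinAt_const s _ θ)
      have h3 : MapsTo (fun s : ℝ => (s, θ)) (Icc 0 T) (Icc 0 T ×ˢ univ) := fun r hr => ⟨hr, mem_univ _⟩
      exact h1.comp_hasDerivWithinAt s h2 h3
  have hcη : ∀ s ∈ Ioo 0 T, Continuous (η s) := fun s hs =>
    (h.contDiff_apply (Ioo_subset_Icc_self hs)).continuous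
  have hcD : Continuous (D t) :=
    ContinuousOn.comp_continuous (g := fun p : ℝ × ℝ => D p.1 p.2) (f := fun θ : ℝ => (t, θ)) hDc
      (by fun_prop) fun _ => ⟨Ioo_subset_Icc_self ht, mem_univ _⟩
  have hmain := intervalIntegral.hasDerivAt_integral_of_dominated_loc_of_deriv_le (μ := volume)
    (a := -π) (b := π) (bound := fun _ => B) (x₀ := t) (s := Ioo 0 T)
    (F := fun t θ => η t θ * sin ((i + 1 : ℕ) * θ))
    (F' := fun t θ => D t θ * sin ((i + 1 : ℕ) * θ)) (Ioo_mem_nhds ht.1 ht.2) ?_ ?_ ?_ ?_ (by simp) ?_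
  · obtain ⟨v, hv, heq⟩ := h.equation t (Ioo_subset_Icc_self ht)
    have hDb : ∀ θ, D t θ = bracket (fun x => 1 / 2 * η t x + σ * v x) (fun x => sin (2 * x)) θ :=
      fun θ => (uniqueDiffOn_Icc hT t (Ioo_subset_Icc_self ht)).eq_deriv _
        (hder t (Ioo_subset_Icc_self ht) θ) (heq θ)
    have := hmain.2
    simp only [hDb] at this
    rwa [integral_velocity_bracket_mul_sin (h.contDiff_apply (Ioo_subset_Icc_self ht))
      (h.periodic t (Ioo_subset_Icc_self ht)) hv] at this
  · filter_upwards [Ioo_mem_nhds ht.1 ht.2] with s hs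
    have := hcη s hs
    exact Continuous.aestronglyMeasurable (by fun_prop)
  · have := hcη t ht
    exact Continuous.intervalIntegrable (by fun_prop) _ _
  · exact Continuous.aestronglyMeasurable (by fun_prop)
  · refine ae_of_all _ fun θ hθ s hs => ?_
    rw [uIoc_of_le (by linarith [pi_pos])] at hθ
    have h1 := hB (s, θ) ⟨Ioo_subset_Icc_self hs, Ioc_subset_Icc_self hθ⟩
    rw [norm_mul]
    calc _ ≤ B * 1 := by
          gcongr
          · exact (norm_nonneg _).trans h1
          · exact abs_sin_le_one _
      _ = B := mul_one B
  · refine ae_of_all _ fun θ _ s hs => ?_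
    exact ((hder s (Ioo_subset_Icc_self hs) θ).hasDerivAt (Icc_mem_nhds hs.1 hs.2)).mul_const _

theorem neighbourSum_sub (l d u x y : ℕ → ℝ) (i : ℕ) :
    neighbourSum l d u (fun j => x j - y j) i = neighbourSum l d u x i - neighbourSum l d u y i := by
  unfold neighbourSum
  split_ifs <;> ring

/-- The sine coefficients of the difference form a bounded solution with zero initial value, hence
vanish; the cosine coefficients vanish by oddness. -/
theorem unique {ζ : ℝ → ℝ → ℝ} (hσ : |σ| ≤ 1) (hη : IsClassicalOddSolution σ T η₀ η)
    (hζ : IsClassicalOddSolution σ T η₀ ζ) {t : ℝ} (ht : t ∈ Icc 0 T) : ζ t = η t := by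
  have hT : 0 ≤ T := ht.1.trans ht.2
  obtain ⟨M₁, hM₁⟩ := hη.exists_abs_sineCoeff_le
  obtain ⟨M₂, hM₂⟩ := hζ.exists_abs_sineCoeff_le
  have hzero : ∀ i, sineCoeff (ζ t) (i + 1) - sineCoeff (η t) (i + 1) = 0 := fun i => by
    refine (almostSkew_sine hσ).eq_zero_of_hasDerivAt
      (x := fun i t => sineCoeff (ζ t) (i + 1) - sineCoeff (η t) (i + 1)) (M := M₂ + M₁)
      (fun i s hs => ?_) (fun i => ?_) (fun i s hs => ?_) (fun i => ?_) i ht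
    · exact (abs_sub _ _).trans (add_le_add (hM₂ _ s hs) (hM₁ _ s hs))
    · exact (hζ.continuousOn_sineCoeff hT _).sub (hη.continuousOn_sineCoeff hT _)
    · rw [neighbourSum_sub]
      exact (hζ.hasDerivAt_sineCoeff i hs).sub (hη.hasDerivAt_sineCoeff i hs)
    · rw [show ζ 0 = η 0 from funext fun θ => (hζ.initial θ).trans (hη.initial θ).symm, sub_self]
  have hcη := (hη.contDiff_apply ht).continuous
  have hcζ := (hζ.contDiff_apply ht).continuous
  have hmem : MemLp (fun θ => ζ t θ - η t θ) 2 circleMeasure := by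
    obtain ⟨C, hC⟩ := (isCompact_Icc (a := -π) (b := π)).exists_bound_of_continuousOn
      (hcζ.sub hcη).continuousOn
    refine MemLp.of_bound (hcζ.sub hcη).aestronglyMeasurable C ?_
    filter_upwards [ae_restrict_mem measurableSet_Ioc] with θ hθ
    exact hC θ (Ioc_subset_Icc_self hθ)
  refine eq_of_ae_eq_circleMeasure hcζ hcη (hζ.periodic t ht) (hη.periodic t ht) ?_
  have h0 := ae_eq_zero_of_integral_eq_zero hmem (fun n => ?_) fun n => ?_
  · filter_upwards [h0] with θ hθ
    exact sub_eq_zero.1 hθ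
  · rw [integral_circleMeasure]
    refine integral_eq_zero_of_odd (fun θ => ?_) π
    rw [hζ.odd t ht θ, hη.odd t ht θ, mul_neg, cos_neg]
    ring
  · rw [integral_circleMeasure]
    cases n with
    | zero => simp
    | succ i =>
      rw [← hzero i, sineCoeff, sineCoeff, ← intervalIntegral.integral_sub
        (Continuous.intervalIntegrable (by fun_prop) _ _)
        (Continuous.intervalIntegrable (by fun_prop) _ _)]
      refine intervalIntegral.integral_congr fun θ _ => ?_
      ring

end IsClassicalOddSolution

/-! ### Series in the basis `e` -/

/-- At zeros of the sine the weights take the default value of division by zero; such points are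
negligible in every integral. -/
theorem ae_sin_ne_zero : ∀ᵐ θ : ℝ, sin θ ≠ 0 := by
  have h : {θ : ℝ | sin θ = 0} = range fun n : ℤ => (n : ℝ) * π := by
    ext θ
    exact sin_eq_zero_iff
  have hc : {θ : ℝ | sin θ = 0}.Countable := h ▸ countable_range _
  simpa [ae_iff] using hc.measure_zero volume

theorem sin_mul_period {n : ℕ} (θ : ℝ) : sin (n * (θ + 2 * π)) = sin (n * θ) := by
  rw [show (n : ℝ) * (θ + 2 * π) = n * θ + n * (2 * π) by ring, sin_add_nat_mul_two_pi]

/-- The functions `e_{2,i+1}`. -/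
def mode (i : ℕ) (θ : ℝ) : ℝ :=
  sin ((i + 3 : ℕ) * θ) / (i + 3 : ℕ) - sin ((i + 1 : ℕ) * θ) / (i + 1 : ℕ)

/-- The derivative of `mode`. -/
def modeDeriv (i : ℕ) (θ : ℝ) : ℝ := -2 * sin θ * sin ((i + 2 : ℕ) * θ)

/-- The velocity of `mode`. -/
def modeVelocity (i : ℕ) (θ : ℝ) : ℝ :=
  sin ((i + 1 : ℕ) * θ) / ((i + 1 : ℕ) : ℝ) ^ 2 - sin ((i + 3 : ℕ) * θ) / ((i + 3 : ℕ) : ℝ) ^ 2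

/-- The Hilbert transform of `mode`. -/
def modeHilbert (i : ℕ) (θ : ℝ) : ℝ :=
  cos ((i + 1 : ℕ) * θ) / (i + 1 : ℕ) - cos ((i + 3 : ℕ) * θ) / (i + 3 : ℕ)

theorem e_succ (i : ℕ) : e (i + 1) = mode i := by
  ext θ
  unfold e mode
  push_cast
  rw [show (i : ℝ) + 1 + 2 = i + 3 by ring]

theorem hasDerivAt_sin_nat (n : ℕ) (θ : ℝ) :
    HasDerivAt (fun θ : ℝ => sin (n * θ)) (n * cos (n * θ)) θ := by
  have := ((hasDerivAt_id θ).const_mul (n : ℝ)).sin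
  convert! this using 1
  simp
  ring

theorem hasDerivAt_mode (i : ℕ) (θ : ℝ) : HasDerivAt (mode i) (modeDeriv i θ) θ := by
  have h := ((hasDerivAt_sin_nat (i + 3) θ).div_const ((i + 3 : ℕ) : ℝ)).sub
    ((hasDerivAt_sin_nat (i + 1) θ).div_const ((i + 1 : ℕ) : ℝ))
  convert! h using 1
  have h1 : ((i + 1 : ℕ) : ℝ) ≠ 0 := by positivity
  have h3 : ((i + 3 : ℕ) : ℝ) ≠ 0 := by positivity
  rw [mul_div_cancel_left₀ _ h1, mul_div_cancel_left₀ _ h3, modeDeriv,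
    show ((i + 3 : ℕ) : ℝ) * θ = (i + 2 : ℕ) * θ + θ by push_cast; ring,
    show ((i + 1 : ℕ) : ℝ) * θ = (i + 2 : ℕ) * θ - θ by push_cast; ring, cos_add, cos_sub]
  ring

theorem hasDerivAt_modeVelocity (i : ℕ) (θ : ℝ) :
    HasDerivAt (modeVelocity i) (modeHilbert i θ) θ := by
  have h := ((hasDerivAt_sin_nat (i + 1) θ).div_const (((i + 1 : ℕ) : ℝ) ^ 2)).sub
    ((hasDerivAt_sin_nat (i + 3) θ).div_const (((i + 3 : ℕ) : ℝ) ^ 2))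
  convert! h using 1
  have h1 : ((i + 1 : ℕ) : ℝ) ≠ 0 := by positivity
  have h3 : ((i + 3 : ℕ) : ℝ) ≠ 0 := by positivity
  rw [modeHilbert]
  field_simp

theorem abs_sub_le_two {a b : ℝ} (ha : |a| ≤ 1) (hb : |b| ≤ 1) : |a - b| ≤ 2 :=
  (abs_sub _ _).trans (by linarith)

theorem abs_div_succ_le {a : ℝ} (ha : |a| ≤ 1) (n k : ℕ) (hn : 0 < n) : |a / (n : ℝ) ^ k| ≤ 1 := by
  have : (1 : ℝ) ≤ (n : ℝ) ^ k := one_le_pow₀ (by exact_mod_cast hn)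
  rw [abs_div, abs_of_pos (by linarith : (0 : ℝ) < (n : ℝ) ^ k), div_le_one (by linarith)]
  linarith

theorem abs_mode_le (i : ℕ) (θ : ℝ) : |mode i θ| ≤ 2 := by
  have h3 := abs_div_succ_le (abs_sin_le_one ((i + 3 : ℕ) * θ)) (i + 3) 1 (by omega)
  have h1 := abs_div_succ_le (abs_sin_le_one ((i + 1 : ℕ) * θ)) (i + 1) 1 (by omega)
  rw [pow_one] at h1 h3
  exact abs_sub_le_two h3 h1

theorem abs_modeDeriv_le (i : ℕ) (θ : ℝ) : |modeDeriv i θ| ≤ 2 := by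
  unfold modeDeriv
  rw [abs_mul, abs_mul, abs_neg, abs_two]
  have h1 := abs_sin_le_one θ
  have h2 := abs_sin_le_one ((i + 2 : ℕ) * θ)
  calc (2 : ℝ) * |sin θ| * |sin ((i + 2 : ℕ) * θ)| ≤ 2 * 1 * 1 := by gcongr
    _ = 2 := by norm_num

theorem abs_modeVelocity_le (i : ℕ) (θ : ℝ) : |modeVelocity i θ| ≤ 2 :=
  abs_sub_le_two (abs_div_succ_le (abs_sin_le_one _) (i + 1) 2 (by omega))
    (abs_div_succ_le (abs_sin_le_one _) (i + 3) 2 (by omega))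

theorem abs_modeHilbert_le (i : ℕ) (θ : ℝ) : |modeHilbert i θ| ≤ 2 := by
  have h3 := abs_div_succ_le (abs_cos_le_one ((i + 3 : ℕ) * θ)) (i + 3) 1 (by omega)
  have h1 := abs_div_succ_le (abs_cos_le_one ((i + 1 : ℕ) * θ)) (i + 1) 1 (by omega)
  rw [pow_one] at h1 h3
  exact abs_sub_le_two h1 h3

theorem lipschitzWith_mode (i : ℕ) : LipschitzWith 2 (mode i) := by
  refine lipschitzWith_of_nnnorm_deriv_le (fun θ => (hasDerivAt_mode i θ).differentiableAt)
    fun θ => ?_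
  rw [(hasDerivAt_mode i θ).deriv, ← NNReal.coe_le_coe, coe_nnnorm]
  exact abs_modeDeriv_le i θ

theorem hilbert_mode (i : ℕ) (θ : ℝ) : hilbert (mode i) θ = modeHilbert i θ := by
  have hk : ∀ y, hilbertKernel (mode i) θ y =
      hilbertKernel (fun θ => sin ((i + 3 : ℕ) * θ)) θ y / (i + 3 : ℕ) -
        hilbertKernel (fun θ => sin ((i + 1 : ℕ) * θ)) θ y / (i + 1 : ℕ) := fun y => by
    unfold hilbertKernel mode
    ring
  have h3 := hilbert_sin (i + 2) θ
  have h1 := hilbert_sin i θ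
  unfold hilbert at h1 h3 ⊢
  simp only [hk]
  rw [intervalIntegral.integral_sub
    ((intervalIntegrable_hilbertKernel (lipschitzWith_sin_nat_mul _) θ).div_const _)
    ((intervalIntegrable_hilbertKernel (lipschitzWith_sin_nat_mul _) θ).div_const _),
    intervalIntegral.integral_div, intervalIntegral.integral_div, mul_sub, ← mul_div_assoc,
    ← mul_div_assoc, h1, h3, modeHilbert]
  ring

/-- The function with coefficients `c` in the basis `mode`. -/
def profile (c : ℕ → ℝ) (θ : ℝ) : ℝ := ∑' i, c i * mode i θ

/-- The velocity of `profile c`. -/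
def velocity (c : ℕ → ℝ) (θ : ℝ) : ℝ := ∑' i, c i * modeVelocity i θ

section Series

variable {c : ℕ → ℝ}

theorem summable_mul_of_abs_le (hc : Summable fun i => |c i|) {a : ℕ → ℝ} {M : ℝ}
    (ha : ∀ i, |a i| ≤ M) : Summable fun i => c i * a i := by
  refine Summable.of_norm_bounded (hc.mul_right M) fun i => ?_
  rw [norm_mul, Real.norm_eq_abs, Real.norm_eq_abs]
  gcongr
  exact ha i

theorem hasDerivAt_tsum_mul (hc : Summable fun i => |c i|) {g g' : ℕ → ℝ → ℝ} {M : ℝ}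
    (hg : ∀ i θ, HasDerivAt (g i) (g' i θ) θ) (hb : ∀ i θ, |g i θ| ≤ M)
    (hb' : ∀ i θ, |g' i θ| ≤ M) (θ : ℝ) :
    HasDerivAt (fun θ => ∑' i, c i * g i θ) (∑' i, c i * g' i θ) θ :=
  hasDerivAt_tsum (hc.mul_right M) (fun i θ => (hg i θ).const_mul (c i))
    (fun i θ => by
      rw [norm_mul, Real.norm_eq_abs, Real.norm_eq_abs]
      gcongr
      exact hb' i θ) (summable_mul_of_abs_le hc fun i => hb i 0) θ

theorem hasDerivAt_profile (hc : Summable fun i => |c i|) (θ : ℝ) :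
    HasDerivAt (profile c) (∑' i, c i * modeDeriv i θ) θ :=
  hasDerivAt_tsum_mul hc hasDerivAt_mode abs_mode_le abs_modeDeriv_le θ

theorem hasDerivAt_velocity (hc : Summable fun i => |c i|) (θ : ℝ) :
    HasDerivAt (velocity c) (∑' i, c i * modeHilbert i θ) θ :=
  hasDerivAt_tsum_mul hc hasDerivAt_modeVelocity abs_modeVelocity_le abs_modeHilbert_le θ

theorem profile_periodic (c : ℕ → ℝ) : Function.Periodic (profile c) (2 * π) := fun θ => by
  unfold profile mode
  simp only [sin_mul_period]

theorem profile_odd (c : ℕ → ℝ) : Function.Odd (profile c) := fun θ => by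
  unfold profile mode
  rw [← tsum_neg]
  congr 1
  ext i
  rw [mul_neg, sin_neg, mul_neg, sin_neg]
  ring

theorem deriv_profile (hc : Summable fun i => |c i|) (θ : ℝ) :
    deriv (profile c) θ = -2 * sin θ * ∑' i, c i * sin ((i + 2 : ℕ) * θ) := by
  rw [(hasDerivAt_profile hc θ).deriv, ← tsum_mul_left]
  congr 1
  ext i
  unfold modeDeriv
  ring

/-- The factor `sin θ` of `modeDeriv` cancels the weight, leaving a normalized sine series. The
minus sign recurs wherever coefficients are compared with Sobolev series. -/
theorem weightedDeriv_profile (hc : Summable fun i => |c i|) {θ : ℝ} (hθ : sin θ ≠ 0) :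
    weightedDeriv (profile c) θ = -∑' i, c i * ((√π)⁻¹ * sin ((i + 2 : ℕ) * θ)) := by
  have e : ∀ i, c i * ((√π)⁻¹ * sin ((i + 2 : ℕ) * θ)) =
      (√π)⁻¹ * (c i * sin ((i + 2 : ℕ) * θ)) := fun i => by ring
  have hpi : √π ≠ 0 := (sqrt_pos.2 pi_pos).ne'
  rw [weightedDeriv, deriv_profile hc]
  simp only [e]
  rw [tsum_mul_left]
  generalize ∑' i, c i * sin ((i + 2 : ℕ) * θ) = S
  field_simp

/-- After cancellation of the weight, orthonormality of the modes is that of the sines of frequency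
`i + 2`. -/
theorem coeff_profile (hc : Summable fun i => |c i|) (i : ℕ) : coeff (i + 1) (profile c) = c i := by
  have h1 : coeff (i + 1) (profile c) = ∫ θ in (-π)..π,
      ∑' j, c j * (1 / π * (sin ((j + 2 : ℕ) * θ) * sin ((i + 2 : ℕ) * θ))) := by
    refine intervalIntegral.integral_congr_ae ?_
    filter_upwards [ae_sin_ne_zero] with θ hθ _
    have e : ∀ j, c j * (1 / π * (sin ((j + 2 : ℕ) * θ) * sin ((i + 2 : ℕ) * θ))) =
        1 / π * sin ((i + 2 : ℕ) * θ) * (c j * sin ((j + 2 : ℕ) * θ)) := fun j => by ring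
    simp only [e]
    rw [tsum_mul_left, deriv_profile hc, e_succ, (hasDerivAt_mode i θ).deriv, rho, modeDeriv]
    generalize ∑' i, c i * sin ((i + 2 : ℕ) * θ) = S
    field_simp
    ring
  have hsum : HasSum (fun j => ∫ θ in (-π)..π,
      c j * (1 / π * (sin ((j + 2 : ℕ) * θ) * sin ((i + 2 : ℕ) * θ))))
      (coeff (i + 1) (profile c)) := by
    rw [h1]
    have hb : ∀ j θ, |1 / π * (sin ((j + 2 : ℕ) * θ) * sin ((i + 2 : ℕ) * θ))| ≤ 1 / π := fun j θ => by
      rw [abs_mul, abs_of_pos (by positivity : 0 < 1 / π), abs_mul]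
      calc 1 / π * (|sin ((j + 2 : ℕ) * θ)| * |sin ((i + 2 : ℕ) * θ)|) ≤ 1 / π * (1 * 1) := by
            gcongr
            exacts [abs_sin_le_one _, abs_sin_le_one _]
        _ = 1 / π := by ring
    refine intervalIntegral.hasSum_integral_of_dominated_convergence (fun j _ => |c j| * (1 / π))
      (fun j => Continuous.aestronglyMeasurable (by fun_prop)) (fun j => ae_of_all _ fun θ _ => ?_)
      (ae_of_all _ fun _ _ => hc.mul_right _) (by simp) (ae_of_all _ fun θ _ => ?_)
    · rw [norm_mul, Real.norm_eq_abs, Real.norm_eq_abs]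
      gcongr
      exact hb j θ
    · exact (summable_mul_of_abs_le hc fun j => hb j θ).hasSum
  refine hsum.unique ?_
  have hval : ∀ j, ∫ θ in (-π)..π,
      c j * (1 / π * (sin ((j + 2 : ℕ) * θ) * sin ((i + 2 : ℕ) * θ))) = if j = i then c i else 0 :=
    fun j => by
      have := integral_sin_mul_sin (j + 2) (i + 2) 0 (by omega)
      simp only [add_zero, Nat.add_right_cancel_iff] at this
      rw [intervalIntegral.integral_const_mul, intervalIntegral.integral_const_mul, this]
      split_ifs with h
      · subst h
        field_simp
      · simp
  simp only [hval]
  exact hasSum_ite_eq i (c i)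

theorem isVelocity_velocity (hc : Summable fun i => |c i|) :
    IsVelocity (profile c) (velocity c) := by
  refine ⟨by simp [velocity, modeVelocity], fun θ => ⟨_, ?_, hasDerivAt_velocity hc θ⟩⟩
  have hcn : Summable fun i => |c i|.toNNReal * 2 := by
    rw [← NNReal.summable_coe]
    simpa using hc.mul_right 2
  have hLip : ∀ i, LipschitzWith (|c i|.toNNReal * 2) fun θ => c i * mode i θ := fun i => by
    refine LipschitzWith.of_dist_le_mul fun x y => ?_
    have := (lipschitzWith_mode i).dist_le_mul x y
    rw [Real.dist_eq] at this ⊢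
    rw [← mul_sub, abs_mul]
    simp only [NNReal.coe_mul, coe_toNNReal _ (abs_nonneg _), mul_assoc]
    gcongr
  have hprof : LipschitzWith (∑' i, |c i|.toNNReal * 2) (profile c) := by
    refine lipschitzWith_of_nnnorm_deriv_le
      (fun θ => (hasDerivAt_profile hc θ).differentiableAt) fun θ => ?_
    rw [(hasDerivAt_profile hc θ).deriv, ← NNReal.coe_le_coe, coe_nnnorm, NNReal.coe_tsum]
    refine tsum_of_norm_bounded (NNReal.summable_coe.2 hcn).hasSum fun i => ?_
    rw [norm_mul, Real.norm_eq_abs, Real.norm_eq_abs]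
    simp only [NNReal.coe_mul, coe_toNNReal _ (abs_nonneg _)]
    gcongr
    exact abs_modeDeriv_le i θ
  have hs := hasSum_hilbert (f := profile c) hLip hcn
    (fun θ => (summable_mul_of_abs_le hc fun i => abs_mode_le i θ).hasSum) θ
  have e : ∀ i, hilbert (fun θ => c i * mode i θ) θ = c i * modeHilbert i θ := fun i => by
    rw [← hilbert_mode, hilbert, hilbert]
    have : ∀ y, hilbertKernel (fun θ => c i * mode i θ) θ y = c i * hilbertKernel (mode i) θ y :=
      fun y => by unfold hilbertKernel; ring
    simp only [this]
    rw [intervalIntegral.integral_const_mul]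
    ring
  simp only [e] at hs
  rw [hs.tsum_eq]
  exact hasHilbert_hilbert hprof θ

end Series

/-! ### The linearized operator in the basis `mode` -/

/-- The coupling of `mode i` and `mode (i + 2)`. -/
def coupling (σ : ℝ) (i : ℕ) : ℝ := ((i : ℝ) + 1) * (i + 5) * (i + 3 - 2 * σ) / (4 * (i + 3) ^ 2)

/-- The diagonal coefficients of the linearized operator. -/
def modeDiag (σ : ℝ) (i : ℕ) : ℝ :=
  ((i : ℝ) - 1) * (i + 3) * (i + 1 - 2 * σ) / (4 * (i + 1) ^ 2) - coupling σ i

theorem modeDeriv_eq (i : ℕ) (θ : ℝ) :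
    modeDeriv i θ = cos (((i : ℝ) + 3) * θ) - cos (((i : ℝ) + 1) * θ) := by
  rw [modeDeriv, show ((i : ℝ) + 3) * θ = (i + 2 : ℕ) * θ + θ by push_cast; ring,
    show ((i : ℝ) + 1) * θ = (i + 2 : ℕ) * θ - θ by push_cast; ring, cos_add, cos_sub]
  ring

theorem two_mul_cos_sub_mul_sin (n θ : ℝ) :
    2 * cos (2 * θ) * sin (n * θ) - n * sin (2 * θ) * cos (n * θ) =
      (1 - n / 2) * sin ((n + 2) * θ) + (1 + n / 2) * sin ((n - 2) * θ) := by
  rw [add_mul n, sub_mul n, sin_add, sin_sub]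
  ring

theorem bracket_mode_eq (σ : ℝ) (i : ℕ) (θ : ℝ) :
    bracket (fun x => 1 / 2 * mode i x + σ * modeVelocity i x) (fun x => sin (2 * x)) θ =
      (1 / 2 - σ / (i + 3)) / (i + 3) *
        ((1 - ((i : ℝ) + 3) / 2) * sin (((i : ℝ) + 5) * θ) +
          (1 + ((i : ℝ) + 3) / 2) * sin (((i : ℝ) + 1) * θ)) -
      (1 / 2 - σ / (i + 1)) / (i + 1) *
        ((1 - ((i : ℝ) + 1) / 2) * sin (((i : ℝ) + 3) * θ) +
          (1 + ((i : ℝ) + 1) / 2) * sin (((i : ℝ) - 1) * θ)) := by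
  have hd : HasDerivAt (fun x => 1 / 2 * mode i x + σ * modeVelocity i x)
      (1 / 2 * modeDeriv i θ + σ * modeHilbert i θ) θ :=
    ((hasDerivAt_mode i θ).const_mul (1 / 2)).add ((hasDerivAt_modeVelocity i θ).const_mul σ)
  have h1 := two_mul_cos_sub_mul_sin ((i : ℝ) + 1) θ
  have h3 := two_mul_cos_sub_mul_sin ((i : ℝ) + 3) θ
  rw [show (i : ℝ) + 1 + 2 = i + 3 by ring, show (i : ℝ) + 1 - 2 = i - 1 by ring] at h1
  rw [show (i : ℝ) + 3 + 2 = i + 5 by ring, show (i : ℝ) + 3 - 2 = i + 1 by ring] at h3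
  rw [← h1, ← h3, bracket, (hasDerivAt_sin_two_mul θ).deriv, hd.deriv, modeDeriv_eq, mode,
    modeVelocity, modeHilbert]
  push_cast
  generalize sin (((i : ℝ) + 1) * θ) = s1
  generalize sin (((i : ℝ) + 3) * θ) = s3
  generalize cos (((i : ℝ) + 1) * θ) = c1
  generalize cos (((i : ℝ) + 3) * θ) = c3
  generalize cos (2 * θ) = c
  generalize sin (2 * θ) = s
  field_simp
  ring

/-- The bracket has frequencies i - 1, i + 1, i + 3, i + 5, and its derivative vanishes at θ = 0.
This one linear relation among four coefficients makes it a combination of three modes; the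
couplings up and down are opposite to each other. -/
theorem bracket_mode (σ : ℝ) (i : ℕ) (θ : ℝ) :
    bracket (fun x => 1 / 2 * mode i x + σ * modeVelocity i x) (fun x => sin (2 * x)) θ =
      -coupling σ i * mode (i + 2) θ + modeDiag σ i * mode i θ +
        if 2 ≤ i then coupling σ (i - 2) * mode (i - 2) θ else 0 := by
  rw [bracket_mode_eq]
  rcases Nat.lt_or_ge i 2 with hi | hi
  · rw [if_neg (by omega)]
    interval_cases i
    · unfold mode modeDiag coupling
      -- The folded frequency -1 is already accounted for by the general formula for `modeDiag` at
      -- `i = 0`.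
      have e : sin ((((0 : ℕ) : ℝ) - 1) * θ) = -sin ((((0 : ℕ) : ℝ) + 1) * θ) := by
        rw [← sin_neg]; norm_num
      rw [e]
      push_cast
      simp only [zero_add, one_mul]
      generalize sin θ = s1
      generalize sin (3 * θ) = s3
      norm_num
      generalize sin (5 * θ) = s5
      ring
    · unfold mode modeDiag coupling
      have e : sin ((((1 : ℕ) : ℝ) - 1) * θ) = 0 := by norm_num
      rw [e]
      norm_num
      generalize sin (2 * θ) = s1
      generalize sin (4 * θ) = s3
      generalize sin (6 * θ) = s5
      ring
  · obtain ⟨j, rfl⟩ := Nat.exists_eq_add_of_le' hi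
    rw [if_pos hi, Nat.add_sub_cancel]
    unfold mode modeDiag coupling
    push_cast
    rw [show (j : ℝ) + 2 + 5 = j + 7 by ring, show (j : ℝ) + 2 + 3 = j + 5 by ring,
      show (j : ℝ) + 2 + 1 = j + 3 by ring, show (j : ℝ) + 2 - 1 = j + 1 by ring,
      show (j : ℝ) + 2 + 2 + 3 = j + 7 by ring, show (j : ℝ) + 2 + 2 + 1 = j + 5 by ring]
    generalize sin (((j : ℝ) + 1) * θ) = s1
    generalize sin (((j : ℝ) + 3) * θ) = s3
    generalize sin (((j : ℝ) + 5) * θ) = s5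
    generalize sin (((j : ℝ) + 7) * θ) = s7
    field_simp
    ring

theorem abs_coupling_le {σ : ℝ} (hσ : |σ| ≤ 1) (i : ℕ) : |coupling σ i| ≤ (i : ℝ) + 2 := by
  have h := abs_le.1 hσ
  have hi : (0 : ℝ) ≤ i := Nat.cast_nonneg i
  rw [coupling, abs_div, abs_mul, abs_of_nonneg (by positivity : (0 : ℝ) ≤ ((i : ℝ) + 1) * (i + 5)),
    abs_of_nonneg (by positivity : (0 : ℝ) ≤ 4 * ((i : ℝ) + 3) ^ 2), div_le_iff₀ (by positivity)]
  have h1 : |(i : ℝ) + 3 - 2 * σ| ≤ 4 * (i + 2) := by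
    rw [abs_le]; constructor <;> linarith
  calc ((i : ℝ) + 1) * (i + 5) * |(i : ℝ) + 3 - 2 * σ| ≤ ((i : ℝ) + 3) ^ 2 * (4 * (i + 2)) := by
        gcongr
        nlinarith
    _ = _ := by ring

theorem almostSkew_mode {σ : ℝ} (hσ : |σ| ≤ 1) :
    AlmostSkew (fun i => -coupling σ i) (modeDiag σ) (coupling σ) 10 where
  lower i := by
    rw [abs_neg]
    linarith [abs_coupling_le hσ i, (Nat.cast_nonneg i : (0 : ℝ) ≤ i)]
  upper i := by
    linarith [abs_coupling_le hσ i, (Nat.cast_nonneg i : (0 : ℝ) ≤ i)]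
  diag i := by
    have hi : (0 : ℝ) ≤ i := Nat.cast_nonneg i
    -- The diagonal is a difference of two linearly growing terms, and the growth cancels.
    have e : modeDiag σ i = -(1 / 2) - 1 / (i + 1) + 1 / (i + 3) +
        2 * (σ * (1 / ((i : ℝ) + 1) ^ 2) - σ * (1 / ((i : ℝ) + 3) ^ 2)) := by
      unfold modeDiag coupling
      field_simp
      ring
    have hb : ∀ a : ℝ, 1 ≤ a → |1 / a| ≤ 1 := fun a ha => by
      rw [abs_of_pos (by positivity), div_le_one (by linarith)]
      exact ha
    have hs : ∀ a : ℝ, |1 / a| ≤ 1 → |σ * (1 / a)| ≤ 1 := fun a ha => by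
      rw [abs_mul]
      exact mul_le_one₀ hσ (abs_nonneg _) ha
    have h1 := abs_le.1 (hb ((i : ℝ) + 1) (by linarith))
    have h2 := abs_le.1 (hb ((i : ℝ) + 3) (by linarith))
    have h3 := abs_le.1 (hs _ (hb (((i : ℝ) + 1) ^ 2) (one_le_pow₀ (by linarith))))
    have h4 := abs_le.1 (hs _ (hb (((i : ℝ) + 3) ^ 2) (one_le_pow₀ (by linarith))))
    rw [e, abs_le]
    constructor <;> linarith
  skew i := by simp

/-- The linearized operator acts on the coefficients through `neighbourSum`. -/
theorem bracket_profile {c : ℕ → ℝ} (σ : ℝ) (hσ : |σ| ≤ 1)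
    (hc : Summable fun i : ℕ => |c i| * ((i : ℝ) + 2)) (θ : ℝ) :
    bracket (fun x => 1 / 2 * profile c x + σ * velocity c x) (fun x => sin (2 * x)) θ =
      ∑' i, neighbourSum (fun i => -coupling σ i) (modeDiag σ) (coupling σ) c i * mode i θ := by
  have hA := almostSkew_mode hσ
  have hc0 : Summable fun i => |c i| := by
    refine Summable.of_nonneg_of_le (fun i => abs_nonneg _) (fun i => ?_) hc
    exact le_mul_of_one_le_right (abs_nonneg _) (by linarith [(Nat.cast_nonneg i : (0 : ℝ) ≤ i)])
  have hd : HasDerivAt (fun x => 1 / 2 * profile c x + σ * velocity c x)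
      (1 / 2 * (∑' i, c i * modeDeriv i θ) + σ * ∑' i, c i * modeHilbert i θ) θ :=
    ((hasDerivAt_profile hc0 θ).const_mul (1 / 2)).add ((hasDerivAt_velocity hc0 θ).const_mul σ)
  have hs1 := (summable_mul_of_abs_le hc0 fun i => abs_mode_le i θ).hasSum
  have hs2 := (summable_mul_of_abs_le hc0 fun i => abs_modeDeriv_le i θ).hasSum
  have hs3 := (summable_mul_of_abs_le hc0 fun i => abs_modeVelocity_le i θ).hasSum
  have hs4 := (summable_mul_of_abs_le hc0 fun i => abs_modeHilbert_le i θ).hasSum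
  have hL : HasSum (fun i => c i *
      bracket (fun x => 1 / 2 * mode i x + σ * modeVelocity i x) (fun x => sin (2 * x)) θ)
      (bracket (fun x => 1 / 2 * profile c x + σ * velocity c x) (fun x => sin (2 * x)) θ) := by
    have h := (((hs1.mul_left (1 / 2)).add (hs3.mul_left σ)).mul_right (2 * cos (2 * θ))).sub
      (((hs2.mul_left (1 / 2)).add (hs4.mul_left σ)).mul_left (sin (2 * θ)))
    have e : bracket (fun x => 1 / 2 * profile c x + σ * velocity c x) (fun x => sin (2 * x)) θ =
        (1 / 2 * (∑' i, c i * mode i θ) + σ * ∑' i, c i * modeVelocity i θ) * (2 * cos (2 * θ)) -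
        sin (2 * θ) * (1 / 2 * (∑' i, c i * modeDeriv i θ) + σ * ∑' i, c i * modeHilbert i θ) := by
      rw [bracket, (hasDerivAt_sin_two_mul θ).deriv, hd.deriv]
      rfl
    rw [e]
    convert! h using 2 with i
    have hdi : HasDerivAt (fun x => 1 / 2 * mode i x + σ * modeVelocity i x)
        (1 / 2 * modeDeriv i θ + σ * modeHilbert i θ) θ :=
      ((hasDerivAt_mode i θ).const_mul (1 / 2)).add ((hasDerivAt_modeVelocity i θ).const_mul σ)
    rw [bracket, (hasDerivAt_sin_two_mul θ).deriv, hdi.deriv]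
    ring
  have hbound : ∀ {a : ℕ → ℝ}, (∀ i : ℕ, |a i| ≤ 10 * ((i : ℝ) + 2)) → ∀ p : ℕ → ℕ,
      Summable fun i => c i * (a i * mode (p i) θ) := fun {a} ha p => by
    refine Summable.of_norm_bounded (hc.mul_right (10 * 2)) fun i => ?_
    rw [norm_mul, norm_mul, Real.norm_eq_abs, Real.norm_eq_abs, Real.norm_eq_abs]
    calc |c i| * (|a i| * |mode (p i) θ|) ≤ |c i| * (10 * ((i : ℝ) + 2) * 2) := by
          gcongr
          exacts [ha i, abs_mode_le _ _]
      _ = _ := by ring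
  have hlow := hbound hA.lower fun i => i + 2
  have hdiag := hbound (a := modeDiag σ) (fun i => (hA.diag i).trans
    (by linarith [(Nat.cast_nonneg i : (0 : ℝ) ≤ i)])) id
  have hup : Summable fun i => c (i + 2) * (coupling σ i * mode i θ) := by
    have hc2 := (summable_nat_add_iff 2).2 hc
    refine Summable.of_norm_bounded (hc2.mul_right (10 * 2)) fun i => ?_
    rw [norm_mul, norm_mul, Real.norm_eq_abs, Real.norm_eq_abs, Real.norm_eq_abs]
    calc |c (i + 2)| * (|coupling σ i| * |mode i θ|) ≤
          |c (i + 2)| * (10 * (((i + 2 : ℕ) : ℝ) + 2) * 2) := by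
          gcongr
          · refine (hA.upper i).trans ?_
            push_cast
            linarith
          · exact abs_mode_le _ _
      _ = _ := by ring
  -- Passing from the images of the modes to the coefficients transposes the matrix; the two
  -- off-diagonal series are reindexed by 2.
  have shift : ∀ {F : ℕ → ℝ}, Summable F →
      HasSum (fun i => if 2 ≤ i then F (i - 2) else 0) (∑' i, F i) := fun {F} hF => by
    have h := (hasSum_nat_add_iff (f := fun i => if 2 ≤ i then F (i - 2) else 0) 2
      (g := ∑' i, F i)).1 (by simpa using hF.hasSum)
    simpa [Finset.sum_range_succ] using h
  have hup' := shift hup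
  have hlow' := shift hlow
  have h1 := (hlow.hasSum.add hdiag.hasSum).add hup'
  have h2 := (hlow'.add hdiag.hasSum).add hup.hasSum
  have e1 : ∀ i, c i *
      bracket (fun x => 1 / 2 * mode i x + σ * modeVelocity i x) (fun x => sin (2 * x)) θ =
      c i * (-coupling σ i * mode (i + 2) θ) + c i * (modeDiag σ i * mode (id i) θ) +
        if 2 ≤ i then c (i - 2 + 2) * (coupling σ (i - 2) * mode (i - 2) θ) else 0 := fun i => by
    rw [bracket_mode]
    split_ifs with hi
    · rw [Nat.sub_add_cancel hi, id]; ring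
    · rw [id]; ring
  have e2 : ∀ i, neighbourSum (fun i => -coupling σ i) (modeDiag σ) (coupling σ) c i * mode i θ =
      (if 2 ≤ i then c (i - 2) * (-coupling σ (i - 2) * mode (i - 2 + 2) θ) else 0) +
        c i * (modeDiag σ i * mode (id i) θ) + c (i + 2) * (coupling σ i * mode i θ) := fun i => by
    rw [neighbourSum]
    split_ifs with hi
    · rw [Nat.sub_add_cancel hi, id]; ring
    · rw [id]; ring
  simp only [e1] at hL
  simp only [e2]
  rw [hL.unique h1, h2.tsum_eq]

/-! ### Expansion of the initial data -/

theorem summable_inv_add_two_sq : Summable fun i : ℕ => (((i : ℝ) + 2) ^ 2)⁻¹ := by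
  have h := (summable_nat_add_iff 2).2 (Real.summable_nat_pow_inv.2 (by norm_num : 1 < 2))
  simpa using h

theorem summable_abs_of_abs_le {c : ℕ → ℝ} {M : ℝ} {k : ℕ} (hk : 2 ≤ k)
    (h : ∀ i : ℕ, |c i| ≤ M / ((i : ℝ) + 2) ^ k) : Summable fun i => |c i| := by
  have hM : 0 ≤ M := by
    have := (abs_nonneg _).trans (h 0)
    rw [le_div_iff₀ (by positivity)] at this
    linarith
  refine Summable.of_nonneg_of_le (fun i => abs_nonneg _) (fun i => (h i).trans ?_)
    (summable_inv_add_two_sq.mul_left M)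
  rw [div_eq_mul_inv]
  gcongr
  linarith [(Nat.cast_nonneg i : (0 : ℝ) ≤ i)]

theorem abs_seq_div_le (x : Seq) (m i : ℕ) :
    |x i / ((i : ℝ) + 2) ^ m| ≤ ‖x‖ / ((i : ℝ) + 2) ^ m := by
  rw [abs_div, abs_of_pos (by positivity : (0 : ℝ) < ((i : ℝ) + 2) ^ m)]
  gcongr
  exact x.abs_apply_le i

theorem summable_abs_seq_div (x : Seq) {m : ℕ} (hm : 2 ≤ m) :
    Summable fun i : ℕ => |x i / ((i : ℝ) + 2) ^ m| :=
  summable_abs_of_abs_le hm (abs_seq_div_le x m)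

theorem weightedShift_multiplier_apply (x : Seq) (m i : ℕ) :
    weightedShift 0 (multiplier m 0) x i = x i / ((i : ℝ) + 2) ^ m := by
  rw [weightedShift_apply (abs_multiplier_le (Nat.zero_le m)), multiplier, pow_zero, add_zero]
  ring

/-- The weighted derivative of a profile is represented by a Sobolev series. -/
theorem seriesDeriv_zero_ae_eq (x : Seq) {m : ℕ} (hm : 2 ≤ m) :
    seriesDeriv m 0 x =ᵐ[circleMeasure]
      fun θ => -weightedDeriv (profile fun i => x i / ((i : ℝ) + 2) ^ m) θ := by
  have hs := summable_abs_seq_div x hm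
  have hs' : Summable fun i => |weightedShift 0 (multiplier m 0) x i| := by
    simpa only [weightedShift_multiplier_apply] using hs
  have h := coeFn_sineSeries (((0 : ℕ) : ℝ) * (π / 2)) _ hs'
  filter_upwards [h, ae_restrict_of_ae ae_sin_ne_zero] with θ h1 h2
  rw [weightedDeriv_profile hs h2, neg_neg]
  refine h1.trans ?_
  simp only [weightedShift_multiplier_apply, Nat.cast_zero, zero_mul, add_zero]

theorem integral_sineSeries_mul_sin (x : Seq) (n : ℕ) (hn : 0 < n) :
    HasSum (fun i => x i * if i + 2 = n then √π else 0)
      (∫ θ, sineSeries 0 x θ * sin (n * θ) ∂circleMeasure) := by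
  obtain ⟨L, hL⟩ := exists_clm_integral_mul (by fun_prop : Continuous fun θ : ℝ => sin (n * θ))
  have h := (hasSum_sineSeries 0 x).mapL L
  rw [hL] at h
  convert h using 2 with i
  have h1 := integral_sin_mul_sin (i + 2) n 0 (by omega)
  rw [map_smul, hL, integral_shiftedSinL2_mul, integral_circleMeasure]
  simp only [add_zero] at h1 ⊢
  rw [h1, smul_eq_mul]
  split_ifs
  · have : (√π)⁻¹ * π = √π := by
      rw [inv_mul_eq_div, div_sqrt]
    rw [this]
  · simp

theorem integral_mul_cos_eq_zero_of_odd {f g : ℝ → ℝ} (hf : Function.Odd f) (n : ℕ)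
    (h : g =ᵐ[circleMeasure] f) : ∫ θ, g θ * cos (n * θ) ∂circleMeasure = 0 := by
  have h1 : ∫ θ, g θ * cos (n * θ) ∂circleMeasure = ∫ θ, f θ * cos (n * θ) ∂circleMeasure := by
    refine integral_congr_ae ?_
    filter_upwards [h] with θ hθ
    rw [hθ]
  rw [h1, integral_circleMeasure]
  refine integral_eq_zero_of_odd (fun θ => ?_) π
  rw [hf, mul_neg, cos_neg]
  ring

theorem weightedDeriv_odd {f : ℝ → ℝ} (hf : Function.Odd f) : Function.Odd (weightedDeriv f) := by
  intro θ
  have h1 : deriv f (-θ) = deriv f θ := by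
    have h := deriv_comp_neg f θ
    rw [show (fun x => f (-x)) = fun x => -f x from funext hf, deriv.fun_neg] at h
    linarith
  rw [weightedDeriv, weightedDeriv, h1, sin_neg, mul_neg, div_neg]
  ring

theorem seriesDeriv_zero (m : ℕ) (x : Seq) :
    seriesDeriv m 0 x = sineSeries 0 (weightedShift 0 (multiplier m 0) x) := by
  have h : seriesDeriv m 0 x =
      sineSeries (((0 : ℕ) : ℝ) * (π / 2)) (weightedShift 0 (multiplier m 0) x) := rfl
  rw [h, Nat.cast_zero, zero_mul]

theorem integral_seriesDeriv_mul_sin (m : ℕ) (x : Seq) (i : ℕ) :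
    ∫ θ, seriesDeriv m 0 x θ * sin ((i + 2 : ℕ) * θ) ∂circleMeasure =
      √π * (x i / ((i : ℝ) + 2) ^ m) := by
  have h := integral_sineSeries_mul_sin (weightedShift 0 (multiplier m 0) x) (i + 2) (by omega)
  rw [← seriesDeriv_zero] at h
  simp only [weightedShift_multiplier_apply] at h
  refine h.unique ?_
  convert hasSum_ite_eq i (√π * (x i / ((i : ℝ) + 2) ^ m)) using 1
  ext j
  by_cases hj : j = i
  · subst hj
    simp [mul_comm]
  · rw [if_neg (by omega), if_neg hj, mul_zero]

/-- The series starts at frequency 2, so admissible data must have no component along sin θ;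
`integral_weightedDeriv_mul_sin` provides this. -/
theorem integral_seriesDeriv_mul_sin_one (m : ℕ) (x : Seq) :
    ∫ θ, seriesDeriv m 0 x θ * sin ((1 : ℕ) * θ) ∂circleMeasure = 0 := by
  have h := integral_sineSeries_mul_sin (weightedShift 0 (multiplier m 0) x) 1 one_pos
  rw [← seriesDeriv_zero] at h
  refine h.unique ?_
  convert hasSum_zero using 1
  ext i
  rw [if_neg (by omega), mul_zero]

theorem ae_add_eq_zero (f g : L2)
    (hf : ∀ n : ℕ, ∫ θ, f θ * cos (n * θ) ∂circleMeasure = 0)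
    (hg : ∀ n : ℕ, ∫ θ, g θ * cos (n * θ) ∂circleMeasure = 0)
    (hfg : ∀ n : ℕ, ∫ θ, f θ * sin (n * θ) ∂circleMeasure +
      ∫ θ, g θ * sin (n * θ) ∂circleMeasure = 0) :
    ∀ᵐ θ ∂circleMeasure, f θ + g θ = 0 := by
  have hsplit : ∀ {ψ : ℝ → ℝ}, Continuous ψ → ∫ θ, (f θ + g θ) * ψ θ ∂circleMeasure =
      ∫ θ, f θ * ψ θ ∂circleMeasure + ∫ θ, g θ * ψ θ ∂circleMeasure := fun hψ => by
    rw [← integral_add (integrable_mul_of_continuous f hψ) (integrable_mul_of_continuous g hψ)]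
    simp only [add_mul]
  have hmem : MemLp (fun θ => f θ + g θ) 2 circleMeasure := (Lp.memLp f).add (Lp.memLp g)
  refine ae_eq_zero_of_integral_eq_zero hmem (fun n => ?_) fun n => ?_
  · rw [hsplit (by fun_prop), hf, hg, add_zero]
  · rw [hsplit (by fun_prop), hfg]

namespace IsAdmissibleData

variable {m : ℕ} {η₀ : ℝ → ℝ}

theorem integral_deriv_eq_zero (h : IsAdmissibleData m η₀) : ∫ θ in (-π)..π, deriv η₀ θ = 0 := by
  rw [h.absCont.integral_deriv_eq_sub, h.periodic.apply_pi_eq, sub_self]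

/-- Multiplication by `sin θ` removes the weight, leaving a multiple of the integral of `deriv η₀`
over a period. -/
theorem integral_weightedDeriv_mul_sin (h : IsAdmissibleData m η₀) :
    ∫ θ, weightedDeriv η₀ θ * sin θ ∂circleMeasure = 0 := by
  have h1 : ∫ θ, weightedDeriv η₀ θ * sin θ ∂circleMeasure =
      ∫ θ, 1 / (2 * √π) * deriv η₀ θ ∂circleMeasure := by
    refine integral_congr_ae ?_
    filter_upwards [ae_restrict_of_ae ae_sin_ne_zero] with θ hθ
    have hpi : √π ≠ 0 := (sqrt_pos.2 pi_pos).ne'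
    rw [weightedDeriv]
    field_simp
  rw [h1, integral_const_mul, integral_circleMeasure, h.integral_deriv_eq_zero, mul_zero]

/-- The sine coefficients of the weighted derivative, multiplied by `(i + 2)^m`, are square
summable. -/
theorem exists_seq (h : IsAdmissibleData m η₀) : ∃ (W : Sobolev m) (x : Seq),
    Represents W (weightedDeriv η₀) ∧ ∀ i : ℕ, ∫ θ, W.1 0 θ * sin ((i + 2 : ℕ) * θ) ∂circleMeasure =
      -√π * (x i / ((i : ℝ) + 2) ^ m) := by
  obtain ⟨W, hW⟩ := h.weighted
  -- With this phase the `m`-th derivative of the test function is (i+2)^m sin((i+2)θ), so Bessel's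
  -- inequality for the `m`-th weak derivative yields the weighted summability.
  set c : ℝ := -(m * (π / 2)) with hc
  set y : ℕ → ℝ := fun i => -((-1) ^ m * inner ℝ (shiftedSinL2 c i) (W.1 (Fin.last m))) with hy
  have hys : Summable fun i => y i ^ 2 := by
    have := (orthonormal_shiftedSinL2 c).inner_products_summable (x := W.1 (Fin.last m))
    refine this.congr fun i => ?_
    simp only [hy, neg_sq, mul_pow, ← pow_mul, mul_comm m 2]
    simp [pow_mul]
  refine ⟨W, ⟨y, memℓp_two_iff.2 hys⟩, hW, fun i => ?_⟩
  have hφ : ContDiff ℝ ∞ fun θ : ℝ => sin ((i + 2 : ℕ) * θ + c) := by fun_prop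
  have hw := W.2 (Fin.last m) _ hφ (periodic_sin_nat_mul_add (i + 2) c)
  rw [Fin.val_last, iteratedDeriv_sin_mul_add] at hw
  have hpi : √π ≠ 0 := (sqrt_pos.2 pi_pos).ne'
  have hi : ((i : ℝ) + 2) ^ m ≠ 0 := by positivity
  have e : ∀ θ, W.1 0 θ * (((i + 2 : ℕ) : ℝ) ^ m * sin ((i + 2 : ℕ) * θ + (c + m * (π / 2)))) =
      ((i + 2 : ℕ) : ℝ) ^ m * (W.1 0 θ * sin ((i + 2 : ℕ) * θ)) := fun θ => by
    rw [hc, neg_add_cancel, add_zero]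
    ring
  simp only [e] at hw
  rw [integral_const_mul] at hw
  change _ = -√π * (y i / ((i : ℝ) + 2) ^ m)
  simp only [hy]
  rw [inner_shiftedSinL2]
  have hcast : ((i + 2 : ℕ) : ℝ) = (i : ℝ) + 2 := by push_cast; ring
  rw [mul_left_comm, ← hw]
  rw [hcast]
  field_simp

/-- All Fourier coefficients agree: the cosine ones vanish by oddness, that of sin θ vanishes on
both sides, and the others match by the choice of `x`. -/
theorem exists_weightedDeriv_ae_eq (h : IsAdmissibleData m η₀) (hm : 2 ≤ m) :
    ∃ x : Seq, ∀ᵐ θ ∂circleMeasure, weightedDeriv η₀ θ =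
      weightedDeriv (profile fun i => x i / ((i : ℝ) + 2) ^ m) θ := by
  obtain ⟨W, x, hW, hx⟩ := h.exists_seq
  refine ⟨x, ?_⟩
  have hser := seriesDeriv_zero_ae_eq x hm
  have hodd : Function.Odd fun θ => -weightedDeriv (profile fun i => x i / ((i : ℝ) + 2) ^ m) θ :=
    fun θ => congrArg Neg.neg (weightedDeriv_odd (profile_odd _) θ)
  have hzero := ae_add_eq_zero (W.1 0) (seriesDeriv m 0 x)
    (fun n => integral_mul_cos_eq_zero_of_odd (weightedDeriv_odd h.odd) n hW)
    (fun n => integral_mul_cos_eq_zero_of_odd hodd n hser) fun n => by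
      rcases n with _ | _ | i
      · simp
      · rw [zero_add, integral_seriesDeriv_mul_sin_one, add_zero,
          ← h.integral_weightedDeriv_mul_sin]
        refine integral_congr_ae ?_
        filter_upwards [hW] with θ hθ
        rw [hθ, Nat.cast_one, one_mul]
      · rw [hx, integral_seriesDeriv_mul_sin]
        ring
  filter_upwards [hzero, hW, hser] with θ h1 h2 h3
  rw [h2, h3] at h1
  linarith

/-- Absolute continuity turns almost everywhere equality of derivatives into equality up to a
constant, which oddness fixes at θ = 0. -/
theorem exists_eq_profile (h : IsAdmissibleData m η₀) (hm : 2 ≤ m) :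
    ∃ x : Seq, η₀ = profile fun i => x i / ((i : ℝ) + 2) ^ m := by
  obtain ⟨x, hx⟩ := h.exists_weightedDeriv_ae_eq hm
  refine ⟨x, ?_⟩
  set c : ℕ → ℝ := fun i => x i / ((i : ℝ) + 2) ^ m with hc
  have hs : Summable fun i => |c i| := summable_abs_seq_div x hm
  have hderiv : ∀ᵐ θ ∂circleMeasure, deriv η₀ θ = deriv (profile c) θ := by
    filter_upwards [hx, ae_restrict_of_ae ae_sin_ne_zero] with θ h5 h4
    have hpi : √π ≠ 0 := (sqrt_pos.2 pi_pos).ne'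
    rw [weightedDeriv, weightedDeriv] at h5
    refine mul_left_cancel₀ ?_ h5
    positivity
  have hle : -π ≤ π := by linarith [pi_pos]
  have hderiv' : ∀ᵐ θ, θ ∈ Ioc (-π) π → deriv η₀ θ = deriv (profile c) θ :=
    (ae_restrict_iff' measurableSet_Ioc).1 hderiv
  have hη0 : η₀ 0 = 0 := by
    have := h.odd 0
    rw [neg_zero] at this
    linarith
  have hp0 : profile c 0 = 0 := by
    have := profile_odd c 0
    rw [neg_zero] at this
    linarith
  have hmain : ∀ θ ∈ Icc (-π) π, η₀ θ = profile c θ := fun θ hθ => by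
    have h0 : (0 : ℝ) ∈ Icc (-π) π := ⟨by linarith [pi_pos], pi_pos.le⟩
    have hsub : uIcc 0 θ ⊆ uIcc (-π) π := by
      rw [uIcc_of_le hle]
      exact uIcc_subset_Icc h0 hθ
    have hac := h.absCont.mono hsub
    have h1 := hac.integral_deriv_eq_sub
    have hsub' : uIoc 0 θ ⊆ Ioc (-π) π := by
      rw [← uIoc_of_le hle]
      intro y hy
      rw [uIoc_of_le hle]
      rcases mem_uIoc.1 hy with hy | hy
      · exact ⟨by linarith [hy.1, pi_pos], hy.2.trans hθ.2⟩
      · exact ⟨hθ.1.trans_lt hy.1, by linarith [hy.2, pi_pos]⟩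
    have hcongr : ∀ᵐ y, y ∈ uIoc 0 θ → deriv η₀ y = deriv (profile c) y := by
      filter_upwards [hderiv'] with y hy hy'
      exact hy (hsub' hy')
    have hii : IntervalIntegrable (deriv (profile c)) volume 0 θ := by
      refine hac.intervalIntegrable_deriv.congr_ae ?_
      exact (ae_restrict_iff' measurableSet_uIoc).2 hcongr
    rw [intervalIntegral.integral_congr_ae hcongr, intervalIntegral.integral_eq_sub_of_hasDerivAt
      (fun y _ => (hasDerivAt_profile hs y).differentiableAt.hasDerivAt) hii, hη0, hp0] at h1
    linarith
  ext θ
  obtain ⟨y, hy, hfy⟩ := (h.periodic.sub (profile_periodic c)).exists_mem_Ico (by positivity) θ (-π)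
  rw [show -π + 2 * π = π by ring] at hy
  have h3 := hmain y (Ico_subset_Icc_self hy)
  simp only [Pi.sub_apply] at hfy
  linarith

end IsAdmissibleData

/-! ### Existence -/

theorem neighbourSum_div (l d u x : ℕ → ℝ) (m i : ℕ) :
    neighbourSum l d u (fun j => x j / ((j : ℝ) + 2) ^ m) i =
      neighbourSum (fun i => l i * ratio i ^ m) d (fun i => u i * (ratio i ^ m)⁻¹) x i /
        ((i : ℝ) + 2) ^ m := by
  have h2 : (i : ℝ) + 2 ≠ 0 := by positivity
  have h4 : (i : ℝ) + 4 ≠ 0 := by positivity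
  unfold neighbourSum
  rw [add_div, add_div]
  congr 1
  · congr 1
    · split_ifs with hi
      · obtain ⟨j, rfl⟩ := Nat.exists_eq_add_of_le' hi
        have h2' : (j : ℝ) + 2 ≠ 0 := by positivity
        have h4' : (j : ℝ) + 4 ≠ 0 := by positivity
        simp only [Nat.add_sub_cancel, ratio]
        push_cast
        rw [show (j : ℝ) + 2 + 2 = j + 4 by ring, div_pow]
        field_simp
      · rw [zero_div]
    · ring
  · simp only [ratio]
    push_cast
    rw [show (i : ℝ) + 2 + 2 = i + 4 by ring, div_pow]
    field_simp

theorem continuous_neighbourSum {x : ℝ → ℕ → ℝ} (h : ∀ i, Continuous fun t => x t i)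
    (l d u : ℕ → ℝ) (i : ℕ) : Continuous fun t => neighbourSum l d u (x t) i := by
  unfold neighbourSum
  refine (Continuous.add ?_ ((h i).const_mul _)).add ((h (i + 2)).const_mul _)
  split_ifs
  · exact (h (i - 2)).const_mul _
  · exact continuous_const

/-- Applying the operator costs one power of `i + 2`. The factor `2 ^ k` compares the weights at `i
- 2` and `i`, whose ratio is at most 2. -/
theorem AlmostSkew.abs_neighbourSum_le {l d u : ℕ → ℝ} {C : ℝ} (h : AlmostSkew l d u C)
    {x : ℕ → ℝ} {M : ℝ} {k : ℕ} (hx : ∀ i : ℕ, |x i| ≤ M / ((i : ℝ) + 2) ^ (k + 1)) (i : ℕ) :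
    |neighbourSum l d u x i| ≤ (2 ^ k + 2) * (C * M) / ((i : ℝ) + 2) ^ k := by
  have hC := h.nonneg
  have hM : 0 ≤ M := by
    have := (abs_nonneg _).trans (hx 0)
    rw [le_div_iff₀ (by positivity)] at this
    linarith
  have hi : (0 : ℝ) ≤ i := Nat.cast_nonneg i
  have h1 : |if 2 ≤ i then l (i - 2) * x (i - 2) else 0| ≤
      2 ^ k * (C * M / ((i : ℝ) + 2) ^ k) := by
    split_ifs with h2
    · obtain ⟨j, rfl⟩ := Nat.exists_eq_add_of_le' h2
      rw [Nat.add_sub_cancel, abs_mul]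
      have hj : (0 : ℝ) ≤ j := Nat.cast_nonneg j
      have hk : (((j + 2 : ℕ) : ℝ) + 2) ^ k ≤ 2 ^ k * ((j : ℝ) + 2) ^ k := by
        rw [← mul_pow]
        push_cast
        gcongr
        linarith
      calc |l j| * |x j| ≤ C * (j + 2) * (M / ((j : ℝ) + 2) ^ (k + 1)) := by
            gcongr
            exacts [h.lower j, hx j]
        _ = C * M / ((j : ℝ) + 2) ^ k := by
            rw [pow_succ]
            field_simp
        _ ≤ 2 ^ k * (C * M / (((j + 2 : ℕ) : ℝ) + 2) ^ k) := by
            rw [← mul_div_assoc, div_le_div_iff₀ (by positivity) (by positivity)]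
            calc C * M * (((j + 2 : ℕ) : ℝ) + 2) ^ k ≤ C * M * (2 ^ k * ((j : ℝ) + 2) ^ k) := by
                  gcongr
              _ = _ := by ring
    · rw [abs_zero]
      positivity
  have h2 : |d i * x i| ≤ C * M / ((i : ℝ) + 2) ^ k := by
    rw [abs_mul, mul_div_assoc]
    refine mul_le_mul (h.diag i) ((hx i).trans ?_) (abs_nonneg _) hC
    gcongr
    exacts [by linarith, by omega]
  have h3 : |u i * x (i + 2)| ≤ C * M / ((i : ℝ) + 2) ^ k := by
    have := hx (i + 2)
    push_cast at this
    rw [abs_mul]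
    calc |u i| * |x (i + 2)| ≤ C * (i + 2) * (M / ((i : ℝ) + 2) ^ (k + 1)) := by
          gcongr
          · exact h.upper i
          · refine this.trans ?_
            gcongr
            linarith
      _ = C * M / ((i : ℝ) + 2) ^ k := by
          rw [pow_succ]
          field_simp
  calc |neighbourSum l d u x i| ≤ _ := abs_add_three _ _ _
    _ ≤ 2 ^ k * (C * M / ((i : ℝ) + 2) ^ k) + C * M / ((i : ℝ) + 2) ^ k +
        C * M / ((i : ℝ) + 2) ^ k := by gcongr
    _ = _ := by ring

section Evolution

variable {c c' : ℕ → ℝ → ℝ}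

theorem summable_mul_mode {a : ℕ → ℝ} (ha : Summable fun i => |a i|) (θ : ℝ) :
    Summable fun i => a i * mode i θ :=
  summable_mul_of_abs_le ha fun i => abs_mode_le i θ

theorem hasDerivAt_tsum_mul_mode (hc : ∀ i t, HasDerivAt (c i) (c' i t) t)
    (hb : ∀ R, ∃ v : ℕ → ℝ, Summable v ∧ ∀ t ∈ Ioo (-R) R, ∀ i, |c i t| ≤ v i ∧ |c' i t| ≤ v i)
    (t θ : ℝ) :
    HasDerivAt (fun s => ∑' i, c i s * mode i θ) (∑' i, c' i t * mode i θ) t := by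
  obtain ⟨v, hv, hvb⟩ := hb (|t| + 1)
  have ht : t ∈ Ioo (-(|t| + 1)) (|t| + 1) :=
    ⟨by linarith [neg_abs_le t], by linarith [le_abs_self t]⟩
  refine hasDerivAt_tsum_of_isPreconnected (hv.mul_right 2) isOpen_Ioo isPreconnected_Ioo
    (fun i s _ => (hc i s).mul_const _) (fun i s hs => ?_) ht ?_ ht
  · rw [norm_mul, Real.norm_eq_abs, Real.norm_eq_abs]
    exact mul_le_mul (hvb s hs i).2 (abs_mode_le i θ) (abs_nonneg _)
      ((abs_nonneg _).trans (hvb s hs i).2)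
  · exact summable_mul_mode (Summable.of_nonneg_of_le (fun i => abs_nonneg _)
      (fun i => (hvb t ht i).1) hv) θ

/-- The modes and their derivatives are bounded by 2 uniformly in `i`, so a summable bound for `c`
and `c'`, locally uniform in time, dominates the series of Fréchet derivatives. -/
theorem contDiff_tsum_mul_mode (hc : ∀ i t, HasDerivAt (c i) (c' i t) t)
    (hc' : ∀ i, Continuous (c' i))
    (hb : ∀ R, ∃ v : ℕ → ℝ, Summable v ∧ ∀ t ∈ Ioo (-R) R, ∀ i, |c i t| ≤ v i ∧ |c' i t| ≤ v i) :
    ContDiff ℝ 1 fun p : ℝ × ℝ => ∑' i, c i p.1 * mode i p.2 := by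
  set F : ℕ → ℝ × ℝ → (ℝ × ℝ →L[ℝ] ℝ) := fun i p =>
    c i p.1 • modeDeriv i p.2 • ContinuousLinearMap.snd ℝ ℝ ℝ +
      mode i p.2 • c' i p.1 • ContinuousLinearMap.fst ℝ ℝ ℝ with hF
  have hF1 : ∀ i p, HasFDerivAt (fun p : ℝ × ℝ => c i p.1 * mode i p.2) (F i p) p := fun i p => by
    have h1 : HasFDerivAt (fun p : ℝ × ℝ => c i p.1) (c' i p.1 • ContinuousLinearMap.fst ℝ ℝ ℝ) p :=
      (hc i p.1).comp_hasFDerivAt p hasFDerivAt_fst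
    have h2 : HasFDerivAt (fun p : ℝ × ℝ => mode i p.2)
        (modeDeriv i p.2 • ContinuousLinearMap.snd ℝ ℝ ℝ) p :=
      (hasDerivAt_mode i p.2).comp_hasFDerivAt p hasFDerivAt_snd
    exact h1.mul h2
  have hcc : ∀ i, Continuous (c i) := fun i =>
    continuous_iff_continuousAt.2 fun t => (hc i t).continuousAt
  have hmc : ∀ i, Continuous (mode i) := fun i =>
    continuous_iff_continuousAt.2 fun t => (hasDerivAt_mode i t).continuousAt
  have hmc' : ∀ i, Continuous (modeDeriv i) := fun i => by
    unfold modeDeriv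
    fun_prop
  have hFc : ∀ i, Continuous (F i) := fun i => by
    have h1 := (hcc i).comp (continuous_fst (X := ℝ) (Y := ℝ))
    have h2 := (hc' i).comp (continuous_fst (X := ℝ) (Y := ℝ))
    have h3 := (hmc i).comp (continuous_snd (X := ℝ) (Y := ℝ))
    have h4 := (hmc' i).comp (continuous_snd (X := ℝ) (Y := ℝ))
    exact (h1.smul (h4.smul continuous_const)).add (h3.smul (h2.smul continuous_const))
  have key : ∀ p : ℝ × ℝ, ∃ v : ℕ → ℝ, Summable v ∧ ∃ s : Set (ℝ × ℝ), IsOpen s ∧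
      IsPreconnected s ∧ p ∈ s ∧ (∀ i, ∀ q ∈ s, ‖F i q‖ ≤ v i) ∧
      Summable fun i => c i p.1 * mode i p.2 := fun p => by
    obtain ⟨v, hv, hvb⟩ := hb (|p.1| + 1)
    have hp : p.1 ∈ Ioo (-(|p.1| + 1)) (|p.1| + 1) :=
      ⟨by linarith [neg_abs_le p.1], by linarith [le_abs_self p.1]⟩
    refine ⟨fun i => v i * 4, hv.mul_right 4, Ioo (-(|p.1| + 1)) (|p.1| + 1) ×ˢ univ,
      isOpen_Ioo.prod isOpen_univ, isPreconnected_Ioo.prod isPreconnected_univ, ⟨hp, mem_univ _⟩,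
      fun i q hq => ?_, summable_mul_mode (Summable.of_nonneg_of_le (fun i => abs_nonneg _)
      (fun i => (hvb _ hp i).1) hv) _⟩
    obtain ⟨h1, h2⟩ := hvb q.1 hq.1 i
    have hv0 : 0 ≤ v i := (abs_nonneg _).trans h1
    calc ‖F i q‖ ≤ ‖c i q.1 • modeDeriv i q.2 • ContinuousLinearMap.snd ℝ ℝ ℝ‖ +
          ‖mode i q.2 • c' i q.1 • ContinuousLinearMap.fst ℝ ℝ ℝ‖ := norm_add_le _ _
      _ = |c i q.1| * (|modeDeriv i q.2| * ‖ContinuousLinearMap.snd ℝ ℝ ℝ‖) +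
          |mode i q.2| * (|c' i q.1| * ‖ContinuousLinearMap.fst ℝ ℝ ℝ‖) := by
        simp only [norm_smul, Real.norm_eq_abs]
      _ ≤ v i * (2 * 1) + 2 * (v i * 1) := by
        gcongr
        exacts [abs_modeDeriv_le _ _, ContinuousLinearMap.norm_snd_le ℝ ℝ ℝ, abs_mode_le _ _,
          ContinuousLinearMap.norm_fst_le ℝ ℝ ℝ]
      _ = v i * 4 := by ring
  have hder : ∀ p, HasFDerivAt (fun p : ℝ × ℝ => ∑' i, c i p.1 * mode i p.2) (∑' i, F i p) p :=
    fun p => by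
      obtain ⟨v, hv, s, hs, hs', hp, hFs, h0⟩ := key p
      exact hasFDerivAt_tsum_of_isPreconnected hv hs hs' (fun i q _ => hF1 i q) hFs hp h0 hp
  refine contDiff_one_iff_fderiv.2 ⟨fun p => (hder p).differentiableAt, ?_⟩
  rw [show fderiv ℝ (fun p : ℝ × ℝ => ∑' i, c i p.1 * mode i p.2) = fun p => ∑' i, F i p from
    funext fun p => (hder p).fderiv]
  refine continuous_iff_continuousAt.2 fun p => ?_
  obtain ⟨v, hv, s, hs, -, hp, hFs, -⟩ := key p
  exact (continuousOn_tsum (fun i => (hFc i).continuousOn) hv hFs).continuousAt (hs.mem_nhds hp)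

end Evolution

theorem iteratedDeriv_le_two {f f' f'' : ℝ → ℝ} (hf : ∀ t, HasDerivAt f (f' t) t)
    (hf' : ∀ t, HasDerivAt f' (f'' t) t) :
    iteratedDeriv 0 f = f ∧ iteratedDeriv 1 f = f' ∧ iteratedDeriv 2 f = f'' := by
  have h1 : deriv f = f' := funext fun t => (hf t).deriv
  have h2 : deriv f' = f'' := funext fun t => (hf' t).deriv
  refine ⟨iteratedDeriv_zero, by rw [iteratedDeriv_one, h1], ?_⟩
  rw [iteratedDeriv_succ, iteratedDeriv_one, h1, h2]

theorem contDiff_two_of_hasDerivAt {f f' f'' : ℝ → ℝ} (hf : ∀ t, HasDerivAt f (f' t) t)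
    (hf' : ∀ t, HasDerivAt f' (f'' t) t) (hf'' : Continuous f'') : ContDiff ℝ 2 f := by
  rw [show (2 : WithTop ℕ∞) = 1 + 1 by norm_num, contDiff_succ_iff_deriv]
  refine ⟨fun t => (hf t).differentiableAt, by simp, ?_⟩
  rw [show deriv f = f' from funext fun t => (hf t).deriv, contDiff_one_iff_deriv]
  refine ⟨fun t => (hf' t).differentiableAt, ?_⟩
  rwa [show deriv f' = f'' from funext fun t => (hf' t).deriv]

/-- The coefficients of the solution with `i`-th initial coefficient `x i / (i + 2)^m`. -/
theorem AlmostSkew.exists_weighted_flow {l d u : ℕ → ℝ} {C : ℝ} (h : AlmostSkew l d u C) (m : ℕ)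
    (x : Seq) : ∃ b : ℝ → Seq, Continuous b ∧ b 0 = x ∧ (ContDiff ℝ 2 fun t => damp (b t)) ∧
      ∀ i t, HasDerivAt (fun s => b s i / ((i : ℝ) + 2) ^ m)
        (neighbourSum l d u (fun j => b t j / ((j : ℝ) + 2) ^ m) i) t := by
  obtain ⟨b, hb, hb0, hbd⟩ := (h.mul_ratio_pow m).exists_flow x
  refine ⟨b, hb, hb0, (h.mul_ratio_pow m).contDiff_damp hb hbd, fun i t => ?_⟩
  rw [neighbourSum_div]
  exact (hbd i t).div_const _

theorem exists_abs_div_le {b : ℝ → Seq} (hb : Continuous b) (m : ℕ) (r s : ℝ) :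
    ∃ M, ∀ t ∈ Icc r s, ∀ i : ℕ, |b t i / ((i : ℝ) + 2) ^ m| ≤ M / ((i : ℝ) + 2) ^ m := by
  obtain ⟨M, hM⟩ := (isCompact_Icc (a := r) (b := s)).exists_bound_of_continuousOn hb.continuousOn
  refine ⟨M, fun t ht i => (abs_seq_div_le (b t) m i).trans ?_⟩
  gcongr
  exact hM t ht

theorem profile_neg (c : ℕ → ℝ) : (profile fun i => -c i) = fun θ => -profile c θ := by
  ext θ
  unfold profile
  rw [← tsum_neg]
  exact tsum_congr fun i => neg_mul _ _

theorem hasWeightedRegularity_profile {m : ℕ} (hm : 2 ≤ m) {b : ℝ → Seq} (hb : Continuous b)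
    (hb2 : ContDiff ℝ 2 fun t => damp (b t)) (T : ℝ) :
    HasWeightedRegularity (Nat.sub_le m 2) T
      fun t => profile fun i => b t i / ((i : ℝ) + 2) ^ m := by
  -- The sign compensates the minus in the weighted derivative of a mode.
  refine ⟨fun t => sobolevSeries m (-b t), fun t _ => ?_, ?_, ?_⟩
  · refine (seriesDeriv_zero_ae_eq (-b t) hm).trans (Eventually.of_forall fun θ => ?_)
    have e : (profile fun i => (-b t) i / ((i : ℝ) + 2) ^ m) =
        fun θ => -profile (fun i => b t i / ((i : ℝ) + 2) ^ m) θ := by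
      rw [← profile_neg]
      congr 1
      ext i
      exact neg_div _ _
    simp only [e, weightedDeriv, deriv.fun_neg]
    ring
  · exact ((sobolevSeries m).continuous.comp hb.neg).continuousOn
  · have e : (fun t => Sobolev.incl (Nat.sub_le m 2) (sobolevSeries m (-b t))) =
        fun t => -sobolevSeries (m - 2) (damp (b t)) := by
      ext1 t
      rw [incl_sobolevSeries hm, map_neg, map_neg]
    rw [e]
    exact ((sobolevSeries (m - 2)).contDiff.comp hb2).neg.contDiffOn

theorem hasCoeffDecay_profile {l d u : ℕ → ℝ} {C : ℝ} (h : AlmostSkew l d u C) {m : ℕ} (hm : 2 ≤ m)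
    {b : ℝ → Seq} (hb : Continuous b)
    (hd : ∀ i t, HasDerivAt (fun s => b s i / ((i : ℝ) + 2) ^ m)
        (neighbourSum l d u (fun j => b t j / ((j : ℝ) + 2) ^ m) i) t) {T : ℝ} (hT : 0 < T) :
    HasCoeffDecay m T fun t => profile fun i => b t i / ((i : ℝ) + 2) ^ m := by
  obtain ⟨M, hM⟩ := exists_abs_div_le hb m 0 T
  obtain ⟨n, rfl⟩ := Nat.exists_eq_add_of_le' hm
  set c : ℝ → ℕ → ℝ := fun t i => b t i / ((i : ℝ) + 2) ^ (n + 2) with hc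
  set N : (ℕ → ℝ) → ℕ → ℝ := neighbourSum l d u with hN
  have hd2 : ∀ i t, HasDerivAt (fun s => N (c s) i) (N (N (c t)) i) t := fun i t =>
    hasDerivAt_neighbourSum (x' := fun i t => N (c t) i) (fun j => hd j t) l d u i
  have hcont : ∀ i, Continuous fun t => c t i := fun i =>
    continuous_iff_continuousAt.2 fun t => (hd i t).continuousAt
  have hcont2 : ∀ i, Continuous fun t => N (N (c t)) i := fun i =>
    continuous_neighbourSum (fun j => continuous_neighbourSum hcont l d u j) l d u i
  set M1 := (2 ^ (n + 1) + 2) * (C * M) with hM1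
  set M2 := (2 ^ n + 2) * (C * M1) with hM2
  have hb1 : ∀ t ∈ Icc 0 T, ∀ i : ℕ, |N (c t) i| ≤ M1 / ((i : ℝ) + 2) ^ (n + 1) :=
    fun t ht => h.abs_neighbourSum_le (hM t ht)
  have hb2 : ∀ t ∈ Icc 0 T, ∀ i : ℕ, |N (N (c t)) i| ≤ M2 / ((i : ℝ) + 2) ^ n :=
    fun t ht => h.abs_neighbourSum_le (hb1 t ht)
  -- The weight is `i + 2 = k + 1`, which may be replaced by the smaller `k = i + 1`; a single
  -- constant then serves all three derivatives.
  have hle : ∀ {A a : ℝ} {p i : ℕ}, |a| ≤ A / ((i : ℝ) + 2) ^ p → A ≤ |M| + |M1| + |M2| →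
      |a| ≤ (|M| + |M1| + |M2|) / ((i + 1 : ℕ) : ℝ) ^ p := fun {A a p i} ha hA => by
    refine ha.trans ?_
    push_cast
    gcongr
    norm_num
  refine ⟨|M| + |M1| + |M2|, fun k hk => ?_⟩
  obtain ⟨i, rfl⟩ := Nat.exists_eq_add_of_le' hk
  have hcoeff : (fun t => coeff (i + 1) (profile (c t))) = fun t => c t i :=
    funext fun t => coeff_profile (summable_abs_seq_div (b t) hm) i
  have hC2 : ContDiff ℝ 2 fun t => c t i := contDiff_two_of_hasDerivAt (hd i) (hd2 i) (hcont2 i)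
  obtain ⟨e0, e1, e2⟩ := iteratedDeriv_le_two (hd i) (hd2 i)
  have hn0 := abs_nonneg M
  have hn1 := abs_nonneg M1
  have hn2 := abs_nonneg M2
  rw [hcoeff]
  refine ⟨hC2.contDiffOn, fun j hj t ht => ?_⟩
  rw [iteratedDerivWithin_eq_iteratedDeriv (uniqueDiffOn_Icc hT)
    (hC2.of_le (by exact_mod_cast hj)).contDiffAt ht]
  interval_cases j
  · rw [e0]
    exact hle (hM t ht i) (by linarith [le_abs_self M])
  · rw [e1]
    exact hle (hb1 t ht i) (by linarith [le_abs_self M1])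
  · rw [e2]
    exact hle (hb2 t ht i) (by linarith [le_abs_self M2])

/-- The coefficients decay like (i+2)^{-m} and their time derivatives like (i+2)^{-(m-1)}; both are
summable, so the series can be differentiated term by term in `t` and `θ`. -/
theorem isClassicalOddSolution_profile {σ : ℝ} (hσ : |σ| ≤ 1) {m : ℕ} (hm : 3 < m)
    {b : ℝ → Seq} (hb : Continuous b)
    (hd : ∀ i t, HasDerivAt (fun s => b s i / ((i : ℝ) + 2) ^ m)
        (neighbourSum (fun i => -coupling σ i) (modeDiag σ) (coupling σ)
          (fun j => b t j / ((j : ℝ) + 2) ^ m) i) t) (T : ℝ) :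
    IsClassicalOddSolution σ T (profile fun i => b 0 i / ((i : ℝ) + 2) ^ m)
      fun t => profile fun i => b t i / ((i : ℝ) + 2) ^ m := by
  have hA := almostSkew_mode hσ
  obtain ⟨n, rfl⟩ := Nat.exists_eq_add_of_le' (by omega : 3 ≤ m)
  set c : ℝ → ℕ → ℝ := fun t i => b t i / ((i : ℝ) + 2) ^ (n + 3) with hc
  have hsum : ∀ t, Summable fun i => |c t i| := fun t => summable_abs_seq_div (b t) (by omega)
  have hcont : ∀ i, Continuous fun t => c t i := fun i =>
    continuous_iff_continuousAt.2 fun t => (hd i t).continuousAt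
  have hbound : ∀ R, ∃ v : ℕ → ℝ, Summable v ∧ ∀ t ∈ Ioo (-R) R, ∀ i, |c t i| ≤ v i ∧
      |neighbourSum (fun i => -coupling σ i) (modeDiag σ) (coupling σ) (c t) i| ≤ v i := fun R => by
    obtain ⟨M, hM⟩ := exists_abs_div_le hb (n + 3) (-R) R
    set M' := (2 ^ (n + 2) + 2) * (10 * M) with hM'
    refine ⟨fun i => (|M| + |M'|) * (((i : ℝ) + 2) ^ 2)⁻¹, summable_inv_add_two_sq.mul_left _,
      fun t ht i => ?_⟩
    have hle : ∀ {A a : ℝ} {p : ℕ}, 2 ≤ p → |a| ≤ A / ((i : ℝ) + 2) ^ p → A ≤ |M| + |M'| →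
        |a| ≤ (|M| + |M'|) * (((i : ℝ) + 2) ^ 2)⁻¹ := fun {A a p} hp ha hA => by
      refine ha.trans ?_
      rw [← div_eq_mul_inv]
      gcongr
      linarith [(Nat.cast_nonneg i : (0 : ℝ) ≤ i)]
    have hMt := hM t (Ioo_subset_Icc_self ht)
    exact ⟨hle (by omega) (hMt i) (by linarith [le_abs_self M, abs_nonneg M']),
      hle (by omega) (hA.abs_neighbourSum_le hMt i) (by linarith [le_abs_self M', abs_nonneg M])⟩
  refine ⟨?_, fun t _ => profile_periodic _, fun t _ => profile_odd _, fun θ => rfl, fun t _ =>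
    ⟨velocity (c t), isVelocity_velocity (hsum t), fun θ => ?_⟩⟩
  · exact (contDiff_tsum_mul_mode hd
      (fun i => continuous_neighbourSum hcont _ _ _ i) hbound).contDiffOn
  -- The extra factor `i + 2` pays for the linear growth of `coupling` when the bracket is summed
  -- mode by mode.
  · have hw : Summable fun i : ℕ => |c t i| * ((i : ℝ) + 2) := by
      have := summable_abs_seq_div (b t) (m := n + 2) (by omega)
      refine this.congr fun i => ?_
      rw [hc]
      simp only [abs_div, abs_of_pos (by positivity : (0 : ℝ) < ((i : ℝ) + 2) ^ (n + 3)),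
        abs_of_pos (by positivity : (0 : ℝ) < ((i : ℝ) + 2) ^ (n + 2))]
      rw [pow_succ _ (n + 2)]
      field_simp
    rw [bracket_profile σ hσ hw]
    exact (hasDerivAt_tsum_mul_mode hd hbound t θ).hasDerivWithinAt

theorem IsAdmissibleData.exists_solution {m : ℕ} (hm : 3 < m) {η₀ : ℝ → ℝ}
    (h : IsAdmissibleData m η₀) {σ T : ℝ} (hσ : |σ| ≤ 1) (hT : 0 < T) :
    ∃ η : ℝ → ℝ → ℝ, IsClassicalOddSolution σ T η₀ η ∧
      HasWeightedRegularity (Nat.sub_le m 2) T η ∧ HasCoeffDecay m T η := by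
  obtain ⟨x, rfl⟩ := h.exists_eq_profile (by omega)
  obtain ⟨b, hb, rfl, hb2, hd⟩ := (almostSkew_mode hσ).exists_weighted_flow m x
  exact ⟨_, isClassicalOddSolution_profile hσ hm hb hd T,
    hasWeightedRegularity_profile (by omega) hb hb2 T,
    hasCoeffDecay_profile (almostSkew_mode hσ) (by omega) hb hd hT⟩

end MHD

end

theorem mainTheorem1 (m : ℕ) (hm : 3 < m) (η₀p η₀m : ℝ → ℝ)
    (hp : MHD.IsAdmissibleData m η₀p) (hn : MHD.IsAdmissibleData m η₀m) (T : ℝ) (hT : 0 < T) :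
    ∃ ηp ηm : ℝ → ℝ → ℝ,
      MHD.IsClassicalOddSolutionPair T η₀p η₀m ηp ηm ∧
      (∀ ζp ζm : ℝ → ℝ → ℝ, MHD.IsClassicalOddSolutionPair T η₀p η₀m ζp ζm →
        ∀ t ∈ Set.Icc 0 T, ∀ θ : ℝ, ζp t θ = ηp t θ ∧ ζm t θ = ηm t θ) ∧
      MHD.HasWeightedRegularity (Nat.sub_le m 2) T ηp ∧
      MHD.HasWeightedRegularity (Nat.sub_le m 2) T ηm ∧
      MHD.HasCoeffDecay m T ηp ∧
      MHD.HasCoeffDecay m T ηm := by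
  have h1 : |(1 : ℝ)| ≤ 1 := by simp
  have h2 : |(-1 : ℝ)| ≤ 1 := by simp
  obtain ⟨ηp, hηp, hrp, hdp⟩ := hp.exists_solution hm h1 hT
  obtain ⟨ηm, hηm, hrm, hdm⟩ := hn.exists_solution hm h2 hT
  exact ⟨ηp, ηm, ⟨hηp, hηm⟩, fun ζp ζm hζ t ht θ =>
    ⟨congrFun (hηp.unique h1 hζ.1 ht) θ, congrFun (hηm.unique h2 hζ.2 ht) θ⟩, hrp, hrm, hdp, hdm⟩
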